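/- **Setting.** Let $w\colon\mathbb R^d\to[1,\infty)$ be $C^\infty$ with $w(x)=|x|^p$ for $|x|>2$, for some $p\in(0,\infty)$. Write $\langle\varphi,\mu\rangle=\int\varphi\,d\mu$. Let $\mathcal P_w$ be the set of probability measures $\mu$ on $\mathbb R^d$ with $\langle w,\mu\rangle<\infty$, with the topology in which $\mu_n\to\mu$ iff $\mu_n\Rightarrow\mu$ weakly and $\langle w,\mu_n\rangle\to\langle w,\mu\rangle$. Let $(\mathbb R^d)^\Delta$ be the one-point compactification of $\mathbb R^d$, regard $w\mu$ ($\mu\in\mathcal P_w$) as a finite measure on it, and let $\mathcal X$ be the closure of $\{w\mu:\mu\in\mathcal P_w\}$ in the space of finite positive measures on $(\mathbb R^d)^\Delta$ with the weak topology. Let $\mathbb S^d$ be the symmetric real $d\times d$ matrices. Let $C_w^\infty$ be the linear span of $w$ and $C_c^\infty(\mathbb R^d)$. Let $\mathcal D_w$ be the algebra (without unit) generated by the functions $\mu\mapsto\langle\varphi,\mu\rangle e^{-\langle w,\mu\rangle}$, $\varphi\in C_c^\infty(\mathbb R^d)$, and $\mathcal E_w$ the algebra generated by the functions $\mu\mapsto\langle\varphi,\mu\rangle$,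 $\varphi\in C_w^\infty$ (constants may be included). These are functions of signed measures $\mu$, with $e^{-\langle w,\mu\rangle}:=0$ if $\langle w,|\mu|\rangle=\infty$; put $\partial_xf(\mu)=\lim_{\varepsilon\to0}\varepsilon^{-1}(f(\mu+\varepsilon\delta_x)-f(\mu))$, $\partial^2_{xy}f=\partial_x\partial_yf$. **Operator.** Let $b\colon\mathcal P_w\times\mathbb R^d\to\mathbb R^d$ and $\sigma,\tau\colon\mathcal P_w\times\mathbb R^d\to\mathbb S^d$ be of the form $b_\mu(x)=\widetilde b_{w\mu}(x)$, $\sigma_\mu(x)=\widetilde\sigma_{w\mu}(x)$, $\tau_\mu(x)=\widetilde\tau_{w\mu}(x)$ for continuous maps $\widetilde b\colon\mathcal X\times\mathbb R^d\to\mathbb R^d$ and $\widetilde\sigma,\widetilde\tau\colon\mathcal X\times\mathbb R^d\to\mathbb S^d$ such that for all $i,j$ the maps $$\nu\mapsto\frac{\widetilde b_{\nu,i}(\cdot)}{1+|\cdot|},\qquad \nu\mapsto\frac{\widetilde\sigma_{\nu,ij}(\cdot)^2}{1+|\cdot|^2},\qquad \nu\mapsto\frac{\widetilde\tau_{\nu,ij}(\cdot)}{1+|\cdot|}$$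 are continuous from $\mathcal X$ to $\mathbb R+C_0(\mathbb R^d)$ (supremum norm), and such that for some constant $c\ge0$ $$\sup_{x\in\mathbb R^d}\frac{|x|\,|\widetilde b_\nu(x)|+|\widetilde\sigma_\nu(x)|^2+|\widetilde\tau_\nu(x)|^2}{1+|x|^2}\le c\qquad\text{for all }\nu\in\mathcal X.$$ For $f\in\mathcal D_w\cup\mathcal E_w$ and $\mu\in\mathcal P_w$ let $$Lf(\mu)=\langle B_\mu(\partial f(\mu)),\mu\rangle+\tfrac12\langle Q_\mu(\partial^2f(\mu)),\mu\otimes\mu\rangle,$$ where $B_\mu(\varphi)=b_\mu^\top\nabla\varphi+\tfrac12\operatorname{tr}((\sigma_\mu^2+\tau_\mu^2)\nabla^2\varphi)$ and $Q_\mu$ is the linear operator with $Q_\mu(\varphi\otimes\psi)(x,y)=\sum_{i=1}^d(\tau_\mu\nabla\varphi)_i(x)\,(\tau_\mu\nabla\psi)_i(y)$. For $\mathcal D=\mathcal D_w$ or $\mathcal E_w$, a solution of the martingale problem for $(L,\mathcal D,\mathcal P_w)$ with initial condition $\overline\mu\in\mathcal P_w$ is a $\mathcal P_w$-valued adapted process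 $X$ with right-continuous paths with left limits on a filtered probability space, with $X_0=\overline\mu$ a.s., such that $M^f_t:=f(X_t)-f(X_0)-\int_0^tLf(X_s)\,ds$, $t\ge0$, is a (well-defined) local martingale for every $f\in\mathcal D$. **Proposition.** Let $\overline\mu\in\mathcal P_w$. There is a constant $C>0$ (which may depend on $w,b,\sigma,\tau,\overline\mu$) such that every solution $X$ of the martingale problem for $(L,\mathcal D_w,\mathcal P_w)$ with initial condition $\overline\mu$ satisfies: 1. $\langle w,X_t\rangle^k$ is integrable and $\mathbb E[\langle w,X_t\rangle^k]\le\langle w,\overline\mu\rangle^k\,e^{k(k+1)Ct}$ for all $k\in\mathbb N$ and $t\ge0$; 2. $X$ solves the martingale problem for $(L,\mathcal E_w,\mathcal P_w)$. Moreover, for every $f\in\mathcal E_w$, $M^f$ is a true martingale and $\mathbb E[|M^f_t|^k]<\infty$ for all $k\in\mathbb N$ and $t\ge0$. -/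

import Mathlib

open MeasureTheory ProbabilityTheory Filter Topology
open scoped NNReal ENNReal BoundedContinuousFunction

noncomputable section

namespace MVJD

/-- The underlying space `ℝᵈ` with its Euclidean norm. -/
abbrev Rd (d : ℕ) : Type := EuclideanSpace ℝ (Fin d)

variable {d : ℕ}

/-- The one-point compactification of `ℝᵈ` carries its Borel σ-algebra. -/
instance instMeasurableSpaceOnePointRd : MeasurableSpace (OnePoint (Rd d)) := borel _

instance instBorelSpaceOnePointRd : BorelSpace (OnePoint (Rd d)) := ⟨rfl⟩

/-- The weight function: a smooth `w : ℝᵈ → [1, ∞)` which equals `|x|^p` for `|x| > 2`, for some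
`p ∈ (0, ∞)`. -/
structure IsWeight (w : Rd d → ℝ) : Prop where
  smooth : ContDiff ℝ (⊤ : ℕ∞) w
  one_le : ∀ x, 1 ≤ w x
  eq_rpow : ∃ p : ℝ, 0 < p ∧ ∀ x, 2 < ‖x‖ → w x = ‖x‖ ^ p

/-- The set of probability measures on `ℝᵈ` with finite `w`-moment. -/
@[ext] structure Pw (w : Rd d → ℝ) where
  /-- the underlying probability measure -/
  prob : ProbabilityMeasure (Rd d)
  integrable : Integrable w (prob : Measure (Rd d))

namespace Pw

variable {w : Rd d → ℝ}

/-- `μ ∈ 𝒫_w` as a measure. -/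
abbrev meas (μ : Pw w) : Measure (Rd d) := (μ.prob : Measure (Rd d))

/-- `⟨w, μ⟩`. -/
def moment (μ : Pw w) : ℝ := ∫ x, w x ∂μ.meas

/-- The topology of `𝒫_w`: `μₙ → μ` iff `μₙ ⇒ μ` weakly and `⟨w, μₙ⟩ → ⟨w, μ⟩`. -/
instance instTopologicalSpace : TopologicalSpace (Pw w) :=
  TopologicalSpace.induced (fun μ : Pw w => (μ.prob, μ.moment)) inferInstance

/-- `μ ∈ 𝒫_w` as an element of the space `M(ℝᵈ)` of signed measures. -/
def signed (μ : Pw w) : SignedMeasure (Rd d) := μ.meas.toSignedMeasure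

/-- The measure `w μ` is finite. -/
theorem isFiniteMeasure_withDensity (μ : Pw w) :
    IsFiniteMeasure (μ.meas.withDensity fun x => ENNReal.ofReal (w x)) :=
  isFiniteMeasure_withDensity_ofReal μ.integrable.2

/-- The embedding `T : 𝒫_w → M₊((ℝᵈ)^Δ)`, `T(μ)(dx) = w(x) μ(dx ∩ ℝᵈ)`. -/
def embed (μ : Pw w) : FiniteMeasure (OnePoint (Rd d)) :=
  ⟨(μ.meas.withDensity fun x => ENNReal.ofReal (w x)).map ((↑) : Rd d → OnePoint (Rd d)),
    haveI := μ.isFiniteMeasure_withDensity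
    inferInstance⟩

end Pw

/-- The locally compact space `𝒳`: the weak closure of `T(𝒫_w)` in `M₊((ℝᵈ)^Δ)`, with the weak
topology. -/
abbrev XSpace (w : Rd d → ℝ) : Type :=
  {ν : FiniteMeasure (OnePoint (Rd d)) // ν ∈ closure (Set.range (Pw.embed (w := w)))}

/-- The map `T`, with values in `𝒳`. -/
def Pw.toX {w : Rd d → ℝ} (μ : Pw w) : XSpace w := ⟨μ.embed, subset_closure ⟨μ, rfl⟩⟩

/-! ### Functions of measures -/

/-- The pairing `⟨φ, μ⟩` for a signed measure `μ`. -/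
def pairing (φ : Rd d → ℝ) (μ : SignedMeasure (Rd d)) : ℝ :=
  μ.integral φ (ContinuousLinearMap.lsmul ℝ ℝ).flip

open Classical in
/-- `exp(-⟨w, μ⟩)`, with the convention that this is `0` if `⟨w, |μ|⟩ = ∞`. -/
def expNeg (w : Rd d → ℝ) (μ : SignedMeasure (Rd d)) : ℝ :=
  if Integrable w μ.variation then Real.exp (-pairing w μ) else 0

/-- `C_c^∞(ℝᵈ)`. -/
def testFunctions (d : ℕ) : Set (Rd d → ℝ) := {φ | ContDiff ℝ (⊤ : ℕ∞) φ ∧ HasCompactSupport φ}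

/-- `C_w^∞`, the linear span of `w` and `C_c^∞(ℝᵈ)`. -/
def Cw (w : Rd d → ℝ) : Submodule ℝ (Rd d → ℝ) := Submodule.span ℝ (insert w (testFunctions d))

/-- `𝒟_w`, the algebra (without unit) generated by `μ ↦ ⟨φ, μ⟩ exp(-⟨w, μ⟩)`, `φ ∈ C_c^∞(ℝᵈ)`. -/
def Dw (w : Rd d → ℝ) : Set (SignedMeasure (Rd d) → ℝ) :=
  NonUnitalAlgebra.adjoin ℝ {f | ∃ φ ∈ testFunctions d, f = fun μ => pairing φ μ * expNeg w μ}

/-- `ℰ_w`, the algebra generated by `μ ↦ ⟨φ, μ⟩`, `φ ∈ C_w^∞`. -/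
def Ew (w : Rd d → ℝ) : Set (SignedMeasure (Rd d) → ℝ) :=
  Algebra.adjoin ℝ {f | ∃ φ ∈ Cw w, f = pairing φ}

/-- `∂_x f(μ) = lim_{ε → 0} (f(μ + ε δ_x) - f(μ)) / ε`. -/
def measDeriv (x : Rd d) (f : SignedMeasure (Rd d) → ℝ) (μ : SignedMeasure (Rd d)) : ℝ :=
  deriv (fun ε : ℝ => f (μ + ε • (Measure.dirac x).toSignedMeasure)) 0

/-! ### The operator -/

/-- Partial derivative `∂_i φ`. -/
def partialDeriv (i : Fin d) (φ : Rd d → ℝ) (x : Rd d) : ℝ :=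
  fderiv ℝ φ x (EuclideanSpace.single i 1)

section Operator

variable {w : Rd d → ℝ}

/-- `B_μ(φ) = b_μᵀ ∇φ + ½ tr((σ_μ² + τ_μ²) ∇²φ)`. -/
def driftOp (b : Pw w → Rd d → Rd d) (σ τ : Pw w → Rd d → Matrix (Fin d) (Fin d) ℝ) (μ : Pw w)
    (φ : Rd d → ℝ) (x : Rd d) : ℝ :=
  ∑ i, b μ x i * partialDeriv i φ x +
    (1 / 2) * ∑ i, ∑ j, (σ μ x * σ μ x + τ μ x * τ μ x) i j * partialDeriv j (partialDeriv i φ) x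

/-- The linear operator `Q_μ` acting on functions `ψ` of `(x, y)`; on `ψ = φ ⊗ φ` it is
`(τ_μ ∇φ) ⊗ (τ_μ ∇φ) = ∑ i, (τ_μ ∇φ)_i(x) (τ_μ ∇φ)_i(y)`. -/
def diffusionOp (τ : Pw w → Rd d → Matrix (Fin d) (Fin d) ℝ) (μ : Pw w)
    (ψ : Rd d → Rd d → ℝ) (x y : Rd d) : ℝ :=
  ∑ i, ∑ k, ∑ l, τ μ x i k * τ μ y i l *
    partialDeriv k (fun x' => partialDeriv l (fun y' => ψ x' y') y) x

/-- `Lf(μ) = ⟨B_μ(∂f(μ)), μ⟩ + ½ ⟨Q_μ(∂²f(μ)), μ²⟩` for `μ ∈ 𝒫_w`. -/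
def generator (b : Pw w → Rd d → Rd d) (σ τ : Pw w → Rd d → Matrix (Fin d) (Fin d) ℝ)
    (f : SignedMeasure (Rd d) → ℝ) (μ : Pw w) : ℝ :=
  ∫ x, driftOp b σ τ μ (fun y => measDeriv y f μ.signed) x ∂μ.meas +
    (1 / 2) * ∫ z : Rd d × Rd d,
      diffusionOp τ μ (fun x y => measDeriv x (measDeriv y f) μ.signed) z.1 z.2
        ∂(μ.meas.prod μ.meas)

/-- `g` is continuous as a map from `𝒳` to the Banach space `ℝ + C₀(ℝᵈ)` (continuous functions with
a limit at infinity) with the supremum norm. -/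
def IsContinuousIntoRAddC0 (g : XSpace w → Rd d → ℝ) : Prop :=
  ∃ G : XSpace w → (Rd d →ᵇ ℝ), Continuous G ∧
    ∀ ν, (∃ a : ℝ, Tendsto (G ν) (cocompact (Rd d)) (𝓝 a)) ∧ ∀ x, G ν x = g ν x

/-- The conditions on the coefficients `b`, `σ`, `τ`, with growth exponent `γ`. -/
def CoefficientConditions (γ : ℝ) (b : Pw w → Rd d → Rd d)
    (σ τ : Pw w → Rd d → Matrix (Fin d) (Fin d) ℝ) : Prop :=
  ∃ (b' : XSpace w → Rd d → Rd d) (σ' τ' : XSpace w → Rd d → Matrix (Fin d) (Fin d) ℝ),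
    (∀ μ x, b μ x = b' μ.toX x) ∧ (∀ μ x, σ μ x = σ' μ.toX x) ∧ (∀ μ x, τ μ x = τ' μ.toX x) ∧
    (∀ ν x, (σ' ν x).IsSymm) ∧ (∀ ν x, (τ' ν x).IsSymm) ∧
    Continuous (fun q : XSpace w × Rd d => b' q.1 q.2) ∧
    Continuous (fun q : XSpace w × Rd d => σ' q.1 q.2) ∧
    Continuous (fun q : XSpace w × Rd d => τ' q.1 q.2) ∧
    (∀ i, IsContinuousIntoRAddC0 fun (ν : XSpace w) x => b' ν x i / (1 + ‖x‖)) ∧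
    (∀ i j, IsContinuousIntoRAddC0 fun (ν : XSpace w) x => (σ' ν x i j) ^ 2 / (1 + ‖x‖ ^ 2)) ∧
    (∀ i j, IsContinuousIntoRAddC0 fun (ν : XSpace w) x => τ' ν x i j / (1 + ‖x‖)) ∧
    ∃ c : ℝ, 0 ≤ c ∧ ∀ (ν : XSpace w) (x : Rd d),
      (‖x‖ * ‖b' ν x‖ + (∑ i, ∑ j, (σ' ν x i j) ^ 2) + ∑ i, ∑ j, (τ' ν x i j) ^ 2) / (1 + ‖x‖ ^ 2)
        ≤ c * (ν.1.mass : ℝ) ^ γ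

end Operator

/-! ### The martingale problem -/

section MartingaleProblem

variable {w : Rd d → ℝ} {Ω : Type*} [MeasurableSpace Ω]

/-- Right-continuous paths with left limits (everywhere, in the state space). -/
def IsRCLL {S : Type*} [TopologicalSpace S] (X : ℝ≥0 → Ω → S) : Prop :=
  ∀ ω t, ContinuousWithinAt (fun s => X s ω) (Set.Ici t) t ∧
    ∃ l, Tendsto (fun s => X s ω) (𝓝[<] t) (𝓝 l)

/-- The process `f(X_t) - f(X_0) - ∫₀ᵗ Lf(X_s) ds`. -/
def mgProcess (L : (SignedMeasure (Rd d) → ℝ) → Pw w → ℝ) (X : ℝ≥0 → Ω → Pw w)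
    (f : SignedMeasure (Rd d) → ℝ) (t : ℝ≥0) (ω : Ω) : ℝ :=
  f (X t ω).signed - f (X 0 ω).signed - ∫ s in (0 : ℝ)..t, L f (X s.toNNReal ω)

/-- `X` is a solution, on the filtered probability space `(Ω, ℱ, P)`, to the martingale problem for
`(L, 𝒟, 𝒫_w)` with initial condition `μ₀`. -/
structure SolvesMartingaleProblem (L : (SignedMeasure (Rd d) → ℝ) → Pw w → ℝ)
    (𝒟 : Set (SignedMeasure (Rd d) → ℝ)) (μ₀ : Pw w) (P : Measure Ω)
    (ℱ : Filtration ℝ≥0 ‹MeasurableSpace Ω›) (X : ℝ≥0 → Ω → Pw w) : Prop where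
  adapted : StronglyAdapted ℱ X
  rcll : IsRCLL X
  initial : ∀ᵐ ω ∂P, X 0 ω = μ₀
  /-- the time integrals exist -/
  intervalIntegrable : ∀ f ∈ 𝒟, ∀ ω (t : ℝ≥0),
    IntervalIntegrable (fun s : ℝ => L f (X s.toNNReal ω)) volume 0 t
  localMartingale : ∀ f ∈ 𝒟,
    Locally (fun M : ℝ≥0 → Ω → ℝ => Martingale M ℱ P) ℱ (mgProcess L X f) P

end MartingaleProblem

end MVJD

end

/-!
The functional `z = ⟨w, ·⟩` should satisfy `L (z ^ k) ≤ k (k + 1) C z ^ k`, and Gronwall's inequality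
would then give the moment bound. Neither `z ^ k` nor the polynomials in `ℰ_w` belong to `𝒟_w`, so the
martingale property has to be transported from `𝒟_w` to larger classes.

*Jets.* The value `f(μ)`, the gradient along the `d` noise directions and the drift `L f(μ)` form an
element of the commutative ring `Jet d`, in which multiplication is the Itô product rule and
`Jet.comp` is Itô's formula. `HasJet.generator_eq` identifies these components for the functions
generated by pairings and `exp (-⟨w, ·⟩)`.

*A subtlety.* The growth condition controls `|x| |b|`, hence not the size of `b` near the origin,
which may grow with the mass of `w μ`. There is only a bound `|b_μ(x)| ≤ κ(μ) (1 + |x|)` with `κ`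
continuous on `𝒫_w` and bounded on sets of bounded moment (by compactness of these sets in `𝒳`). So
`L f` may be unbounded even for `f ∈ 𝒟_w`. The weight `w` is therefore split into a test function
`innerWeight w` and `outerWeight w`, which is constant near the origin and whose drift needs no `κ`.

*The closure.* `Core` is the closure of the jets of `𝒟_w` under pointwise limits with value and
gradient bounded and drift `O(κ)`. Along a solution these jets yield martingales after discounting
by `exp (-l ∫ κ(X))`; letting `l → 0`, `Core.hasDrift` gives true martingales for the jets in the
class with bounded drift. Polynomial approximation shows that the class is an algebra, closed under
`C²` functions, and contains the truncations in the outer weight of all `f ∈ ℰ_w`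
(`exists_locCore_of_mem_Ew`).

*Moments.* `exists_lyapunov` constructs bounded substitutes of `z` in the class: a concave
truncation of the outer weight plus a constant bounding the inner weight, corrected on a bounded set
so that the value at the initial condition is exactly `⟨w, μ₀⟩`. Gronwall's inequality and Fatou's
lemma give the first assertion.

*Polynomials.* For a truncation of `f ∈ ℰ_w`, the martingale `M` has drift-free dynamics with
squared gradient `Γ`, and `M ^ (2 k)` has drift `k (2 k - 1) M ^ (2 k - 2) Γ`
(`hasDrift_pow_mul_pow`, which needs no stochastic integration: only the product rule with the
absolutely continuous compensator). Adding a power of the Lyapunov function that dominates `Γ ^ k`,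
Gronwall's inequality bounds the moments uniformly in the truncation
(`integral_compensated_pow_le`). As the truncation parameter grows the martingales become eventually
constant along each path, so boundedness in `L²` makes the limit a martingale.
-/

noncomputable section

namespace MVJD

/-! ### The ring of Itô jets -/

/-- The second order Itô jet of a functional `f` of a measure-valued process at a point: its value,
its gradient along the `d` noise directions and its drift `Lf`. The product
`(r, s, t) (r', s', t') = (r r', r s' + r' s, r t' + r' t + s · s')` encodes the Itô product rule. -/
@[ext] structure Jet (d : ℕ) where
  /-- the value -/
  val : ℝ
  /-- the derivatives along the noise -/
  grad : Fin d → ℝ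
  /-- the drift -/
  drift : ℝ

namespace Jet

variable {d : ℕ}

instance : Zero (Jet d) := ⟨⟨0, 0, 0⟩⟩
instance : One (Jet d) := ⟨⟨1, 0, 0⟩⟩
instance : Add (Jet d) := ⟨fun J K => ⟨J.val + K.val, J.grad + K.grad, J.drift + K.drift⟩⟩
instance : Neg (Jet d) := ⟨fun J => ⟨-J.val, -J.grad, -J.drift⟩⟩
instance : Mul (Jet d) := ⟨fun J K => ⟨J.val * K.val, fun i => J.val * K.grad i + K.val * J.grad i,
  J.val * K.drift + K.val * J.drift + ∑ i, J.grad i * K.grad i⟩⟩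
instance : SMul ℝ (Jet d) := ⟨fun c J => ⟨c * J.val, fun i => c * J.grad i, c * J.drift⟩⟩

@[simp] theorem zero_val : (0 : Jet d).val = 0 := rfl
@[simp] theorem zero_grad (i : Fin d) : (0 : Jet d).grad i = 0 := rfl
@[simp] theorem zero_drift : (0 : Jet d).drift = 0 := rfl
@[simp] theorem one_val : (1 : Jet d).val = 1 := rfl
@[simp] theorem one_grad (i : Fin d) : (1 : Jet d).grad i = 0 := rfl
@[simp] theorem one_drift : (1 : Jet d).drift = 0 := rfl
@[simp] theorem add_val (J K : Jet d) : (J + K).val = J.val + K.val := rfl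
@[simp] theorem add_grad (J K : Jet d) (i : Fin d) : (J + K).grad i = J.grad i + K.grad i := rfl
@[simp] theorem add_drift (J K : Jet d) : (J + K).drift = J.drift + K.drift := rfl
@[simp] theorem neg_val (J : Jet d) : (-J).val = -J.val := rfl
@[simp] theorem neg_grad (J : Jet d) (i : Fin d) : (-J).grad i = -J.grad i := rfl
@[simp] theorem neg_drift (J : Jet d) : (-J).drift = -J.drift := rfl
@[simp] theorem mul_val (J K : Jet d) : (J * K).val = J.val * K.val := rfl
@[simp] theorem mul_grad (J K : Jet d) (i : Fin d) :
    (J * K).grad i = J.val * K.grad i + K.val * J.grad i := rfl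
@[simp] theorem mul_drift (J K : Jet d) :
    (J * K).drift = J.val * K.drift + K.val * J.drift + ∑ i, J.grad i * K.grad i := rfl
@[simp] theorem smul_val (c : ℝ) (J : Jet d) : (c • J).val = c * J.val := rfl
@[simp] theorem smul_grad (c : ℝ) (J : Jet d) (i : Fin d) : (c • J).grad i = c * J.grad i := rfl
@[simp] theorem smul_drift (c : ℝ) (J : Jet d) : (c • J).drift = c * J.drift := rfl

instance : CommRing (Jet d) where
  add_assoc J K L := by ext <;> simp [add_assoc]
  zero_add J := by ext <;> simp
  add_zero J := by ext <;> simp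
  add_comm J K := by ext <;> simp [add_comm]
  nsmul := nsmulRec
  zsmul := zsmulRec
  neg_add_cancel J := by ext <;> simp
  mul_assoc J K L := by
    ext <;> simp only [mul_val, mul_grad, mul_drift, mul_add, add_mul, Finset.sum_add_distrib,
      Finset.mul_sum] <;> ring_nf
  one_mul J := by ext <;> simp
  mul_one J := by ext <;> simp
  left_distrib J K L := by
    ext <;> simp only [mul_val, mul_grad, mul_drift, add_val, add_grad, add_drift, mul_add,
      Finset.sum_add_distrib] <;> ring
  right_distrib J K L := by
    ext <;> simp only [mul_val, mul_grad, mul_drift, add_val, add_grad, add_drift, add_mul,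
      Finset.sum_add_distrib] <;> ring
  zero_mul J := by ext <;> simp
  mul_zero J := by ext <;> simp
  mul_comm J K := by
    ext <;> simp only [mul_val, mul_grad, mul_drift, mul_comm] <;> ring

instance : Module ℝ (Jet d) where
  one_smul J := by ext <;> simp
  mul_smul a b J := by ext <;> simp [mul_assoc]
  smul_zero a := by ext <;> simp
  smul_add a J K := by ext <;> simp [mul_add]
  add_smul a b J := by ext <;> simp [add_mul]
  zero_smul J := by ext <;> simp

instance : Algebra ℝ (Jet d) := Algebra.ofModule
  (fun a J K => by
    ext <;> simp only [mul_val, mul_grad, mul_drift, smul_val, smul_grad, smul_drift, mul_add,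
      Finset.mul_sum, mul_assoc] <;> ring_nf)
  (fun a J K => by
    ext <;> simp only [mul_val, mul_grad, mul_drift, smul_val, smul_grad, smul_drift, mul_add,
      Finset.mul_sum, mul_left_comm] <;> ring_nf)

@[simp] theorem sub_val (J K : Jet d) : (J - K).val = J.val - K.val := by
  simp [sub_eq_add_neg]
@[simp] theorem sub_grad (J K : Jet d) (i : Fin d) : (J - K).grad i = J.grad i - K.grad i := by
  simp [sub_eq_add_neg]
@[simp] theorem sub_drift (J K : Jet d) : (J - K).drift = J.drift - K.drift := by
  simp [sub_eq_add_neg]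

@[simp] theorem algebraMap_val (c : ℝ) : (algebraMap ℝ (Jet d) c).val = c := by
  simp [Algebra.algebraMap_eq_smul_one]
@[simp] theorem algebraMap_grad (c : ℝ) (i : Fin d) : (algebraMap ℝ (Jet d) c).grad i = 0 := by
  simp [Algebra.algebraMap_eq_smul_one]
@[simp] theorem algebraMap_drift (c : ℝ) : (algebraMap ℝ (Jet d) c).drift = 0 := by
  simp [Algebra.algebraMap_eq_smul_one]

/-- The squared length of the gradient, i.e. the carré du champ of the functional. -/
def normSq (J : Jet d) : ℝ := ∑ i, J.grad i * J.grad i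

theorem normSq_nonneg (J : Jet d) : 0 ≤ J.normSq :=
  Finset.sum_nonneg fun _ _ => mul_self_nonneg _

theorem pow_val (J : Jet d) (n : ℕ) : (J ^ n).val = J.val ^ n := by
  induction n with
  | zero => simp
  | succ n ih => rw [pow_succ, mul_val, ih]; ring

theorem pow_grad (J : Jet d) (n : ℕ) (i : Fin d) :
    (J ^ n).grad i = n * J.val ^ (n - 1) * J.grad i := by
  induction n with
  | zero => simp
  | succ n ih =>
    rw [pow_succ, mul_grad, pow_val, ih]
    rcases n with _ | n
    · simp
    · push_cast
      ring

theorem pow_drift (J : Jet d) (n : ℕ) :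
    (J ^ n).drift = n * J.val ^ (n - 1) * J.drift
      + (n * (n - 1) / 2) * J.val ^ (n - 2) * J.normSq := by
  induction n with
  | zero => simp
  | succ n ih =>
    have h : ∑ i, (J ^ n).grad i * J.grad i = n * J.val ^ (n - 1) * J.normSq := by
      rw [normSq, Finset.mul_sum]
      exact Finset.sum_congr rfl fun i _ => by rw [pow_grad]; ring
    rw [pow_succ, mul_drift, ih, pow_val, h]
    rcases n with _ | _ | n
    · simp
    · norm_num; ring
    · push_cast
      ring

/-- Itô's formula: the jet of `F ∘ f` in terms of the jet of `f`. -/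
def comp (F : ℝ → ℝ) (J : Jet d) : Jet d :=
  ⟨F J.val, fun i => deriv F J.val * J.grad i,
    deriv F J.val * J.drift + deriv (deriv F) J.val / 2 * J.normSq⟩

@[simp] theorem comp_val (F : ℝ → ℝ) (J : Jet d) : (comp F J).val = F J.val := rfl
@[simp] theorem comp_grad (F : ℝ → ℝ) (J : Jet d) (i : Fin d) :
    (comp F J).grad i = deriv F J.val * J.grad i := rfl
theorem comp_drift (F : ℝ → ℝ) (J : Jet d) :
    (comp F J).drift = deriv F J.val * J.drift + deriv (deriv F) J.val / 2 * J.normSq := rfl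

theorem comp_congr {F G : ℝ → ℝ} {J : Jet d} (h : F =ᶠ[𝓝 J.val] G) : comp F J = comp G J := by
  ext
  · exact h.eq_of_nhds
  · simp [h.deriv_eq]
  · simp [comp_drift, h.deriv_eq, h.deriv.deriv_eq]

theorem comp_mul {F G : ℝ → ℝ} (hF : ContDiff ℝ 2 F) (hG : ContDiff ℝ 2 G) (J : Jet d) :
    comp (fun y => F y * G y) J = comp F J * comp G J := by
  have hF1 := hF.differentiable (by norm_num)
  have hG1 := hG.differentiable (by norm_num)
  have hF2 := ((contDiff_succ_iff_deriv (n := 1)).1 hF).2.2.differentiable (by norm_num)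
  have hG2 := ((contDiff_succ_iff_deriv (n := 1)).1 hG).2.2.differentiable (by norm_num)
  have h1 : deriv (fun y => F y * G y) = fun y => deriv F y * G y + F y * deriv G y := by
    funext y; exact deriv_fun_mul (hF1 y) (hG1 y)
  have h2 : deriv (deriv (fun y => F y * G y)) J.val = deriv (deriv F) J.val * G J.val
      + deriv F J.val * deriv G J.val + (deriv F J.val * deriv G J.val
      + F J.val * deriv (deriv G) J.val) := by
    rw [h1]
    exact (((hF2 _).hasDerivAt.mul (hG1 _).hasDerivAt).add
      ((hF1 _).hasDerivAt.mul (hG2 _).hasDerivAt)).deriv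
  ext
  · simp
  · simp [h1]; ring
  · rw [comp_drift, h2, h1]
    simp only [mul_drift, comp_val, comp_grad, comp_drift]
    have : ∑ i, deriv F J.val * J.grad i * (deriv G J.val * J.grad i)
        = deriv F J.val * deriv G J.val * J.normSq := by
      rw [normSq, Finset.mul_sum]; exact Finset.sum_congr rfl fun i _ => by ring
    rw [this]; ring

theorem comp_comp {F G : ℝ → ℝ} (hF : ContDiff ℝ 2 F) (hG : ContDiff ℝ 2 G) (J : Jet d) :
    comp (fun y => F (G y)) J = comp F (comp G J) := by
  have hF1 := hF.differentiable (by norm_num)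
  have hG1 := hG.differentiable (by norm_num)
  have hF2 := ((contDiff_succ_iff_deriv (n := 1)).1 hF).2.2.differentiable (by norm_num)
  have hG2 := ((contDiff_succ_iff_deriv (n := 1)).1 hG).2.2.differentiable (by norm_num)
  have h1 : deriv (fun y => F (G y)) = fun y => deriv F (G y) * deriv G y := by
    funext y; exact ((hF1 (G y)).hasDerivAt.comp y (hG1 y).hasDerivAt).deriv
  have h2 : deriv (deriv (fun y => F (G y))) J.val
      = deriv (deriv F) (G J.val) * deriv G J.val * deriv G J.val
        + deriv F (G J.val) * deriv (deriv G) J.val := by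
    rw [h1]
    exact (((hF2 (G J.val)).hasDerivAt.comp J.val (hG1 _).hasDerivAt).mul
      (hG2 J.val).hasDerivAt).deriv
  ext
  · simp
  · simp [h1]; ring
  · rw [comp_drift, h2, h1]
    simp only [comp_val, comp_drift]
    have : (comp G J).normSq = deriv G J.val * deriv G J.val * J.normSq := by
      rw [normSq, normSq, Finset.mul_sum]; exact Finset.sum_congr rfl fun i _ => by simp; ring
    rw [this]; ring

theorem comp_const (c : ℝ) (J : Jet d) : comp (fun _ => c) J = algebraMap ℝ (Jet d) c := by
  ext <;> simp [comp_drift]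

theorem comp_id (J : Jet d) : comp (fun y => y) J = J := by
  have h : deriv (fun y : ℝ => y) = fun _ => 1 := by funext y; simp
  ext <;> simp [comp_drift, h]

theorem comp_add {F G : ℝ → ℝ} (hF : ContDiff ℝ 2 F) (hG : ContDiff ℝ 2 G) (J : Jet d) :
    comp (fun y => F y + G y) J = comp F J + comp G J := by
  have hF1 := hF.differentiable (by norm_num)
  have hG1 := hG.differentiable (by norm_num)
  have hF2 := ((contDiff_succ_iff_deriv (n := 1)).1 hF).2.2.differentiable (by norm_num)
  have hG2 := ((contDiff_succ_iff_deriv (n := 1)).1 hG).2.2.differentiable (by norm_num)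
  have h1 : deriv (fun y => F y + G y) = fun y => deriv F y + deriv G y := by
    funext y; exact deriv_fun_add (hF1 y) (hG1 y)
  have h2 : deriv (deriv (fun y => F y + G y)) J.val
      = deriv (deriv F) J.val + deriv (deriv G) J.val := by
    rw [h1, deriv_fun_add (hF2 _) (hG2 _)]
  ext
  · simp
  · simp [h1]; ring
  · rw [comp_drift, h2, h1]
    simp only [add_drift, comp_drift]
    ring

theorem comp_aeval (P : Polynomial ℝ) (J : Jet d) :
    comp (fun y => P.eval y) J = Polynomial.aeval J P := by
  induction P using Polynomial.induction_on' with
  | add P Q hP hQ =>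
    simp only [Polynomial.eval_add, map_add]
    rw [comp_add (by simpa using P.contDiff_aeval (𝕜 := ℝ) 2) (by simpa using Q.contDiff_aeval (𝕜 := ℝ) 2), hP, hQ]
  | monomial n a =>
    simp only [Polynomial.eval_monomial, Polynomial.aeval_monomial]
    rw [comp_mul (F := fun _ => a) (G := fun y => y ^ n) contDiff_const (contDiff_id.pow n),
      comp_const]
    congr 1
    induction n with
    | zero => simp [comp_const]
    | succ n ih =>
      simp only [pow_succ]
      rw [comp_mul (F := fun y => y ^ n) (G := fun y => y) (contDiff_id.pow n) contDiff_id, ih,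
        comp_id]

theorem comp_exp_add (J K : Jet d) :
    comp Real.exp (J + K) = comp Real.exp J * comp Real.exp K := by
  ext
  · simp [Real.exp_add]
  · simp [Real.exp_add]; ring
  · have : (J + K).normSq = J.normSq + K.normSq + 2 * ∑ i, J.grad i * K.grad i := by
      simp only [normSq, add_grad, Finset.mul_sum, ← Finset.sum_add_distrib]
      exact Finset.sum_congr rfl fun i _ => by ring
    have h2 : ∑ i, Real.exp J.val * J.grad i * (Real.exp K.val * K.grad i)
        = Real.exp J.val * Real.exp K.val * ∑ i, J.grad i * K.grad i := by
      rw [Finset.mul_sum]; exact Finset.sum_congr rfl fun i _ => by ring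
    simp only [comp_drift, mul_drift, comp_val, comp_grad, Real.deriv_exp, this, h2,
      add_val, Real.exp_add, add_drift]
    ring

/-! Size estimates: the drift is measured relative to a factor `κ`, which will be the (unbounded)
size of the drift coefficient. -/

/-- `J.Le κ a`: value and gradient are bounded by `a`, the drift by `κ a`. -/
def Le (κ a : ℝ) (J : Jet d) : Prop := |J.val| ≤ a ∧ (∀ i, |J.grad i| ≤ a) ∧ |J.drift| ≤ κ * a

variable {κ a b : ℝ} {J K : Jet d}

theorem Le.nonneg (h : J.Le κ a) : 0 ≤ a := (abs_nonneg _).trans h.1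

theorem Le.mono (hκ : 0 ≤ κ) (h : J.Le κ a) (hab : a ≤ b) : J.Le κ b :=
  ⟨h.1.trans hab, fun i => (h.2.1 i).trans hab, h.2.2.trans (mul_le_mul_of_nonneg_left hab hκ)⟩

theorem Le.add (hJ : J.Le κ a) (hK : K.Le κ b) : (J + K).Le κ (a + b) :=
  ⟨(abs_add_le _ _).trans (add_le_add hJ.1 hK.1),
    fun i => (abs_add_le _ _).trans (add_le_add (hJ.2.1 i) (hK.2.1 i)),
    (abs_add_le _ _).trans ((add_le_add hJ.2.2 hK.2.2).trans_eq (by ring))⟩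

theorem Le.smul (c : ℝ) (hJ : J.Le κ a) : (c • J).Le κ (|c| * a) := by
  refine ⟨?_, fun i => ?_, ?_⟩
  · rw [smul_val, abs_mul]; exact mul_le_mul_of_nonneg_left hJ.1 (abs_nonneg _)
  · rw [smul_grad, abs_mul]; exact mul_le_mul_of_nonneg_left (hJ.2.1 i) (abs_nonneg _)
  · rw [smul_drift, abs_mul]
    exact (mul_le_mul_of_nonneg_left hJ.2.2 (abs_nonneg _)).trans_eq (by ring)

theorem abs_sum_grad_mul_le (hJ : J.Le κ a) (hK : K.Le κ b) :
    |∑ i, J.grad i * K.grad i| ≤ d * (a * b) := by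
  refine (Finset.abs_sum_le_sum_abs _ _).trans ?_
  refine (Finset.sum_le_card_nsmul _ _ (a * b) fun i _ => ?_).trans_eq (by simp)
  rw [abs_mul]
  exact mul_le_mul (hJ.2.1 i) (hK.2.1 i) (abs_nonneg _) hJ.nonneg

theorem Le.normSq_le (hJ : J.Le κ a) : J.normSq ≤ d * (a * a) :=
  (le_abs_self _).trans (abs_sum_grad_mul_le hJ hJ)

theorem Le.mul (hκ : 1 ≤ κ) (hJ : J.Le κ a) (hK : K.Le κ b) :
    (J * K).Le κ ((d + 2) * (a * b)) := by
  have ha := hJ.nonneg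
  have hb := hK.nonneg
  have hab := mul_nonneg ha hb
  have hd : (0 : ℝ) ≤ d := Nat.cast_nonneg d
  refine ⟨?_, fun i => ?_, ?_⟩
  · rw [mul_val, abs_mul]
    have := mul_le_mul hJ.1 hK.1 (abs_nonneg _) ha
    nlinarith
  · rw [mul_grad]
    have h1 : |J.val * K.grad i| ≤ a * b := by
      rw [abs_mul]; exact mul_le_mul hJ.1 (hK.2.1 i) (abs_nonneg _) ha
    have h2 : |K.val * J.grad i| ≤ b * a := by
      rw [abs_mul]; exact mul_le_mul hK.1 (hJ.2.1 i) (abs_nonneg _) hb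
    have := abs_add_le (J.val * K.grad i) (K.val * J.grad i)
    nlinarith
  · rw [mul_drift]
    have h1 : |J.val * K.drift| ≤ a * (κ * b) := by
      rw [abs_mul]; exact mul_le_mul hJ.1 hK.2.2 (abs_nonneg _) ha
    have h2 : |K.val * J.drift| ≤ b * (κ * a) := by
      rw [abs_mul]; exact mul_le_mul hK.1 hJ.2.2 (abs_nonneg _) hb
    have h3 := abs_sum_grad_mul_le hJ hK
    have h4 := abs_add_three (J.val * K.drift) (K.val * J.drift) (∑ i, J.grad i * K.grad i)
    have h5 : d * (a * b) ≤ κ * (d * (a * b)) := le_mul_of_one_le_left (by positivity) hκ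
    nlinarith

theorem Le.comp {F : ℝ → ℝ} {m : ℝ} (hκ : 1 ≤ κ) (ha : 1 ≤ a) (hJ : J.Le κ a)
    (h0 : |F J.val| ≤ m) (h1 : |deriv F J.val| ≤ m) (h2 : |deriv (deriv F) J.val| ≤ m) :
    (comp F J).Le κ ((d + 1) * (m * a ^ 2)) := by
  have hm : 0 ≤ m := (abs_nonneg _).trans h0
  have hd : (0 : ℝ) ≤ d := Nat.cast_nonneg d
  have haa : a ≤ a ^ 2 := by nlinarith
  have hma : m * a ≤ m * a ^ 2 := mul_le_mul_of_nonneg_left haa hm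
  have hma1 : m ≤ m * a ^ 2 := le_mul_of_one_le_right hm (by nlinarith)
  have hd' : 0 ≤ d * (m * a ^ 2) := by positivity
  refine ⟨?_, fun i => ?_, ?_⟩
  · rw [comp_val]; linarith
  · rw [comp_grad, abs_mul]
    have := mul_le_mul h1 (hJ.2.1 i) (abs_nonneg _) hm
    linarith
  · rw [comp_drift]
    have e1 : |deriv F J.val * J.drift| ≤ m * (κ * a) := by
      rw [abs_mul]; exact mul_le_mul h1 hJ.2.2 (abs_nonneg _) hm
    have e2 : |deriv (deriv F) J.val / 2 * J.normSq| ≤ m * (d * (a * a)) := by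
      rw [abs_mul, abs_of_nonneg J.normSq_nonneg, abs_div, abs_two]
      refine mul_le_mul ?_ hJ.normSq_le J.normSq_nonneg hm
      linarith [abs_nonneg (deriv (deriv F) J.val)]
    have e3 := abs_add_le (deriv F J.val * J.drift) (deriv (deriv F) J.val / 2 * J.normSq)
    have e4 : d * (m * a ^ 2) ≤ κ * (d * (m * a ^ 2)) := le_mul_of_one_le_left hd' hκ
    have e5 : κ * (m * a) ≤ κ * (m * a ^ 2) := mul_le_mul_of_nonneg_left hma (by linarith)
    nlinarith

/-- Componentwise convergence of jets. -/
def Tendsto {α : Type*} (J : α → Jet d) (l : Filter α) (K : Jet d) : Prop :=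
  Filter.Tendsto (fun n => (J n).val) l (𝓝 K.val) ∧
    (∀ i, Filter.Tendsto (fun n => (J n).grad i) l (𝓝 (K.grad i))) ∧
    Filter.Tendsto (fun n => (J n).drift) l (𝓝 K.drift)

section Tendsto

variable {α : Type*} {l : Filter α} {f g : α → Jet d}

theorem tendsto_const (J : Jet d) : Tendsto (fun _ : α => J) l J :=
  ⟨tendsto_const_nhds, fun _ => tendsto_const_nhds, tendsto_const_nhds⟩

theorem Tendsto.add (hf : Tendsto f l J) (hg : Tendsto g l K) :
    Tendsto (fun n => f n + g n) l (J + K) :=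
  ⟨hf.1.add hg.1, fun i => (hf.2.1 i).add (hg.2.1 i), hf.2.2.add hg.2.2⟩

theorem Tendsto.smul (c : ℝ) (hf : Tendsto f l J) : Tendsto (fun n => c • f n) l (c • J) :=
  ⟨hf.1.const_mul c, fun i => (hf.2.1 i).const_mul c, hf.2.2.const_mul c⟩

theorem Tendsto.mul (hf : Tendsto f l J) (hg : Tendsto g l K) :
    Tendsto (fun n => f n * g n) l (J * K) :=
  ⟨hf.1.mul hg.1, fun i => (hf.1.mul (hg.2.1 i)).add (hg.1.mul (hf.2.1 i)),
    ((hf.1.mul hg.2.2).add (hg.1.mul hf.2.2)).add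
      (tendsto_finsetSum _ fun i _ => (hf.2.1 i).mul (hg.2.1 i))⟩

theorem Tendsto.normSq (hf : Tendsto f l J) :
    Filter.Tendsto (fun n => (f n).normSq) l (𝓝 J.normSq) :=
  tendsto_finsetSum _ fun i _ => (hf.2.1 i).mul (hf.2.1 i)

theorem Tendsto.comp {F : ℝ → ℝ} (hF : ContDiff ℝ 2 F) (hf : Tendsto f l J) :
    Tendsto (fun n => comp F (f n)) l (comp F J) := by
  have h1 := ((contDiff_succ_iff_deriv (n := 1)).1 hF).2.2
  have hc1 := (h1.continuous.tendsto J.val).comp hf.1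
  have hc2 := ((h1.continuous_deriv le_rfl).tendsto J.val).comp hf.1
  exact ⟨(hF.continuous.tendsto J.val).comp hf.1, fun i => hc1.mul (hf.2.1 i),
    (hc1.mul hf.2.2).add ((hc2.div_const 2).mul hf.normSq)⟩

/-- A limit in the function variable of `comp`. -/
theorem tendsto_comp_left {F : α → ℝ → ℝ} {G : ℝ → ℝ}
    (h0 : Filter.Tendsto (fun n => F n J.val) l (𝓝 (G J.val)))
    (h1 : Filter.Tendsto (fun n => deriv (F n) J.val) l (𝓝 (deriv G J.val)))
    (h2 : Filter.Tendsto (fun n => deriv (deriv (F n)) J.val) l (𝓝 (deriv (deriv G) J.val))) :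
    Tendsto (fun n => Jet.comp (F n) J) l (Jet.comp G J) :=
  ⟨h0, fun _ => h1.mul_const _, (h1.mul_const _).add ((h2.div_const 2).mul_const _)⟩

end Tendsto

end Jet

/-! ### Smooth functions controlled by the weight -/

section Admissible

variable {d : ℕ} {w : Rd d → ℝ} {φ ψ : Rd d → ℝ} {C D : ℝ}

theorem contDiff_partialDeriv (hφ : ContDiff ℝ (⊤ : ℕ∞) φ) (i : Fin d) :
    ContDiff ℝ (⊤ : ℕ∞) (partialDeriv i φ) :=
  (hφ.fderiv_right (m := (⊤ : ℕ∞)) (by simp)).clm_apply contDiff_const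

theorem differentiable_of_smooth (hφ : ContDiff ℝ (⊤ : ℕ∞) φ) : Differentiable ℝ φ :=
  hφ.differentiable (by simp)

theorem partialDeriv_add (hφ : Differentiable ℝ φ) (hψ : Differentiable ℝ ψ) (i : Fin d) :
    partialDeriv i (φ + ψ) = partialDeriv i φ + partialDeriv i ψ := by
  funext x
  simp [partialDeriv, fderiv_add (hφ x) (hψ x)]

theorem partialDeriv_smul (hφ : Differentiable ℝ φ) (c : ℝ) (i : Fin d) :
    partialDeriv i (c • φ) = c • partialDeriv i φ := by
  funext x
  simp [partialDeriv, fderiv_const_smul (hφ x)]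

theorem partialDeriv_mul (hφ : Differentiable ℝ φ) (hψ : Differentiable ℝ ψ) (i : Fin d) :
    partialDeriv i (φ * ψ) = φ * partialDeriv i ψ + ψ * partialDeriv i φ := by
  funext x
  simp [partialDeriv, fderiv_mul (hφ x) (hψ x)]

theorem partialDeriv_comp_smul (hφ : Differentiable ℝ φ) (r : ℝ) (i : Fin d) :
    partialDeriv i (fun x => φ (r • x)) = fun x => r * partialDeriv i φ (r • x) := by
  funext x
  have h : HasFDerivAt (fun x : Rd d => φ (r • x))
      ((fderiv ℝ φ (r • x)).comp (r • ContinuousLinearMap.id ℝ (Rd d))) x :=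
    ((hφ (r • x)).hasFDerivAt).comp x ((hasFDerivAt_id x).const_smul r)
  simp [partialDeriv, h.fderiv]

theorem partialDeriv_congr {x : Rd d} (h : φ =ᶠ[𝓝 x] ψ) (i : Fin d) :
    partialDeriv i φ =ᶠ[𝓝 x] partialDeriv i ψ := by
  filter_upwards [h.fderiv (𝕜 := ℝ)] with y hy
  simp [partialDeriv, hy]

theorem partialDeriv_const (c : ℝ) (i : Fin d) : partialDeriv i (fun _ : Rd d => c) = 0 := by
  funext x; simp [partialDeriv]

/-- `φ` is smooth, and `|φ|`, `(1 + |x|) |∇φ|` and `(1 + |x|)² |∇²φ|` are at most `C w`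
(entrywise). The powers of `1 + |x|` absorb the growth of the coefficients, so that the drift and
noise operators map such a `φ` to functions bounded by a multiple of `w`. -/
def Adm (w : Rd d → ℝ) (C : ℝ) (φ : Rd d → ℝ) : Prop :=
  ContDiff ℝ (⊤ : ℕ∞) φ ∧ ∀ x, |φ x| ≤ C * w x ∧
    (∀ i, (1 + ‖x‖) * |partialDeriv i φ x| ≤ C * w x) ∧
    ∀ i j, (1 + ‖x‖) ^ 2 * |partialDeriv j (partialDeriv i φ) x| ≤ C * w x

theorem Adm.nonneg (h : Adm w C φ) (hw : ∀ x, 1 ≤ w x) : 0 ≤ C := by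
  have h1 := (abs_nonneg _).trans (h.2 0).1
  have h2 := hw 0
  by_contra hC
  nlinarith

theorem abs_weighted_add_le {r a b s t : ℝ} (hr : 0 ≤ r) (ha : r * |a| ≤ s) (hb : r * |b| ≤ t) :
    r * |a + b| ≤ s + t := by
  have := mul_le_mul_of_nonneg_left (abs_add_le a b) hr
  linarith

theorem Adm.add (hφ : Adm w C φ) (hψ : Adm w D ψ) : Adm w (C + D) (φ + ψ) := by
  have h1 := differentiable_of_smooth hφ.1
  have h2 := differentiable_of_smooth hψ.1
  refine ⟨hφ.1.add hψ.1, fun x => ⟨?_, fun i => ?_, fun i j => ?_⟩⟩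
  · have := abs_weighted_add_le (r := 1) zero_le_one (by simpa using (hφ.2 x).1)
      (by simpa using (hψ.2 x).1)
    simpa [add_mul] using this
  · rw [partialDeriv_add h1 h2, add_mul C]
    exact abs_weighted_add_le (by positivity) ((hφ.2 x).2.1 i) ((hψ.2 x).2.1 i)
  · rw [partialDeriv_add h1 h2,
      partialDeriv_add (differentiable_of_smooth (contDiff_partialDeriv hφ.1 i))
        (differentiable_of_smooth (contDiff_partialDeriv hψ.1 i)), add_mul C]
    exact abs_weighted_add_le (by positivity) ((hφ.2 x).2.2 i j) ((hψ.2 x).2.2 i j)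

theorem Adm.smul (hφ : Adm w C φ) (c : ℝ) : Adm w (|c| * C) (c • φ) := by
  have h1 := differentiable_of_smooth hφ.1
  have key : ∀ {r a s : ℝ}, r * |a| ≤ s → r * |c * a| ≤ |c| * s := by
    intro r a s h
    rw [abs_mul]
    have := mul_le_mul_of_nonneg_left h (abs_nonneg c)
    linarith
  refine ⟨contDiff_const.smul hφ.1, fun x => ⟨?_, fun i => ?_, fun i j => ?_⟩⟩
  · rw [mul_assoc]
    simpa using key (r := 1) (by simpa using (hφ.2 x).1)
  · rw [partialDeriv_smul h1, mul_assoc]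
    exact key ((hφ.2 x).2.1 i)
  · rw [partialDeriv_smul h1,
      partialDeriv_smul (differentiable_of_smooth (contDiff_partialDeriv hφ.1 i)), mul_assoc]
    exact key ((hφ.2 x).2.2 i j)

theorem adm_one (hw : ∀ x, 1 ≤ w x) : Adm w 1 (fun _ => 1) := by
  refine ⟨contDiff_const, fun x => ?_⟩
  have := hw x
  refine ⟨by simpa using this, fun i => ?_, fun i j => ?_⟩
  · rw [partialDeriv_const]; simp; linarith
  · rw [partialDeriv_const]
    have : partialDeriv j (0 : Rd d → ℝ) = 0 := partialDeriv_const 0 j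
    rw [this]; simp; linarith

theorem hasCompactSupport_partialDeriv (h : HasCompactSupport φ) (i : Fin d) :
    HasCompactSupport (partialDeriv i φ) := by
  have := h.fderiv (𝕜 := ℝ)
  exact this.comp_left (g := fun L : Rd d →L[ℝ] ℝ => L (EuclideanSpace.single i 1)) (by simp)

/-- A common bound for finitely many quantities. -/
theorem exists_bound_fin {P : Fin d → ℝ → Prop} (hmono : ∀ i a b, a ≤ b → P i a → P i b)
    (h : ∀ i, ∃ a, P i a) : ∃ a, ∀ i, P i a := by
  choose a ha using h
  exact ⟨∑ i, |a i|, fun i => hmono i _ _ ((le_abs_self _).trans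
    (Finset.single_le_sum (f := fun i => |a i|) (fun _ _ => abs_nonneg _) (Finset.mem_univ i)))
    (ha i)⟩

theorem exists_weighted_bound (hw : ∀ x, 1 ≤ w x) (hw0 : φ ∈ testFunctions d) (k : ℕ) :
    ∃ C, 0 ≤ C ∧ ∀ x, (1 + ‖x‖) ^ k * |φ x| ≤ C * w x := by
  have hc : Continuous fun x => (1 + ‖x‖) ^ k * φ x := by
    have := hw0.1.continuous; fun_prop
  obtain ⟨C, hC⟩ := (hw0.2.mul_left (f := fun x => (1 + ‖x‖) ^ k)).exists_bound_of_continuous hc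
  have hC0 : 0 ≤ C := (norm_nonneg _).trans (hC 0)
  refine ⟨C, hC0, fun x => ?_⟩
  have h1 := hC x
  rw [Pi.mul_apply, norm_mul, Real.norm_eq_abs, Real.norm_eq_abs,
    abs_of_nonneg (by positivity)] at h1
  exact h1.trans (le_mul_of_one_le_right hC0 (hw x))

theorem partialDeriv_mem_testFunctions (h : φ ∈ testFunctions d) (i : Fin d) :
    partialDeriv i φ ∈ testFunctions d :=
  ⟨contDiff_partialDeriv h.1 i, hasCompactSupport_partialDeriv h.2 i⟩

/-- Auxiliary criterion for admissibility: the three bounds may be checked separately. -/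
theorem exists_adm (hw : ∀ x, 1 ≤ w x) (hφ : ContDiff ℝ (⊤ : ℕ∞) φ)
    (h0 : ∃ C, ∀ x, |φ x| ≤ C * w x)
    (h1 : ∀ i, ∃ C, ∀ x, (1 + ‖x‖) * |partialDeriv i φ x| ≤ C * w x)
    (h2 : ∀ i j, ∃ C, ∀ x, (1 + ‖x‖) ^ 2 * |partialDeriv j (partialDeriv i φ) x| ≤ C * w x) :
    ∃ C, Adm w C φ := by
  have key : ∀ {a b : ℝ}, a ≤ b → ∀ x, a * w x ≤ b * w x := fun hab x =>
    mul_le_mul_of_nonneg_right hab (zero_le_one.trans (hw x))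
  obtain ⟨C0, h0⟩ := h0
  obtain ⟨C1, h1⟩ := exists_bound_fin (fun i a b hab h x => (h x).trans (key hab x)) h1
  obtain ⟨C2, h2⟩ := exists_bound_fin
    (P := fun i C => ∀ j x, (1 + ‖x‖) ^ 2 * |partialDeriv j (partialDeriv i φ) x| ≤ C * w x)
    (fun i a b hab h j x => (h j x).trans (key hab x))
    (fun i => exists_bound_fin (fun i a b hab h x => (h x).trans (key hab x)) (h2 i))
  refine ⟨max C0 (max C1 C2), hφ, fun x => ⟨(h0 x).trans (key (le_max_left _ _) x),
    fun i => (h1 i x).trans (key ((le_max_left _ _).trans (le_max_right _ _)) x),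
    fun i j => (h2 i j x).trans (key ((le_max_right _ _).trans (le_max_right _ _)) x)⟩⟩

theorem exists_adm_of_mem_testFunctions (hw : ∀ x, 1 ≤ w x) (h : φ ∈ testFunctions d) :
    ∃ C, Adm w C φ := by
  refine exists_adm hw h.1 ?_ (fun i => ?_) fun i j => ?_
  · obtain ⟨C, -, hC⟩ := exists_weighted_bound hw h 0
    exact ⟨C, by simpa using hC⟩
  · obtain ⟨C, -, hC⟩ := exists_weighted_bound hw (partialDeriv_mem_testFunctions h i) 1
    exact ⟨C, by simpa using hC⟩
  · obtain ⟨C, -, hC⟩ := exists_weighted_bound hw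
      (partialDeriv_mem_testFunctions (partialDeriv_mem_testFunctions h i) j) 2
    exact ⟨C, hC⟩

/-- A continuous function which is homogeneous of degree `p - k` outside a ball, where the weight is
homogeneous of degree `p`, is at most `C (1 + |x|)⁻ᵏ w`. -/
theorem exists_bound_of_homogeneous (hw : ∀ x, 1 ≤ w x) {p : ℝ}
    (hp : ∀ x : Rd d, 2 < ‖x‖ → w x = ‖x‖ ^ p) {g : Rd d → ℝ} (hg : Continuous g) (k : ℕ)
    (hhom : ∀ (x : Rd d) (r : ℝ), 2 < ‖x‖ → 1 ≤ r → r ^ k * g (r • x) = r ^ p * g x) :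
    ∃ C, ∀ x, (1 + ‖x‖) ^ k * |g x| ≤ C * w x := by
  obtain ⟨C, hC⟩ := (isCompact_closedBall (0 : Rd d) 3).exists_bound_of_continuousOn hg.continuousOn
  have hC0 : 0 ≤ C := (norm_nonneg _).trans (hC 0 (by simp))
  refine ⟨4 ^ k * C, fun x => ?_⟩
  have hwx := hw x
  rcases le_or_gt ‖x‖ 3 with hx | hx
  · have h1 : |g x| ≤ C := hC x (by simpa using hx)
    have h2 : (1 + ‖x‖) ^ k ≤ 4 ^ k := pow_le_pow_left₀ (by positivity) (by linarith) k
    calc (1 + ‖x‖) ^ k * |g x| ≤ 4 ^ k * C := mul_le_mul h2 h1 (abs_nonneg _) (by positivity)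
      _ ≤ 4 ^ k * C * w x := le_mul_of_one_le_right (by positivity) hwx
  · set r : ℝ := ‖x‖ / 3 with hr
    have hr1 : 1 ≤ r := by rw [hr]; linarith
    have hr0 : 0 < r := by linarith
    set y : Rd d := r⁻¹ • x with hy
    have hyn : ‖y‖ = 3 := by
      rw [hy, norm_smul, norm_inv, Real.norm_of_nonneg hr0.le, hr]
      field_simp
    have hxy : x = r • y := by rw [hy, smul_smul, mul_inv_cancel₀ hr0.ne', one_smul]
    have h1 : |g y| ≤ C := hC y (by simp [hyn])
    have h2 := hhom y r (by rw [hyn]; norm_num) hr1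
    rw [← hxy] at h2
    have hwx' : w x = r ^ p * 3 ^ p := by
      rw [hp x (by linarith), ← Real.mul_rpow hr0.le (by norm_num), hr]
      congr 1; ring
    have hwy : (1 : ℝ) ≤ 3 ^ p := by
      have := hw y
      rwa [hp y (by rw [hyn]; norm_num), hyn] at this
    have h3 : r ^ k * |g x| ≤ r ^ p * C := by
      rw [← abs_of_pos (pow_pos hr0 k), ← abs_mul, h2, abs_mul,
        abs_of_pos (Real.rpow_pos_of_pos hr0 p)]
      exact mul_le_mul_of_nonneg_left h1 (Real.rpow_nonneg hr0.le p)
    have h4 : (1 + ‖x‖) ^ k ≤ 4 ^ k * r ^ k := by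
      rw [← mul_pow]
      exact pow_le_pow_left₀ (by positivity) (by rw [hr]; linarith) k
    calc (1 + ‖x‖) ^ k * |g x| ≤ 4 ^ k * r ^ k * |g x| :=
          mul_le_mul_of_nonneg_right h4 (abs_nonneg _)
      _ = 4 ^ k * (r ^ k * |g x|) := by ring
      _ ≤ 4 ^ k * (r ^ p * C) := mul_le_mul_of_nonneg_left h3 (by positivity)
      _ = 4 ^ k * C * r ^ p * 1 := by ring
      _ ≤ 4 ^ k * C * r ^ p * 3 ^ p := by
          refine mul_le_mul_of_nonneg_left hwy ?_
          have := Real.rpow_nonneg hr0.le p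
          positivity
      _ = 4 ^ k * C * w x := by rw [hwx']; ring

/-- Differentiating a homogeneity relation lowers the degree by one. -/
theorem partialDeriv_homogeneous {g : Rd d → ℝ} (hg : Differentiable ℝ g) {p : ℝ} {k : ℕ}
    (hhom : ∀ (x : Rd d) (r : ℝ), 2 < ‖x‖ → 1 ≤ r → r ^ k * g (r • x) = r ^ p * g x)
    (i : Fin d) (x : Rd d) (r : ℝ) (hx : 2 < ‖x‖) (hr : 1 ≤ r) :
    r ^ (k + 1) * partialDeriv i g (r • x) = r ^ p * partialDeriv i g x := by
  have h1 : (r ^ k • fun y => g (r • y)) =ᶠ[𝓝 x] (r ^ p • g) := by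
    filter_upwards [continuous_norm.continuousAt.eventually (lt_mem_nhds hx)] with y hy
    simpa using hhom y r hy hr
  have h2 := (partialDeriv_congr h1 i).eq_of_nhds
  have hg' : Differentiable ℝ fun y => g (r • y) := hg.comp (differentiable_id.const_smul r)
  rw [partialDeriv_smul hg', partialDeriv_smul hg, partialDeriv_comp_smul hg] at h2
  simp only [Pi.smul_apply, smul_eq_mul] at h2
  rw [pow_succ, mul_assoc, h2]

theorem IsWeight.exists_adm (hw : IsWeight w) : ∃ C, Adm w C w := by
  obtain ⟨p, -, hp⟩ := hw.eq_rpow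
  have hom0 : ∀ (x : Rd d) (r : ℝ), 2 < ‖x‖ → 1 ≤ r → r ^ 0 * w (r • x) = r ^ p * w x := by
    intro x r hx hr
    have hr0 : 0 < r := by linarith
    have hrx : ‖r • x‖ = r * ‖x‖ := by rw [norm_smul, Real.norm_of_nonneg hr0.le]
    rw [pow_zero, one_mul, hp x hx, hp (r • x) (by rw [hrx]; nlinarith), hrx,
      Real.mul_rpow hr0.le (norm_nonneg _)]
  have hs1 := fun i => contDiff_partialDeriv hw.smooth i
  have hom1 := fun i => partialDeriv_homogeneous (differentiable_of_smooth hw.smooth) hom0 i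
  have hom2 := fun i j => partialDeriv_homogeneous (differentiable_of_smooth (hs1 i)) (hom1 i) j
  refine MVJD.exists_adm hw.one_le hw.smooth ⟨1, fun x => ?_⟩ (fun i => ?_) fun i j => ?_
  · rw [one_mul, abs_of_nonneg (zero_le_one.trans (hw.one_le x))]
  · simpa using exists_bound_of_homogeneous hw.one_le hp (hs1 i).continuous 1 (hom1 i)
  · exact exists_bound_of_homogeneous hw.one_le hp (contDiff_partialDeriv (hs1 i) j).continuous 2
      (hom2 i j)

/-- A smooth bump equal to `1` on the unit ball, with values in `[0, 1]`. -/
def bump (d : ℕ) : ContDiffBump (0 : Rd d) := ⟨1, 2, one_pos, one_lt_two⟩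

theorem bump_mem_testFunctions : (bump d : Rd d → ℝ) ∈ testFunctions d :=
  ⟨(bump d).contDiff, (bump d).hasCompactSupport⟩

/-- The cutoff at scale `n + 1`. -/
def cutoff (d n : ℕ) (x : Rd d) : ℝ := bump d (((n : ℝ) + 1)⁻¹ • x)

theorem cutoff_mem_testFunctions (n : ℕ) : cutoff d n ∈ testFunctions d := by
  have hn : ((n : ℝ) + 1)⁻¹ ≠ 0 := by positivity
  exact ⟨(bump d).contDiff.comp (contDiff_const_smul _),
    (bump d).hasCompactSupport.comp_smul hn⟩

theorem cutoff_eventuallyEq_one (x : Rd d) : ∀ᶠ n in atTop, cutoff d n =ᶠ[𝓝 x] fun _ => 1 := by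
  obtain ⟨N, hN⟩ := exists_nat_gt ‖x‖
  filter_upwards [eventually_ge_atTop N] with n hn
  have hx : ‖x‖ < n + 1 := by
    have : (N : ℝ) ≤ n := by exact_mod_cast hn
    linarith
  filter_upwards [continuous_norm.continuousAt.eventually (gt_mem_nhds hx)] with y hy
  refine (bump d).one_of_mem_closedBall ?_
  have hn0 : (0 : ℝ) < n + 1 := by positivity
  rw [mem_closedBall_zero_iff, norm_smul, norm_inv, Real.norm_of_nonneg hn0.le]
  show _ ≤ (1 : ℝ)
  rw [inv_mul_le_iff₀ hn0]
  linarith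

/-- Multiplication with the cutoffs preserves admissibility, uniformly in the scale. -/
theorem Adm.exists_cutoff (hφ : Adm w C φ) (hw : ∀ x, 1 ≤ w x) :
    ∃ D, ∀ n, Adm w D (cutoff d n * φ) := by
  obtain ⟨K, hK⟩ := exists_adm_of_mem_testFunctions (w := fun _ => 1) (fun _ => le_rfl)
    (bump_mem_testFunctions (d := d))
  have hC := hφ.nonneg hw
  have hK0 : 0 ≤ K := hK.nonneg fun _ => le_rfl
  have hsb := differentiable_of_smooth hK.1
  refine ⟨4 * (K * C), fun n => ?_⟩
  set r : ℝ := ((n : ℝ) + 1)⁻¹ with hr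
  have hr0 : 0 < r := by positivity
  have hr1 : r ≤ 1 := inv_le_one_of_one_le₀ (by linarith [(Nat.cast_nonneg n : (0 : ℝ) ≤ n)])
  have hscale : ∀ x : Rd d, r * (1 + ‖x‖) ≤ 1 + ‖r • x‖ := by
    intro x; rw [norm_smul, Real.norm_of_nonneg hr0.le]; linarith
  have hχ : ContDiff ℝ (⊤ : ℕ∞) (cutoff d n) := (cutoff_mem_testFunctions n).1
  have b0 : ∀ x, |cutoff d n x| ≤ K := fun x => by simpa using! (hK.2 (r • x)).1
  have e1 : ∀ i, partialDeriv i (cutoff d n) = fun x => r * partialDeriv i (bump d) (r • x) :=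
    fun i => partialDeriv_comp_smul hsb r i
  have e2 : ∀ i j, partialDeriv j (partialDeriv i (cutoff d n))
      = fun x => r * (r * partialDeriv j (partialDeriv i (bump d)) (r • x)) := by
    intro i j
    have hd := differentiable_of_smooth (contDiff_partialDeriv hK.1 i)
    have : partialDeriv i (cutoff d n) = r • fun x => partialDeriv i (bump d) (r • x) := by
      rw [e1]; rfl
    have hd' : Differentiable ℝ fun x => partialDeriv i (bump d) (r • x) :=
      hd.comp (differentiable_id.const_smul r)
    rw [this, partialDeriv_smul hd', partialDeriv_comp_smul hd]
    rfl
  have b1 : ∀ i x, (1 + ‖x‖) * |partialDeriv i (cutoff d n) x| ≤ K := by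
    intro i x
    have h := (hK.2 (r • x)).2.1 i
    rw [e1, abs_mul, abs_of_pos hr0]
    calc (1 + ‖x‖) * (r * |partialDeriv i (bump d) (r • x)|)
        = r * (1 + ‖x‖) * |partialDeriv i (bump d) (r • x)| := by ring
      _ ≤ (1 + ‖r • x‖) * |partialDeriv i (bump d) (r • x)| :=
          mul_le_mul_of_nonneg_right (hscale x) (abs_nonneg _)
      _ ≤ K := by simpa using h
  have b2 : ∀ i j x, (1 + ‖x‖) ^ 2 * |partialDeriv j (partialDeriv i (cutoff d n)) x| ≤ K := by
    intro i j x
    have h := (hK.2 (r • x)).2.2 i j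
    rw [e2, abs_mul, abs_mul, abs_of_pos hr0]
    calc (1 + ‖x‖) ^ 2 * (r * (r * |partialDeriv j (partialDeriv i (bump d)) (r • x)|))
        = (r * (1 + ‖x‖)) ^ 2 * |partialDeriv j (partialDeriv i (bump d)) (r • x)| := by ring
      _ ≤ (1 + ‖r • x‖) ^ 2 * |partialDeriv j (partialDeriv i (bump d)) (r • x)| :=
          mul_le_mul_of_nonneg_right (pow_le_pow_left₀ (by positivity) (hscale x) 2) (abs_nonneg _)
      _ ≤ K := by simpa using h
  have hd0 := differentiable_of_smooth hφ.1
  have hdχ := differentiable_of_smooth hχ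
  have hd1 := fun i => differentiable_of_smooth (contDiff_partialDeriv hφ.1 i)
  have hdχ1 := fun i => differentiable_of_smooth (contDiff_partialDeriv hχ i)
  have key : ∀ {s t a b x y : ℝ}, 0 ≤ s → 0 ≤ t → s * |a| ≤ x → t * |b| ≤ y → 
      (s * t) * |a * b| ≤ x * y := by
    intro s t a b x y hs ht h1 h2
    rw [abs_mul]
    have := mul_le_mul h1 h2 (by positivity) ((by positivity : 0 ≤ s * |a|).trans h1)
    linarith
  refine ⟨hχ.mul hφ.1, fun x => ?_⟩
  have hx0 : (0 : ℝ) ≤ 1 + ‖x‖ := by positivity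
  have hP : 0 ≤ K * (C * w x) := mul_nonneg hK0 (mul_nonneg hC (zero_le_one.trans (hw x)))
  have c0 : (1 : ℝ) * |cutoff d n x| ≤ K := by simpa using b0 x
  have f0 : (1 : ℝ) * |φ x| ≤ C * w x := by simpa using (hφ.2 x).1
  refine ⟨?_, fun i => ?_, fun i j => ?_⟩
  · have := key zero_le_one zero_le_one c0 f0
    simp only [Pi.mul_apply]; linarith
  · rw [partialDeriv_mul hdχ hd0]
    have h1 := key zero_le_one hx0 c0 ((hφ.2 x).2.1 i)
    have h2 := key zero_le_one hx0 f0 (b1 i x)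
    rw [one_mul] at h1 h2
    have := abs_weighted_add_le hx0 h1 h2
    simp only [Pi.add_apply, Pi.mul_apply]; linarith
  · rw [partialDeriv_mul hdχ hd0, partialDeriv_add (hdχ.mul (hd1 i)) (hd0.mul (hdχ1 i)),
      partialDeriv_mul hdχ (hd1 i), partialDeriv_mul hd0 (hdχ1 i)]
    have h1 := key zero_le_one (pow_nonneg hx0 2) c0 ((hφ.2 x).2.2 i j)
    have h2 := key hx0 hx0 ((hφ.2 x).2.1 i) (b1 j x)
    have h3 := key zero_le_one (pow_nonneg hx0 2) f0 (b2 i j x)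
    have h4 := key hx0 hx0 (b1 i x) ((hφ.2 x).2.1 j)
    rw [one_mul] at h1 h3
    rw [← sq] at h2 h4
    have := abs_weighted_add_le (pow_nonneg hx0 2) (abs_weighted_add_le (pow_nonneg hx0 2) h1 h2)
      (abs_weighted_add_le (pow_nonneg hx0 2) h3 h4)
    simp only [Pi.add_apply, Pi.mul_apply]; linarith

theorem cutoff_mul_mem_testFunctions (hφ : ContDiff ℝ (⊤ : ℕ∞) φ) (n : ℕ) :
    cutoff d n * φ ∈ testFunctions d :=
  ⟨(cutoff_mem_testFunctions n).1.mul hφ, (cutoff_mem_testFunctions n).2.mul_right⟩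

theorem cutoff_mul_eventuallyEq (φ : Rd d → ℝ) (x : Rd d) :
    ∀ᶠ n in atTop, cutoff d n * φ =ᶠ[𝓝 x] φ := by
  filter_upwards [cutoff_eventuallyEq_one x] with n hn
  filter_upwards [hn] with y hy
  simp [hy]

/-- The smooth functions that are admissible with some constant. -/
def AdmSpace (hw : ∀ x, 1 ≤ w x) : Submodule ℝ (Rd d → ℝ) where
  carrier := {φ | ∃ C, Adm w C φ}
  zero_mem' := by
    obtain ⟨C, hC⟩ := (⟨1, adm_one hw⟩ : ∃ C, Adm w C fun _ : Rd d => (1 : ℝ))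
    exact ⟨|0| * C, by convert hC.smul 0 using 1; simp⟩
  add_mem' := fun ⟨C, hC⟩ ⟨D, hD⟩ => ⟨C + D, hC.add hD⟩
  smul_mem' := fun c _ ⟨C, hC⟩ => ⟨|c| * C, hC.smul c⟩

theorem IsWeight.Cw_le (hw : IsWeight w) : Cw w ≤ AdmSpace hw.one_le := by
  refine Submodule.span_le.2 fun φ hφ => ?_
  rcases hφ with rfl | hφ
  · exact hw.exists_adm
  · exact exists_adm_of_mem_testFunctions hw.one_le hφ

/-- The part of the weight near the origin, where the drift is not controlled uniformly in `μ`. -/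
def innerWeight (w : Rd d → ℝ) (x : Rd d) : ℝ := bump d x * (w x - 1)

/-- A weight comparable to `w` which is constant on the unit ball. -/
def outerWeight (w : Rd d → ℝ) (x : Rd d) : ℝ := w x - innerWeight w x

theorem IsWeight.innerWeight_mem (hw : IsWeight w) : innerWeight w ∈ testFunctions d :=
  ⟨(bump d).contDiff.mul (hw.smooth.sub contDiff_const),
    (bump d).hasCompactSupport.mul_right (f' := fun x => w x - 1)⟩

theorem IsWeight.innerWeight_nonneg (hw : IsWeight w) (x : Rd d) : 0 ≤ innerWeight w x :=
  mul_nonneg (bump d).nonneg (sub_nonneg.2 (hw.one_le x))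

theorem IsWeight.one_le_outerWeight (hw : IsWeight w) (x : Rd d) : 1 ≤ outerWeight w x := by
  have h1 := hw.one_le x
  have h2 : bump d x ≤ 1 := (bump d).le_one
  simp only [outerWeight, innerWeight]
  nlinarith

theorem outerWeight_eventuallyEq (w : Rd d → ℝ) {x : Rd d} (hx : ‖x‖ < 1) :
    outerWeight w =ᶠ[𝓝 x] fun _ => 1 := by
  filter_upwards [continuous_norm.continuousAt.eventually (gt_mem_nhds hx)] with y hy
  have : bump d y = 1 := (bump d).one_of_mem_closedBall (mem_closedBall_zero_iff.2 hy.le)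
  simp [outerWeight, innerWeight, this]

theorem IsWeight.exists_adm_innerWeight (hw : IsWeight w) : ∃ C, Adm w C (innerWeight w) :=
  exists_adm_of_mem_testFunctions hw.one_le hw.innerWeight_mem

theorem IsWeight.exists_adm_outerWeight (hw : IsWeight w) : ∃ C, Adm w C (outerWeight w) := by
  have : outerWeight w = w + (-1 : ℝ) • innerWeight w := by
    funext x; simp [outerWeight, sub_eq_add_neg]
  rw [this]
  exact (AdmSpace hw.one_le).add_mem hw.exists_adm
    ((AdmSpace hw.one_le).smul_mem _ hw.exists_adm_innerWeight)

end Admissible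

/-! ### Continuity of pairings on `𝒫_w` -/

section Pairings

variable {d : ℕ} {w : Rd d → ℝ}

theorem Pw.integrable_of_le (μ : Pw w) {g : Rd d → ℝ} (hg : Continuous g) {C : ℝ}
    (hle : ∀ x, |g x| ≤ C * w x) : Integrable g μ.meas :=
  (μ.integrable.const_mul C).mono' hg.aestronglyMeasurable (ae_of_all _ hle)

theorem Pw.abs_integral_le (μ : Pw w) {g : Rd d → ℝ} {C : ℝ} (hle : ∀ x, |g x| ≤ C * w x) :
    |∫ x, g x ∂μ.meas| ≤ C * μ.moment := by
  rw [Pw.moment, ← integral_const_mul, ← Real.norm_eq_abs]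
  exact norm_integral_le_of_norm_le (μ.integrable.const_mul C) (ae_of_all _ hle)

theorem Pw.one_le_moment (hw : ∀ x, 1 ≤ w x) (μ : Pw w) : 1 ≤ μ.moment := by
  have : ∫ _, (1 : ℝ) ∂μ.meas ≤ ∫ x, w x ∂μ.meas :=
    integral_mono (integrable_const _) μ.integrable hw
  simpa [Pw.moment] using this

theorem Pw.continuous_prob : Continuous (fun μ : Pw w => μ.prob) :=
  continuous_fst.comp (continuous_induced_dom (f := fun μ : Pw w => (μ.prob, μ.moment)))

theorem Pw.continuous_moment : Continuous (fun μ : Pw w => μ.moment) :=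
  continuous_snd.comp (continuous_induced_dom (f := fun μ : Pw w => (μ.prob, μ.moment)))

theorem Pw.continuous_integral_of_bounded {g : Rd d → ℝ} (hg : Continuous g) {C : ℝ}
    (hle : ∀ x, |g x| ≤ C) : Continuous (fun μ : Pw w => ∫ x, g x ∂μ.meas) := by
  let G : Rd d →ᵇ ℝ := BoundedContinuousFunction.ofNormedAddCommGroup g hg C hle
  exact (ProbabilityMeasure.continuous_integral_boundedContinuousFunction G).comp
    Pw.continuous_prob

/-- The mass of `w μ` above the level `n`. -/
def Pw.tail (μ : Pw w) (n : ℝ) : ℝ := ∫ x, (w x - min (w x) n) ∂μ.meas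

theorem Pw.integrable_min (hw : IsWeight w) (μ : Pw w) {n : ℝ} (hn : 0 ≤ n) :
    Integrable (fun x => min (w x) n) μ.meas := by
  refine μ.integrable_of_le (C := 1) (hw.smooth.continuous.min continuous_const) fun x => ?_
  have := hw.one_le x
  rw [abs_of_nonneg (le_min (by linarith) hn), one_mul]
  exact min_le_left _ _

theorem Pw.continuous_tail (hw : IsWeight w) {n : ℝ} (hn : 0 ≤ n) :
    Continuous (fun μ : Pw w => μ.tail n) := by
  have : (fun μ : Pw w => μ.tail n) = fun μ => μ.moment - ∫ x, min (w x) n ∂μ.meas := by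
    funext μ
    exact integral_sub μ.integrable (μ.integrable_min hw hn)
  rw [this]
  refine Pw.continuous_moment.sub (Pw.continuous_integral_of_bounded
    (hw.smooth.continuous.min continuous_const) (C := n) fun x => ?_)
  have := hw.one_le x
  rw [abs_of_nonneg (le_min (by linarith) hn)]
  exact min_le_right _ _

theorem Pw.tendsto_tail (hw : IsWeight w) (μ : Pw w) :
    Tendsto (fun n : ℕ => μ.tail n) atTop (𝓝 0) := by
  have h := tendsto_integral_of_dominated_convergence (μ := μ.meas) (f := fun _ => (0 : ℝ))
    (F := fun (n : ℕ) x => w x - min (w x) n) w (fun n =>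
      (hw.smooth.continuous.sub (hw.smooth.continuous.min
        continuous_const)).aestronglyMeasurable) μ.integrable
    (fun n => ae_of_all _ fun x => by
      have h1 := hw.one_le x
      have h2 : (0 : ℝ) ≤ min (w x) n := le_min (by linarith) (Nat.cast_nonneg n)
      rw [Real.norm_of_nonneg (by linarith [min_le_left (w x) (n : ℝ)])]
      linarith)
    (ae_of_all _ fun x => by
      obtain ⟨N, hN⟩ := exists_nat_gt (w x)
      refine tendsto_const_nhds.congr' ?_
      filter_upwards [eventually_ge_atTop N] with n hn
      have : (N : ℝ) ≤ n := by exact_mod_cast hn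
      rw [min_eq_left (by linarith), sub_self])
  simpa [Pw.tail] using h

theorem IsWeight.isCompact_sublevel (hw : IsWeight w) (a : ℝ) : IsCompact {x | w x ≤ a} := by
  obtain ⟨p, hp, hpw⟩ := hw.eq_rpow
  refine Metric.isCompact_of_isClosed_isBounded
    (isClosed_le hw.smooth.continuous continuous_const) ?_
  refine (Metric.isBounded_closedBall (x := (0 : Rd d)) (r := max 2 (max a 0 ^ p⁻¹))).subset
    fun x hx => ?_
  rw [mem_closedBall_zero_iff]
  by_contra! hlt
  have h2 := (le_max_left _ _).trans_lt hlt
  have h3 := (le_max_right _ _).trans_lt hlt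
  have h4 : max a 0 < ‖x‖ ^ p := by
    have := Real.rpow_lt_rpow (by positivity) h3 hp
    rwa [← Real.rpow_mul (le_max_right _ _), inv_mul_cancel₀ hp.ne', Real.rpow_one] at this
  rw [← hpw x h2] at h4
  exact absurd ((le_max_left a 0).trans_lt h4) (not_lt.2 hx)

/-- Integrals of jointly continuous functions bounded by `K(μ) w` depend continuously on
`μ ∈ 𝒫_w`. -/
theorem Pw.continuous_integral (hw : IsWeight w) {g : Pw w → Rd d → ℝ} {K : Pw w → ℝ}
    (hg : Continuous fun q : Pw w × Rd d => g q.1 q.2) (hK : Continuous K)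
    (hle : ∀ μ x, |g μ x| ≤ K μ * w x) : Continuous fun μ => ∫ x, g μ x ∂μ.meas := by
  have hgμ : ∀ μ, Continuous (g μ) := fun μ => hg.comp (Continuous.prodMk_right μ)
  have hK0 : ∀ μ, 0 ≤ K μ := fun μ => by
    have h1 := (abs_nonneg _).trans (hle μ 0)
    have h2 := hw.one_le 0
    by_contra h
    nlinarith
  refine continuous_iff_continuousAt.2 fun μ₀ => Metric.tendsto_nhds.2 fun ε hε => ?_
  -- a level above which `w μ` carries little mass, for all `μ` near `μ₀`
  set L : ℝ := 4 * (2 * K μ₀ + 1) with hL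
  have hL0 : 0 < L := by have := hK0 μ₀; positivity
  obtain ⟨n, hn⟩ : ∃ n : ℕ, μ₀.tail n < ε / (4 * L) :=
    ((μ₀.tendsto_tail hw).eventually (gt_mem_nhds (by positivity))).exists
  have hn0 : (0 : ℝ) ≤ n := Nat.cast_nonneg n
  have e1 : ∀ᶠ μ in 𝓝 μ₀, μ.tail n < ε / (4 * L) :=
    (Pw.continuous_tail hw hn0).continuousAt.eventually (gt_mem_nhds hn)
  have e2 : ∀ᶠ μ in 𝓝 μ₀, K μ < K μ₀ + 1 :=
    hK.continuousAt.eventually (gt_mem_nhds (by linarith))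
  -- uniform convergence on the compact set where `w ≤ 2 n`
  have e3 : ∀ᶠ μ in 𝓝 μ₀, ∀ x, w x ≤ 2 * n → |g μ x - g μ₀ x| < ε / 4 := by
    let G : C(Pw w, C(Rd d, ℝ)) := ContinuousMap.curry ⟨fun q => g q.1 q.2, hg⟩
    have h1 := (ContinuousMap.tendsto_iff_forall_isCompact_tendstoUniformlyOn.1
      (G.continuous.tendsto μ₀)) _ (hw.isCompact_sublevel (2 * n))
    filter_upwards [Metric.tendstoUniformlyOn_iff.1 h1 (ε / 4) (by positivity)] with μ hμ x hx
    have := hμ x hx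
    rw [dist_comm, Real.dist_eq] at this
    exact this
  have e4 : ∀ᶠ μ in 𝓝 μ₀, |∫ x, g μ₀ x * (min (w x) n / w x) ∂μ.meas
      - ∫ x, g μ₀ x * (min (w x) n / w x) ∂μ₀.meas| < ε / 4 := by
    have hc : Continuous fun x => g μ₀ x * (min (w x) n / w x) :=
      (hgμ μ₀).mul ((hw.smooth.continuous.min continuous_const).div hw.smooth.continuous
        fun x => by have := hw.one_le x; positivity)
    have := (Pw.continuous_integral_of_bounded (w := w) hc (C := K μ₀ * n) fun x => by
      have h1 := hw.one_le x
      have h2 : 0 ≤ min (w x) (n : ℝ) := le_min (by linarith) hn0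
      rw [abs_mul, abs_of_nonneg (div_nonneg h2 (by linarith))]
      calc |g μ₀ x| * (min (w x) n / w x) ≤ K μ₀ * w x * (min (w x) n / w x) :=
            mul_le_mul_of_nonneg_right (hle μ₀ x) (div_nonneg h2 (by linarith))
        _ = K μ₀ * min (w x) n := by field_simp
        _ ≤ K μ₀ * n := mul_le_mul_of_nonneg_left (min_le_right _ _) (hK0 μ₀)).continuousAt
          (x := μ₀)
    simpa [Real.dist_eq] using Metric.tendsto_nhds.1 this (ε / 4) (by positivity)
  have hI : ∀ μ ν : Pw w, Integrable (g ν) μ.meas := fun μ ν =>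
    μ.integrable_of_le (hgμ ν) (hle ν)
  have htailI : ∀ μ : Pw w, Integrable (fun x => w x - min (w x) n) μ.meas := fun μ =>
    μ.integrable.sub (μ.integrable_min hw hn0)
  have htr : ∀ μ : Pw w, |∫ x, g μ₀ x ∂μ.meas - ∫ x, g μ₀ x * (min (w x) n / w x) ∂μ.meas|
      ≤ K μ₀ * μ.tail n := by
    intro μ
    have hb : ∀ x, |g μ₀ x * (min (w x) n / w x)| ≤ K μ₀ * w x := fun x => by
      have h1 := hw.one_le x
      have h2 : 0 ≤ min (w x) (n : ℝ) := le_min (by linarith) hn0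
      rw [abs_mul, abs_of_nonneg (div_nonneg h2 (by linarith))]
      exact (mul_le_of_le_one_right (abs_nonneg _)
        ((div_le_one (by linarith)).2 (min_le_left _ _))).trans (hle μ₀ x)
    have hc : Continuous fun x => g μ₀ x * (min (w x) n / w x) :=
      (hgμ μ₀).mul ((hw.smooth.continuous.min continuous_const).div hw.smooth.continuous
        fun x => by have := hw.one_le x; positivity)
    rw [← integral_sub (hI μ μ₀) (μ.integrable_of_le hc hb), Pw.tail, ← integral_const_mul,
      ← Real.norm_eq_abs]
    refine norm_integral_le_of_norm_le ((htailI μ).const_mul _) (ae_of_all _ fun x => ?_)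
    have h1 := hw.one_le x
    have h2 : g μ₀ x - g μ₀ x * (min (w x) n / w x)
        = g μ₀ x / w x * (w x - min (w x) n) := by field_simp
    rw [h2, norm_mul, Real.norm_eq_abs, Real.norm_of_nonneg (sub_nonneg.2 (min_le_left _ _)),
      abs_div, abs_of_pos (by linarith : 0 < w x)]
    exact mul_le_mul_of_nonneg_right ((div_le_iff₀ (by linarith)).2 (hle μ₀ x))
      (sub_nonneg.2 (min_le_left _ _))
  filter_upwards [e1, e2, e3, e4] with μ h1 h2 h3 h4
  have hdiff : |∫ x, g μ x ∂μ.meas - ∫ x, g μ₀ x ∂μ.meas|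
      ≤ ε / 4 + 2 * (2 * K μ₀ + 1) * μ.tail n := by
    rw [← integral_sub (hI μ μ) (hI μ μ₀)]
    have : ε / 4 + 2 * (2 * K μ₀ + 1) * μ.tail n
        = ∫ x, (ε / 4 + 2 * (2 * K μ₀ + 1) * (w x - min (w x) n)) ∂μ.meas := by
      rw [integral_add (integrable_const _) ((htailI μ).const_mul _), integral_const_mul, Pw.tail]
      simp
    rw [this, ← Real.norm_eq_abs]
    refine norm_integral_le_of_norm_le (g := fun x => ε / 4 + 2 * (2 * K μ₀ + 1) *
      (w x - min (w x) n)) ((integrable_const _).add ((htailI μ).const_mul _))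
      (ae_of_all _ fun x => ?_)
    have hK1 := hK0 μ₀
    have hmin := sub_nonneg.2 (min_le_left (w x) (n : ℝ))
    rw [Real.norm_eq_abs]
    rcases le_or_gt (w x) (2 * n) with hx | hx
    · exact (h3 x hx).le.trans (le_add_of_nonneg_right (by positivity))
    · have hm : w x ≤ 2 * (w x - min (w x) n) := by
        have := min_le_right (w x) (n : ℝ); linarith
      have ha : |g μ x - g μ₀ x| ≤ (2 * K μ₀ + 1) * w x := by
        have a1 := abs_sub (g μ x) (g μ₀ x)
        have a2 := hle μ x
        have a3 := hle μ₀ x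
        have a4 : K μ * w x ≤ (K μ₀ + 1) * w x :=
          mul_le_mul_of_nonneg_right h2.le (zero_le_one.trans (hw.one_le x))
        linarith
      have : (2 * K μ₀ + 1) * w x ≤ (2 * K μ₀ + 1) * (2 * (w x - min (w x) n)) :=
        mul_le_mul_of_nonneg_left hm (by positivity)
      linarith
  have hKμ := hK0 μ₀
  have ht : ∀ ν : Pw w, ν.tail n < ε / (4 * L) → L * ν.tail n < ε / 4 := fun ν hν => by
    rw [lt_div_iff₀ (by positivity)] at hν
    linarith
  have t0 : ∀ ν : Pw w, 0 ≤ ν.tail n := fun ν =>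
    integral_nonneg fun x => sub_nonneg.2 (min_le_left _ _)
  have b1 := ht μ h1
  have b0 := ht μ₀ hn
  have c1 : (2 * (2 * K μ₀ + 1) + K μ₀) * μ.tail n ≤ L * μ.tail n :=
    mul_le_mul_of_nonneg_right (by rw [hL]; linarith) (t0 μ)
  have c0 : K μ₀ * μ₀.tail n ≤ L * μ₀.tail n :=
    mul_le_mul_of_nonneg_right (by rw [hL]; linarith) (t0 μ₀)
  have d1 := htr μ
  have d0 := htr μ₀
  rw [Real.dist_eq]
  rw [abs_le] at hdiff d1 d0
  rw [abs_lt] at h4 ⊢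
  constructor <;> linarith [hdiff.1, hdiff.2, d1.1, d1.2, d0.1, d0.2, h4.1, h4.2]

theorem Pw.continuous_embed (hw : IsWeight w) : Continuous (Pw.embed (w := w)) := by
  have hint : ∀ (μ : Pw w) (f : OnePoint (Rd d) →ᵇ ℝ),
      ∫ y, f y ∂(μ.embed : Measure (OnePoint (Rd d))) = ∫ x, w x * f x ∂μ.meas := by
    intro μ f
    have h1 : (μ.embed : Measure (OnePoint (Rd d)))
        = (μ.meas.withDensity fun x => ENNReal.ofReal (w x)).map ((↑) : Rd d → OnePoint (Rd d)) :=
      rfl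
    rw [h1, integral_map OnePoint.continuous_coe.measurable.aemeasurable
      f.continuous.aestronglyMeasurable]
    have h2 : (fun x => ENNReal.ofReal (w x)) = fun x => ((w x).toNNReal : ℝ≥0∞) := rfl
    rw [h2, integral_withDensity_eq_integral_smul hw.smooth.continuous.measurable.real_toNNReal]
    refine integral_congr_ae (ae_of_all _ fun x => ?_)
    simp [NNReal.smul_def, Real.coe_toNNReal _ (zero_le_one.trans (hw.one_le x))]
  refine continuous_iff_continuousAt.2 fun μ₀ =>
    FiniteMeasure.tendsto_iff_forall_integral_tendsto.2 fun f => ?_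
  simp only [hint]
  refine (Pw.continuous_integral hw (g := fun _ x => w x * f x) (K := fun _ => ‖f‖) ?_
    continuous_const fun μ x => ?_).continuousAt
  · exact (hw.smooth.continuous.comp continuous_snd).mul
      (f.continuous.comp (OnePoint.continuous_coe.comp continuous_snd))
  · rw [abs_mul, abs_of_nonneg (zero_le_one.trans (hw.one_le x)), mul_comm]
    exact mul_le_mul_of_nonneg_right (f.norm_coe_le_norm _) (zero_le_one.trans (hw.one_le x))

theorem Pw.continuous_toX (hw : IsWeight w) : Continuous (Pw.toX (w := w)) :=
  (Pw.continuous_embed hw).subtype_mk _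

theorem Pw.mass_embed (hw : IsWeight w) (μ : Pw w) : (μ.embed.mass : ℝ) = μ.moment := by
  have h1 : (μ.embed : Measure (OnePoint (Rd d)))
      = (μ.meas.withDensity fun x => ENNReal.ofReal (w x)).map ((↑) : Rd d → OnePoint (Rd d)) :=
    rfl
  have h2 : (μ.embed.mass : ℝ≥0∞) = ENNReal.ofReal μ.moment := by
    rw [FiniteMeasure.ennreal_mass, h1, Measure.map_apply OnePoint.continuous_coe.measurable
      MeasurableSet.univ, Set.preimage_univ, withDensity_apply _ MeasurableSet.univ,
      Measure.restrict_univ, Pw.moment, ofReal_integral_eq_lintegral_ofReal μ.integrable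
        (ae_of_all _ fun x => zero_le_one.trans (hw.one_le x))]
  have h3 := congrArg ENNReal.toReal h2
  rwa [ENNReal.toReal_ofReal (zero_le_one.trans (μ.one_le_moment hw.one_le))] at h3

/-- The part of `𝒳` of mass at most `R` is compact. -/
theorem isCompact_mass_le (w : Rd d → ℝ) (R : ℝ≥0) : IsCompact {ν : XSpace w | ν.1.mass ≤ R} := by
  have h := isCompact_setOfPred_finiteMeasure_le_of_compactSpace (OnePoint (Rd d)) R
  exact (isClosed_closure (s := Set.range (Pw.embed (w := w)))).isClosedEmbedding_subtypeVal.isCompact_preimage h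

end Pairings

/-! ### The coefficients and the jets of linear functionals -/

section Coefficients

variable {d : ℕ} {w : Rd d → ℝ}

/-- The bounds on the coefficients used below. The drift is controlled by `κ(μ) (1 + |x|)`, where
`κ` is bounded on sets of bounded moment only, and by `c (1 + |x|)² / |x|` uniformly in `μ`. -/
structure CoefBounds (b : Pw w → Rd d → Rd d) (σ τ : Pw w → Rd d → Matrix (Fin d) (Fin d) ℝ)
    (κ : Pw w → ℝ) (c : ℝ) : Prop where
  c_nonneg : 0 ≤ c
  κ_cont : Continuous κ
  one_le_κ : ∀ μ, 1 ≤ κ μ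
  κ_bdd : ∀ R : ℝ, ∃ K, ∀ μ : Pw w, μ.moment ≤ R → κ μ ≤ K
  b_cont : Continuous fun q : Pw w × Rd d => b q.1 q.2
  σ_cont : Continuous fun q : Pw w × Rd d => σ q.1 q.2
  τ_cont : Continuous fun q : Pw w × Rd d => τ q.1 q.2
  b_le : ∀ μ x i, |b μ x i| ≤ κ μ * (1 + ‖x‖)
  norm_mul_b_le : ∀ μ x i, ‖x‖ * |b μ x i| ≤ c * (1 + ‖x‖) ^ 2
  τ_le : ∀ μ x i j, |τ μ x i j| ≤ c * (1 + ‖x‖)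
  a_le : ∀ μ x i j, |(σ μ x * σ μ x + τ μ x * τ μ x) i j| ≤ c * (1 + ‖x‖) ^ 2

theorem abs_mul_self_apply_le {A : Matrix (Fin d) (Fin d) ℝ} (i j : Fin d) :
    |(A * A) i j| ≤ ∑ i, ∑ j, (A i j) ^ 2 := by
  have h1 : ∀ i, ∑ k, (A i k) ^ 2 ≤ ∑ i, ∑ j, (A i j) ^ 2 := fun i =>
    Finset.single_le_sum (f := fun i => ∑ k, (A i k) ^ 2)
      (fun _ _ => Finset.sum_nonneg fun _ _ => sq_nonneg _) (Finset.mem_univ i)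
  have h2 : ∑ k, (A k j) ^ 2 ≤ ∑ i, ∑ j, (A i j) ^ 2 := Finset.sum_le_sum fun i _ =>
    Finset.single_le_sum (f := fun j => (A i j) ^ 2) (fun _ _ => sq_nonneg _) (Finset.mem_univ j)
  rw [Matrix.mul_apply]
  refine (Finset.abs_sum_le_sum_abs _ _).trans ?_
  have h3 : ∑ k, |A i k * A k j| ≤ ∑ k, ((A i k) ^ 2 + (A k j) ^ 2) / 2 := by
    refine Finset.sum_le_sum fun k _ => ?_
    rw [abs_mul, ← sq_abs (A i k), ← sq_abs (A k j)]
    nlinarith [sq_nonneg (|A i k| - |A k j|)]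
  rw [← Finset.sum_div, Finset.sum_add_distrib] at h3
  linarith [h1 i]

theorem exists_coefBounds (hw : IsWeight w) {b : Pw w → Rd d → Rd d}
    {σ τ : Pw w → Rd d → Matrix (Fin d) (Fin d) ℝ} (h : CoefficientConditions 0 b σ τ) :
    ∃ κ c, CoefBounds b σ τ κ c := by
  obtain ⟨b', σ', τ', hb, hσ, hτ, -, -, cb, cσ, cτ, hb', -, -, c, hc, hle⟩ := h
  choose G hGc hG using hb'
  have hlin : Continuous fun q : Pw w × Rd d => ((q.1.toX, q.2) : XSpace w × Rd d) :=
    ((Pw.continuous_toX hw).comp continuous_fst).prodMk continuous_snd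
  let k : XSpace w → ℝ := fun ν => 1 + ∑ i, ‖G i ν‖
  have hk : Continuous k := continuous_const.add (continuous_finsetSum _ fun i _ => (hGc i).norm)
  have hbd : ∀ (ν : XSpace w) (x : Rd d), ‖x‖ * ‖b' ν x‖ + (∑ i, ∑ j, (σ' ν x i j) ^ 2)
      + ∑ i, ∑ j, (τ' ν x i j) ^ 2 ≤ c * (1 + ‖x‖ ^ 2) := by
    intro ν x
    have := hle ν x
    rwa [Real.rpow_zero, mul_one, div_le_iff₀ (by positivity)] at this
  have hsq : ∀ x : Rd d, 1 + ‖x‖ ^ 2 ≤ (1 + ‖x‖) ^ 2 := fun x => by nlinarith [norm_nonneg x]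
  have hSσ : ∀ (ν : XSpace w) (x : Rd d), 0 ≤ ∑ i, ∑ j, (σ' ν x i j) ^ 2 := fun ν x =>
    Finset.sum_nonneg fun _ _ => Finset.sum_nonneg fun _ _ => sq_nonneg _
  have hSτ : ∀ (ν : XSpace w) (x : Rd d), 0 ≤ ∑ i, ∑ j, (τ' ν x i j) ^ 2 := fun ν x =>
    Finset.sum_nonneg fun _ _ => Finset.sum_nonneg fun _ _ => sq_nonneg _
  refine ⟨fun μ => k μ.toX, 1 + c, by linarith, hk.comp (Pw.continuous_toX hw), fun μ => ?_,
    fun R => ?_, ?_, ?_, ?_, fun μ x i => ?_, fun μ x i => ?_, fun μ x i j => ?_,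
    fun μ x i j => ?_⟩
  · exact le_add_of_nonneg_right (Finset.sum_nonneg fun _ _ => norm_nonneg _)
  · obtain ⟨K, hK⟩ := (isCompact_mass_le w R.toNNReal).exists_bound_of_continuousOn hk.continuousOn
    refine ⟨K, fun μ hμ => (le_abs_self _).trans (hK μ.toX ?_)⟩
    have h1 : (μ.embed.mass : ℝ) ≤ R := by rwa [Pw.mass_embed hw]
    show μ.embed.mass ≤ R.toNNReal
    exact NNReal.le_toNNReal_of_coe_le h1
  · simp only [hb]; exact cb.comp hlin
  · simp only [hσ]; exact cσ.comp hlin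
  · simp only [hτ]; exact cτ.comp hlin
  · have h1 := (hG i μ.toX).2 x
    have h2 := (G i μ.toX).norm_coe_le_norm x
    rw [h1, Real.norm_eq_abs, abs_div, abs_of_pos (by positivity : 0 < 1 + ‖x‖),
      div_le_iff₀ (by positivity), ← hb] at h2
    refine h2.trans (mul_le_mul_of_nonneg_right ?_ (by positivity))
    have := Finset.single_le_sum (f := fun i => ‖G i μ.toX‖) (fun _ _ => norm_nonneg _)
      (Finset.mem_univ i)
    show _ ≤ 1 + ∑ i, ‖G i μ.toX‖
    linarith
  · have h1 := hbd μ.toX x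
    have h2 : |b μ x i| ≤ ‖b' μ.toX x‖ := by
      rw [hb]; exact PiLp.norm_apply_le (b' μ.toX x) i
    have h3 := mul_le_mul_of_nonneg_left h2 (norm_nonneg x)
    have h4 := mul_le_mul_of_nonneg_left (hsq x) hc
    nlinarith [hSσ μ.toX x, hSτ μ.toX x, sq_nonneg (1 + ‖x‖)]
  · have h1 := hbd μ.toX x
    have h2 : (τ' μ.toX x i j) ^ 2 ≤ ∑ i, ∑ j, (τ' μ.toX x i j) ^ 2 :=
      (Finset.single_le_sum (f := fun j => (τ' μ.toX x i j) ^ 2) (fun _ _ => sq_nonneg _)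
        (Finset.mem_univ j)).trans (Finset.single_le_sum
          (f := fun i => ∑ j, (τ' μ.toX x i j) ^ 2)
          (fun _ _ => Finset.sum_nonneg fun _ _ => sq_nonneg _) (Finset.mem_univ i))
    have h4 := mul_le_mul_of_nonneg_left (hsq x) hc
    have h5 : 0 ≤ ‖x‖ * ‖b' μ.toX x‖ := by positivity
    rw [hτ]
    refine abs_le_of_sq_le_sq ?_ (by positivity)
    rw [mul_pow]
    have h6 : c ≤ (1 + c) ^ 2 := by nlinarith
    have h7 := mul_le_mul_of_nonneg_right h6 (sq_nonneg (1 + ‖x‖))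
    nlinarith [hSσ μ.toX x]
  · have h1 := hbd μ.toX x
    have h4 := mul_le_mul_of_nonneg_left (hsq x) hc
    have h5 : 0 ≤ ‖x‖ * ‖b' μ.toX x‖ := by positivity
    rw [hσ, hτ, Matrix.add_apply]
    have h6 := abs_add_le ((σ' μ.toX x * σ' μ.toX x) i j) ((τ' μ.toX x * τ' μ.toX x) i j)
    have h7 := abs_mul_self_apply_le (A := σ' μ.toX x) i j
    have h8 := abs_mul_self_apply_le (A := τ' μ.toX x) i j
    nlinarith [sq_nonneg (1 + ‖x‖)]

/-- The noise coefficient `(τ_μ ∇φ)_i` of `⟨φ, μ⟩`. -/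
def noiseOp (τ : Pw w → Rd d → Matrix (Fin d) (Fin d) ℝ) (μ : Pw w) (φ : Rd d → ℝ) (i : Fin d)
    (x : Rd d) : ℝ :=
  ∑ k, τ μ x i k * partialDeriv k φ x

/-- The Itô jet of `μ ↦ ⟨φ, μ⟩`. -/
def linJet (b : Pw w → Rd d → Rd d) (σ τ : Pw w → Rd d → Matrix (Fin d) (Fin d) ℝ)
    (φ : Rd d → ℝ) (μ : Pw w) : Jet d :=
  ⟨∫ x, φ x ∂μ.meas, fun i => ∫ x, noiseOp τ μ φ i x ∂μ.meas, ∫ x, driftOp b σ τ μ φ x ∂μ.meas⟩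

/-- Continuity of a jet-valued function, componentwise. -/
def JetContinuous (J : Pw w → Jet d) : Prop :=
  (Continuous fun μ => (J μ).val) ∧ (∀ i, Continuous fun μ => (J μ).grad i) ∧
    Continuous fun μ => (J μ).drift

theorem JetContinuous.tendsto {J : Pw w → Jet d} (hJ : JetContinuous J) (μ : Pw w) :
    Jet.Tendsto J (𝓝 μ) (J μ) :=
  ⟨hJ.1.tendsto μ, fun i => (hJ.2.1 i).tendsto μ, hJ.2.2.tendsto μ⟩

theorem jetContinuous_of_tendsto {J : Pw w → Jet d} (h : ∀ μ, Jet.Tendsto J (𝓝 μ) (J μ)) :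
    JetContinuous J :=
  ⟨continuous_iff_continuousAt.2 fun μ => (h μ).1,
    fun i => continuous_iff_continuousAt.2 fun μ => (h μ).2.1 i,
    continuous_iff_continuousAt.2 fun μ => (h μ).2.2⟩

theorem JetContinuous.add {J K : Pw w → Jet d} (hJ : JetContinuous J) (hK : JetContinuous K) :
    JetContinuous fun μ => J μ + K μ :=
  jetContinuous_of_tendsto fun μ => (hJ.tendsto μ).add (hK.tendsto μ)

theorem JetContinuous.mul {J K : Pw w → Jet d} (hJ : JetContinuous J) (hK : JetContinuous K) :
    JetContinuous fun μ => J μ * K μ :=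
  jetContinuous_of_tendsto fun μ => (hJ.tendsto μ).mul (hK.tendsto μ)

theorem JetContinuous.smul {J : Pw w → Jet d} (hJ : JetContinuous J) (c : ℝ) :
    JetContinuous fun μ => c • J μ :=
  jetContinuous_of_tendsto fun μ => (hJ.tendsto μ).smul c

theorem jetContinuous_const (J : Jet d) : JetContinuous fun _ : Pw w => J :=
  jetContinuous_of_tendsto fun _ => Jet.tendsto_const J

theorem JetContinuous.comp {J : Pw w → Jet d} (hJ : JetContinuous J) {F : ℝ → ℝ}
    (hF : ContDiff ℝ 2 F) : JetContinuous fun μ => Jet.comp F (J μ) :=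
  jetContinuous_of_tendsto fun μ => (hJ.tendsto μ).comp hF

variable {b : Pw w → Rd d → Rd d} {σ τ : Pw w → Rd d → Matrix (Fin d) (Fin d) ℝ}
  {κ : Pw w → ℝ} {c : ℝ} {φ ψ : Rd d → ℝ} {C D : ℝ}

theorem abs_sum_le_card_mul {f : Fin d → ℝ} {a : ℝ} (h : ∀ i, |f i| ≤ a) :
    |∑ i, f i| ≤ d * a := by
  refine (Finset.abs_sum_le_sum_abs _ _).trans ?_
  exact (Finset.sum_le_card_nsmul _ _ a fun i _ => h i).trans_eq (by simp)

theorem abs_noiseOp_le (hB : CoefBounds b σ τ κ c) (hφ : Adm w C φ) (μ : Pw w) (i : Fin d)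
    (x : Rd d) : |noiseOp τ μ φ i x| ≤ d * (c * C) * w x := by
  rw [mul_assoc]
  refine abs_sum_le_card_mul fun k => ?_
  rw [abs_mul]
  calc |τ μ x i k| * |partialDeriv k φ x| ≤ c * (1 + ‖x‖) * |partialDeriv k φ x| :=
        mul_le_mul_of_nonneg_right (hB.τ_le μ x i k) (abs_nonneg _)
    _ = c * ((1 + ‖x‖) * |partialDeriv k φ x|) := by ring
    _ ≤ c * (C * w x) := mul_le_mul_of_nonneg_left ((hφ.2 x).2.1 k) hB.c_nonneg
    _ = c * C * w x := by ring

/-- Bound for the drift operator, given a bound on the first order part. -/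
theorem abs_driftOp_le_of (hB : CoefBounds b σ τ κ c) (hφ : Adm w C φ) (μ : Pw w) (x : Rd d)
    {r : ℝ} (hr : ∀ i, |b μ x i * partialDeriv i φ x| ≤ r * (C * w x)) :
    |driftOp b σ τ μ φ x| ≤ (d * r + d * (d * c)) * C * w x := by
  have h1 : |∑ i, b μ x i * partialDeriv i φ x| ≤ d * (r * (C * w x)) := abs_sum_le_card_mul hr
  have h2 : |∑ i, ∑ j, (σ μ x * σ μ x + τ μ x * τ μ x) i j * partialDeriv j (partialDeriv i φ) x|
      ≤ d * (d * (c * (C * w x))) := by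
    refine abs_sum_le_card_mul fun i => abs_sum_le_card_mul fun j => ?_
    rw [abs_mul]
    calc |(σ μ x * σ μ x + τ μ x * τ μ x) i j| * |partialDeriv j (partialDeriv i φ) x|
        ≤ c * (1 + ‖x‖) ^ 2 * |partialDeriv j (partialDeriv i φ) x| :=
          mul_le_mul_of_nonneg_right (hB.a_le μ x i j) (abs_nonneg _)
      _ = c * ((1 + ‖x‖) ^ 2 * |partialDeriv j (partialDeriv i φ) x|) := by ring
      _ ≤ c * (C * w x) := mul_le_mul_of_nonneg_left ((hφ.2 x).2.2 i j) hB.c_nonneg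
  have h3 := abs_add_le (∑ i, b μ x i * partialDeriv i φ x) ((1 / 2) *
    ∑ i, ∑ j, (σ μ x * σ μ x + τ μ x * τ μ x) i j * partialDeriv j (partialDeriv i φ) x)
  rw [abs_mul, abs_of_pos (by norm_num : (0 : ℝ) < 1 / 2)] at h3
  have h4 := (abs_nonneg _).trans h2
  rw [driftOp]
  linarith

theorem abs_driftOp_le (hB : CoefBounds b σ τ κ c) (hφ : Adm w C φ) (hw : ∀ x, 1 ≤ w x) (μ : Pw w)
    (x : Rd d) : |driftOp b σ τ μ φ x| ≤ κ μ * ((d + d * (d * c)) * C) * w x := by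
  have hC := hφ.nonneg hw
  have hκ := hB.one_le_κ μ
  have hc := hB.c_nonneg
  have hwx := hw x
  refine (abs_driftOp_le_of hB hφ μ x (r := κ μ) fun i => ?_).trans ?_
  · rw [abs_mul]
    calc |b μ x i| * |partialDeriv i φ x| ≤ κ μ * (1 + ‖x‖) * |partialDeriv i φ x| :=
          mul_le_mul_of_nonneg_right (hB.b_le μ x i) (abs_nonneg _)
      _ = κ μ * ((1 + ‖x‖) * |partialDeriv i φ x|) := by ring
      _ ≤ κ μ * (C * w x) := mul_le_mul_of_nonneg_left ((hφ.2 x).2.1 i) (by linarith)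
  · have h : (d : ℝ) * (d * c) ≤ κ μ * (d * (d * c)) :=
      le_mul_of_one_le_left (by positivity) hκ
    refine mul_le_mul_of_nonneg_right ?_ (by linarith)
    nlinarith

/-- For functions that are constant near the origin the drift is bounded uniformly. -/
theorem abs_driftOp_le_of_const (hB : CoefBounds b σ τ κ c) (hφ : Adm w C φ) (hw : ∀ x, 1 ≤ w x)
    (h1 : ∀ x, ‖x‖ < 1 → ∀ i, partialDeriv i φ x = 0) (μ : Pw w) (x : Rd d) :
    |driftOp b σ τ μ φ x| ≤ (d * (2 * c) + d * (d * c)) * C * w x := by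
  have hC := hφ.nonneg hw
  have hc := hB.c_nonneg
  have hwx := hw x
  refine abs_driftOp_le_of hB hφ μ x fun i => ?_
  rcases lt_or_ge ‖x‖ 1 with hx | hx
  · rw [h1 x hx, mul_zero, abs_zero]
    have := mul_nonneg hC (zero_le_one.trans hwx)
    positivity
  · have hb := hB.norm_mul_b_le μ x i
    have hb' : |b μ x i| ≤ 2 * c * (1 + ‖x‖) := by
      have h2 : (1 + ‖x‖) * |b μ x i| ≤ 2 * ‖x‖ * |b μ x i| :=
        mul_le_mul_of_nonneg_right (by linarith) (abs_nonneg _)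
      have h3 : (1 + ‖x‖) * |b μ x i| ≤ (1 + ‖x‖) * (2 * c * (1 + ‖x‖)) := by nlinarith
      exact le_of_mul_le_mul_left h3 (by positivity)
    rw [abs_mul]
    calc |b μ x i| * |partialDeriv i φ x| ≤ 2 * c * (1 + ‖x‖) * |partialDeriv i φ x| :=
          mul_le_mul_of_nonneg_right hb' (abs_nonneg _)
      _ = 2 * c * ((1 + ‖x‖) * |partialDeriv i φ x|) := by ring
      _ ≤ 2 * c * (C * w x) := mul_le_mul_of_nonneg_left ((hφ.2 x).2.1 i) (by positivity)

theorem continuous_apply_b (hB : CoefBounds b σ τ κ c) (i : Fin d) :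
    Continuous fun q : Pw w × Rd d => b q.1 q.2 i :=
  (PiLp.continuous_apply 2 _ i).comp hB.b_cont

theorem continuous_noiseOp (hB : CoefBounds b σ τ κ c) (hφ : ContDiff ℝ (⊤ : ℕ∞) φ) (i : Fin d) :
    Continuous fun q : Pw w × Rd d => noiseOp τ q.1 φ i q.2 :=
  continuous_finsetSum _ fun k _ => (hB.τ_cont.matrix_elem i k).mul
    ((contDiff_partialDeriv hφ k).continuous.comp continuous_snd)

theorem continuous_driftOp (hB : CoefBounds b σ τ κ c) (hφ : ContDiff ℝ (⊤ : ℕ∞) φ) :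
    Continuous fun q : Pw w × Rd d => driftOp b σ τ q.1 φ q.2 := by
  refine (continuous_finsetSum _ fun i _ => (continuous_apply_b hB i).mul
    ((contDiff_partialDeriv hφ i).continuous.comp continuous_snd)).add
    (continuous_const.mul (continuous_finsetSum _ fun i _ => continuous_finsetSum _ fun j _ =>
      (Continuous.matrix_elem ?_ i j).mul
      ((contDiff_partialDeriv (contDiff_partialDeriv hφ i) j).continuous.comp continuous_snd)))
  exact (hB.σ_cont.matrix_mul hB.σ_cont).add (hB.τ_cont.matrix_mul hB.τ_cont)

theorem integrable_noiseOp (hB : CoefBounds b σ τ κ c) (hφ : Adm w C φ) (μ : Pw w) (i : Fin d) :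
    Integrable (noiseOp τ μ φ i) μ.meas :=
  μ.integrable_of_le ((continuous_noiseOp hB hφ.1 i).comp (Continuous.prodMk_right μ))
    (abs_noiseOp_le hB hφ μ i)

theorem integrable_driftOp (hB : CoefBounds b σ τ κ c) (hφ : Adm w C φ) (hw : ∀ x, 1 ≤ w x)
    (μ : Pw w) : Integrable (driftOp b σ τ μ φ) μ.meas :=
  μ.integrable_of_le ((continuous_driftOp hB hφ.1).comp (Continuous.prodMk_right μ))
    (abs_driftOp_le hB hφ hw μ)

theorem Adm.integrable (hφ : Adm w C φ) (μ : Pw w) : Integrable φ μ.meas :=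
  μ.integrable_of_le hφ.1.continuous fun x => (hφ.2 x).1

/-- The constant in the size estimates for jets of linear functionals. -/
def jetConst (d : ℕ) (c : ℝ) : ℝ := 1 + d * c + (d + d * (2 * c) + d * (d * c))

theorem jetConst_pos (hc : 0 ≤ c) : 0 < jetConst d c := by
  unfold jetConst; positivity

theorem linJet_val_grad_le (hB : CoefBounds b σ τ κ c) (hφ : Adm w C φ) (hw : ∀ x, 1 ≤ w x)
    (μ : Pw w) : |(linJet b σ τ φ μ).val| ≤ jetConst d c * C * μ.moment ∧
      ∀ i, |(linJet b σ τ φ μ).grad i| ≤ jetConst d c * C * μ.moment := by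
  have hC := hφ.nonneg hw
  have hc := hB.c_nonneg
  have hm : 0 ≤ μ.moment := zero_le_one.trans (μ.one_le_moment hw)
  have hdc : 0 ≤ d * c := by positivity
  have hdd : 0 ≤ d + d * (2 * c) + d * (d * c) := by positivity
  refine ⟨(μ.abs_integral_le fun x => (hφ.2 x).1).trans ?_, fun i =>
    (μ.abs_integral_le (abs_noiseOp_le hB hφ μ i)).trans ?_⟩
  · refine mul_le_mul_of_nonneg_right ?_ hm
    refine le_mul_of_one_le_left hC ?_
    unfold jetConst; linarith
  · refine mul_le_mul_of_nonneg_right ?_ hm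
    rw [← mul_assoc]
    refine mul_le_mul_of_nonneg_right ?_ hC
    unfold jetConst; linarith

theorem linJet_le (hB : CoefBounds b σ τ κ c) (hφ : Adm w C φ) (hw : ∀ x, 1 ≤ w x) (μ : Pw w) :
    (linJet b σ τ φ μ).Le (κ μ) (jetConst d c * C * μ.moment) := by
  have hC := hφ.nonneg hw
  have hc := hB.c_nonneg
  have hm : 0 ≤ μ.moment := zero_le_one.trans (μ.one_le_moment hw)
  have hκ := hB.one_le_κ μ
  have h := linJet_val_grad_le hB hφ hw μ
  refine ⟨h.1, h.2, (μ.abs_integral_le (abs_driftOp_le hB hφ hw μ)).trans ?_⟩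
  have : (d + d * (d * c)) * C * μ.moment ≤ jetConst d c * C * μ.moment := by
    refine mul_le_mul_of_nonneg_right (mul_le_mul_of_nonneg_right ?_ hC) hm
    have h1 : 0 ≤ d * c := by positivity
    unfold jetConst; linarith
  calc κ μ * ((d + d * (d * c)) * C) * μ.moment
      = κ μ * ((d + d * (d * c)) * C * μ.moment) := by ring
    _ ≤ _ := mul_le_mul_of_nonneg_left this (by linarith)

theorem linJet_le_of_const (hB : CoefBounds b σ τ κ c) (hφ : Adm w C φ) (hw : ∀ x, 1 ≤ w x)
    (h1 : ∀ x, ‖x‖ < 1 → ∀ i, partialDeriv i φ x = 0) (μ : Pw w) :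
    (linJet b σ τ φ μ).Le 1 (jetConst d c * C * μ.moment) := by
  have hC := hφ.nonneg hw
  have hc := hB.c_nonneg
  have hm : 0 ≤ μ.moment := zero_le_one.trans (μ.one_le_moment hw)
  have h := linJet_val_grad_le hB hφ hw μ
  refine ⟨h.1, h.2, (μ.abs_integral_le (abs_driftOp_le_of_const hB hφ hw h1 μ)).trans ?_⟩
  rw [one_mul]
  refine mul_le_mul_of_nonneg_right (mul_le_mul_of_nonneg_right ?_ hC) hm
  have h1 : 0 ≤ d * c := by positivity
  have h2 : (0 : ℝ) ≤ d := Nat.cast_nonneg d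
  unfold jetConst; linarith

theorem jetContinuous_linJet (hw : IsWeight w) (hB : CoefBounds b σ τ κ c) (hφ : Adm w C φ) :
    JetContinuous (linJet b σ τ φ) :=
  ⟨Pw.continuous_integral hw (g := fun _ => φ) (K := fun _ => C)
      (hφ.1.continuous.comp continuous_snd) continuous_const fun _ x => (hφ.2 x).1,
    fun i => Pw.continuous_integral hw (continuous_noiseOp hB hφ.1 i) continuous_const
      fun μ x => abs_noiseOp_le hB hφ μ i x,
    Pw.continuous_integral hw (continuous_driftOp hB hφ.1) (hB.κ_cont.mul continuous_const)
      fun μ x => abs_driftOp_le hB hφ hw.one_le μ x⟩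

theorem noiseOp_add (hφ : ContDiff ℝ (⊤ : ℕ∞) φ) (hψ : ContDiff ℝ (⊤ : ℕ∞) ψ) (μ : Pw w)
    (i : Fin d) (x : Rd d) : noiseOp τ μ (φ + ψ) i x = noiseOp τ μ φ i x + noiseOp τ μ ψ i x := by
  simp only [noiseOp, partialDeriv_add (differentiable_of_smooth hφ) (differentiable_of_smooth hψ),
    Pi.add_apply, mul_add, Finset.sum_add_distrib]

theorem noiseOp_smul (hφ : ContDiff ℝ (⊤ : ℕ∞) φ) (a : ℝ) (μ : Pw w) (i : Fin d) (x : Rd d) :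
    noiseOp τ μ (a • φ) i x = a * noiseOp τ μ φ i x := by
  simp only [noiseOp, partialDeriv_smul (differentiable_of_smooth hφ), Pi.smul_apply, smul_eq_mul,
    Finset.mul_sum, mul_left_comm]

theorem driftOp_add (hφ : ContDiff ℝ (⊤ : ℕ∞) φ) (hψ : ContDiff ℝ (⊤ : ℕ∞) ψ) (μ : Pw w)
    (x : Rd d) :
    driftOp b σ τ μ (φ + ψ) x = driftOp b σ τ μ φ x + driftOp b σ τ μ ψ x := by
  have h1 := fun i => differentiable_of_smooth (contDiff_partialDeriv hφ i)
  have h2 := fun i => differentiable_of_smooth (contDiff_partialDeriv hψ i)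
  simp only [driftOp,
    partialDeriv_add (differentiable_of_smooth hφ) (differentiable_of_smooth hψ),
    partialDeriv_add (h1 _) (h2 _), Pi.add_apply, mul_add, Finset.sum_add_distrib]
  ring

theorem driftOp_smul (hφ : ContDiff ℝ (⊤ : ℕ∞) φ) (a : ℝ) (μ : Pw w) (x : Rd d) :
    driftOp b σ τ μ (a • φ) x = a * driftOp b σ τ μ φ x := by
  have h1 := fun i => differentiable_of_smooth (contDiff_partialDeriv hφ i)
  simp only [driftOp, partialDeriv_smul (differentiable_of_smooth hφ),
    partialDeriv_smul (h1 _), Pi.smul_apply, smul_eq_mul, mul_left_comm _ a,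
    ← Finset.mul_sum]
  ring

theorem linJet_add (hB : CoefBounds b σ τ κ c) (hw : ∀ x, 1 ≤ w x) (hφ : Adm w C φ)
    (hψ : Adm w D ψ) (μ : Pw w) :
    linJet b σ τ (φ + ψ) μ = linJet b σ τ φ μ + linJet b σ τ ψ μ := by
  ext
  · exact integral_add (hφ.integrable μ) (hψ.integrable μ)
  · simp only [linJet, noiseOp_add hφ.1 hψ.1, Jet.add_grad]
    exact integral_add (integrable_noiseOp hB hφ μ _) (integrable_noiseOp hB hψ μ _)
  · simp only [linJet, driftOp_add hφ.1 hψ.1, Jet.add_drift]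
    exact integral_add (integrable_driftOp hB hφ hw μ) (integrable_driftOp hB hψ hw μ)

theorem linJet_smul (hφ : Adm w C φ) (a : ℝ) (μ : Pw w) :
    linJet b σ τ (a • φ) μ = a • linJet b σ τ φ μ := by
  ext
  · simp [linJet, integral_const_mul]
  · simp [linJet, noiseOp_smul hφ.1, integral_const_mul]
  · simp [linJet, driftOp_smul hφ.1, integral_const_mul]

theorem linJet_one (μ : Pw w) : linJet b σ τ (fun _ => 1) μ = 1 := by
  have h1 : ∀ i, partialDeriv i (fun _ : Rd d => (1 : ℝ)) = 0 := partialDeriv_const 1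
  have h2 : ∀ i, partialDeriv i (0 : Rd d → ℝ) = 0 := partialDeriv_const 0
  ext
  · simp [linJet]
  · simp [linJet, noiseOp, h1]
  · simp [linJet, driftOp, h1, h2]

theorem tendsto_linJet_cutoff (hB : CoefBounds b σ τ κ c) (hw : ∀ x, 1 ≤ w x) (hφ : Adm w C φ)
    (μ : Pw w) :
    Jet.Tendsto (fun n => linJet b σ τ (cutoff d n * φ) μ) atTop (linJet b σ τ φ μ) := by
  obtain ⟨D, hD⟩ := hφ.exists_cutoff hw
  have hev := fun x => cutoff_mul_eventuallyEq φ x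
  refine ⟨?_, fun i => ?_, ?_⟩
  · refine tendsto_integral_of_dominated_convergence (fun x => D * w x)
      (fun n => (hD n).1.continuous.aestronglyMeasurable) (μ.integrable.const_mul D)
      (fun n => ae_of_all _ fun x => ((hD n).2 x).1) (ae_of_all _ fun x => ?_)
    refine tendsto_const_nhds.congr' ?_
    filter_upwards [hev x] with n hn
    exact hn.eq_of_nhds.symm
  · refine tendsto_integral_of_dominated_convergence (fun x => d * (c * D) * w x)
      (fun n => (integrable_noiseOp hB (hD n) μ i).aestronglyMeasurable)
      (μ.integrable.const_mul _) (fun n => ae_of_all _ fun x => abs_noiseOp_le hB (hD n) μ i x)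
      (ae_of_all _ fun x => ?_)
    refine tendsto_const_nhds.congr' ?_
    filter_upwards [hev x] with n hn
    simp only [noiseOp, (partialDeriv_congr hn _).eq_of_nhds]
  · refine tendsto_integral_of_dominated_convergence
      (fun x => κ μ * ((d + d * (d * c)) * D) * w x)
      (fun n => (integrable_driftOp hB (hD n) hw μ).aestronglyMeasurable)
      (μ.integrable.const_mul _) (fun n => ae_of_all _ fun x => abs_driftOp_le hB (hD n) hw μ x)
      (ae_of_all _ fun x => ?_)
    refine tendsto_const_nhds.congr' ?_
    filter_upwards [hev x] with n hn
    simp only [driftOp, (partialDeriv_congr hn _).eq_of_nhds,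
      (partialDeriv_congr (partialDeriv_congr hn _) _).eq_of_nhds]

end Coefficients

/-! ### Jets of cylinder functions of measures -/

section HasJet

variable {d : ℕ} {w : Rd d → ℝ} {b : Pw w → Rd d → Rd d}
  {σ τ : Pw w → Rd d → Matrix (Fin d) (Fin d) ℝ} {κ : Pw w → ℝ} {c : ℝ} {φ ψ : Rd d → ℝ} {C D : ℝ}

/-- The perturbation `μ + ε δ_x`, whose derivative at `ε = 0` defines `∂_x`. -/
def addDirac (μ : SignedMeasure (Rd d)) (ε : ℝ) (x : Rd d) : SignedMeasure (Rd d) :=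
  μ + ε • (Measure.dirac x).toSignedMeasure

@[simp] theorem addDirac_zero (μ : SignedMeasure (Rd d)) (x : Rd d) : addDirac μ 0 x = μ := by
  simp [addDirac]

theorem integrable_variation_smul_dirac (φ : Rd d → ℝ) (ε : ℝ) (x : Rd d) :
    Integrable φ (ε • (Measure.dirac x).toSignedMeasure).variation :=
  VectorMeasure.Integrable.smul_vectorMeasure (by
    rw [VectorMeasure.Integrable, Measure.variation_toSignedMeasure]
    exact integrable_dirac (by simp)) ε

theorem integrable_variation_addDirac {μ : SignedMeasure (Rd d)}
    (h : Integrable φ μ.variation) (ε : ℝ) (x : Rd d) :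
    Integrable φ (addDirac μ ε x).variation :=
  VectorMeasure.Integrable.add_vectorMeasure h (integrable_variation_smul_dirac φ ε x)

theorem pairing_addDirac {μ : SignedMeasure (Rd d)}
    (h : Integrable φ μ.variation) (ε : ℝ) (x : Rd d) :
    pairing φ (addDirac μ ε x) = pairing φ μ + ε * φ x := by
  rw [pairing, addDirac, VectorMeasure.integral_add_vectorMeasure h
    (integrable_variation_smul_dirac φ ε x), VectorMeasure.integral_smul_vectorMeasure,
    VectorMeasure.integral_toSignedMeasure, integral_dirac]
  rfl

theorem pairing_signed (φ : Rd d → ℝ) (μ : Pw w) : pairing φ μ.signed = ∫ x, φ x ∂μ.meas :=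
  VectorMeasure.integral_toSignedMeasure

theorem integrable_variation_signed (μ : Pw w) : Integrable w μ.signed.variation := by
  rw [Pw.signed, Measure.variation_toSignedMeasure]; exact μ.integrable

theorem Adm.integrable_variation (hφ : Adm w C φ) {μ : SignedMeasure (Rd d)}
    (h : Integrable w μ.variation) : Integrable φ μ.variation :=
  (h.const_mul C).mono' hφ.1.continuous.aestronglyMeasurable (ae_of_all _ fun x => (hφ.2 x).1)

/-- `QuadRep b σ τ μ ψ q`: the function `ψ` of two variables is a finite sum of tensor products of
admissible functions, and `q = ⟨Q_μ ψ, μ ⊗ μ⟩`. -/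
inductive QuadRep (b : Pw w → Rd d → Rd d) (σ τ : Pw w → Rd d → Matrix (Fin d) (Fin d) ℝ)
    (μ : Pw w) : (Rd d → Rd d → ℝ) → ℝ → Prop
  | tensor {φ ψ : Rd d → ℝ} {C D : ℝ} (hφ : Adm w C φ) (hψ : Adm w D ψ) :
      QuadRep b σ τ μ (fun x y => φ x * ψ y)
        (∑ i, (linJet b σ τ φ μ).grad i * (linJet b σ τ ψ μ).grad i)
  | add {f g : Rd d → Rd d → ℝ} {p q : ℝ} (hf : QuadRep b σ τ μ f p) (hg : QuadRep b σ τ μ g q) :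
      QuadRep b σ τ μ (fun x y => f x y + g x y) (p + q)
  | smul {f : Rd d → Rd d → ℝ} {p : ℝ} (a : ℝ) (hf : QuadRep b σ τ μ f p) :
      QuadRep b σ τ μ (fun x y => a * f x y) (a * p)

theorem QuadRep.spec (hB : CoefBounds b σ τ κ c) {μ : Pw w} {f : Rd d → Rd d → ℝ} {q : ℝ}
    (h : QuadRep b σ τ μ f q) :
    (∀ x, Differentiable ℝ (f x)) ∧
    (∀ l y, Differentiable ℝ fun x => partialDeriv l (f x) y) ∧
    Integrable (fun z : Rd d × Rd d => diffusionOp τ μ f z.1 z.2) (μ.meas.prod μ.meas) ∧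
    ∫ z : Rd d × Rd d, diffusionOp τ μ f z.1 z.2 ∂(μ.meas.prod μ.meas) = q := by
  induction h with
  | @tensor φ ψ C D hφ hψ =>
    have dφ := differentiable_of_smooth hφ.1
    have dψ := differentiable_of_smooth hψ.1
    have e1 : ∀ l x y, partialDeriv l (fun y' => φ x * ψ y') y = φ x * partialDeriv l ψ y :=
      fun l x y => congrFun (partialDeriv_smul dψ (φ x) l) y
    have e2 : ∀ k l x y, partialDeriv k (fun x' => φ x' * partialDeriv l ψ y) x
        = partialDeriv l ψ y * partialDeriv k φ x := fun k l x y => by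
      simp only [mul_comm (φ _)]
      exact congrFun (partialDeriv_smul dφ (partialDeriv l ψ y) k) x
    have e3 : ∀ x y, diffusionOp τ μ (fun x y => φ x * ψ y) x y
        = ∑ i, noiseOp τ μ φ i x * noiseOp τ μ ψ i y := by
      intro x y
      simp only [diffusionOp, e1, e2, noiseOp, Finset.sum_mul_sum]
      exact Finset.sum_congr rfl fun i _ => Finset.sum_congr rfl fun k _ =>
        Finset.sum_congr rfl fun l _ => by ring
    refine ⟨fun x => dψ.const_mul _, fun l y => ?_, ?_, ?_⟩
    · simp only [e1]; exact dφ.mul_const _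
    · simp only [e3]
      exact integrable_finsetSum _ fun i _ =>
        (integrable_noiseOp hB hφ μ i).mul_prod (integrable_noiseOp hB hψ μ i)
    · simp only [e3]
      rw [integral_finsetSum _ fun i _ =>
        (integrable_noiseOp hB hφ μ i).mul_prod (integrable_noiseOp hB hψ μ i)]
      exact Finset.sum_congr rfl fun i _ => integral_prod_mul _ _
  | @add f g p q _ _ hf hg =>
    have e1 : ∀ l x y, partialDeriv l (fun y' => f x y' + g x y') y
        = partialDeriv l (f x) y + partialDeriv l (g x) y :=
      fun l x y => congrFun (partialDeriv_add (hf.1 x) (hg.1 x) l) y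
    have e2 : ∀ k l x y, partialDeriv k (fun x' => partialDeriv l (f x') y
          + partialDeriv l (g x') y) x
        = partialDeriv k (fun x' => partialDeriv l (f x') y) x
          + partialDeriv k (fun x' => partialDeriv l (g x') y) x :=
      fun k l x y => congrFun (partialDeriv_add (hf.2.1 l y) (hg.2.1 l y) k) x
    have e3 : ∀ x y, diffusionOp τ μ (fun x y => f x y + g x y) x y
        = diffusionOp τ μ f x y + diffusionOp τ μ g x y := by
      intro x y
      simp only [diffusionOp, e1, e2, mul_add, Finset.sum_add_distrib]
    refine ⟨fun x => (hf.1 x).add (hg.1 x), fun l y => ?_, ?_, ?_⟩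
    · simp only [e1]; exact (hf.2.1 l y).add (hg.2.1 l y)
    · simp only [e3]; exact hf.2.2.1.add hg.2.2.1
    · simp only [e3]; rw [integral_add hf.2.2.1 hg.2.2.1, hf.2.2.2, hg.2.2.2]
  | @smul f p a _ hf =>
    have e1 : ∀ l x y, partialDeriv l (fun y' => a * f x y') y = a * partialDeriv l (f x) y :=
      fun l x y => congrFun (partialDeriv_smul (hf.1 x) a l) y
    have e2 : ∀ k l x y, partialDeriv k (fun x' => a * partialDeriv l (f x') y) x
        = a * partialDeriv k (fun x' => partialDeriv l (f x') y) x :=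
      fun k l x y => congrFun (partialDeriv_smul (hf.2.1 l y) a k) x
    have e3 : ∀ x y, diffusionOp τ μ (fun x y => a * f x y) x y = a * diffusionOp τ μ f x y := by
      intro x y
      simp only [diffusionOp, e1, e2, Finset.mul_sum]
      exact Finset.sum_congr rfl fun i _ => Finset.sum_congr rfl fun k _ =>
        Finset.sum_congr rfl fun l _ => by ring
    refine ⟨fun x => (hf.1 x).const_mul _, fun l y => ?_, ?_, ?_⟩
    · simp only [e1]; exact (hf.2.1 l y).const_mul _
    · simp only [e3]; exact hf.2.2.1.const_mul _
    · simp only [e3]; rw [integral_const_mul, hf.2.2.2]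

/-- `J` is the Itô jet of the function `f` of measures: `f` has first and second derivatives at all
signed measures integrating `w` (the perturbations of `μ ∈ 𝒫_w` are signed), and at `μ ∈ 𝒫_w` these are admissible and yield the gradient and
drift of `J μ`. -/
def HasJet (b : Pw w → Rd d → Rd d) (σ τ : Pw w → Rd d → Matrix (Fin d) (Fin d) ℝ)
    (f : SignedMeasure (Rd d) → ℝ) (J : Pw w → Jet d) : Prop :=
  ∃ (D : SignedMeasure (Rd d) → Rd d → ℝ) (D₂ : SignedMeasure (Rd d) → Rd d → Rd d → ℝ),
    (∀ μ, Integrable w μ.variation → ∀ x, HasDerivAt (fun ε => f (addDirac μ ε x)) (D μ x) 0) ∧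
    (∀ μ, Integrable w μ.variation → ∀ x y,
      HasDerivAt (fun ε => D (addDirac μ ε x) y) (D₂ μ x y) 0) ∧
    ∀ μ : Pw w, (J μ).val = f μ.signed ∧ (∃ C, Adm w C (D μ.signed)) ∧
      (∀ i, (J μ).grad i = (linJet b σ τ (D μ.signed) μ).grad i) ∧
      ∃ q, QuadRep b σ τ μ (D₂ μ.signed) q ∧
        (J μ).drift = (linJet b σ τ (D μ.signed) μ).drift + q / 2

theorem HasJet.generator_eq (hB : CoefBounds b σ τ κ c)
    {f : SignedMeasure (Rd d) → ℝ} {J : Pw w → Jet d} (h : HasJet b σ τ f J) (μ : Pw w) :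
    f μ.signed = (J μ).val ∧ generator b σ τ f μ = (J μ).drift := by
  obtain ⟨D, D₂, h1, h2, h3⟩ := h
  obtain ⟨hv, -, -, q, hq, hd⟩ := h3 μ
  have hμ := integrable_variation_signed μ
  have m1 : ∀ ν : SignedMeasure (Rd d), Integrable w ν.variation → ∀ y, measDeriv y f ν = D ν y :=
    fun ν hν y => (h1 ν hν y).deriv
  have m2 : ∀ x y, measDeriv x (measDeriv y f) μ.signed = D₂ μ.signed x y := by
    intro x y
    rw [← (h2 _ hμ x y).deriv]
    exact congrArg (fun g => deriv g 0) (funext fun ε =>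
      m1 _ (integrable_variation_addDirac hμ ε x) y)
  refine ⟨hv.symm, ?_⟩
  rw [generator, hd, ← (hq.spec hB).2.2.2]
  simp only [m1 _ hμ, m2]
  rw [linJet]
  ring

theorem hasJet_pairing (hw : ∀ x, 1 ≤ w x) (hφ : Adm w C φ) :
    HasJet b σ τ (pairing φ) (linJet b σ τ φ) := by
  refine ⟨fun _ => φ, fun _ _ _ => 0, fun μ hμ x => ?_, fun _ _ _ _ => hasDerivAt_const _ _,
    fun μ => ⟨(pairing_signed φ μ).symm, ⟨C, hφ⟩, fun _ => rfl, 0, ?_, by simp⟩⟩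
  · simp only [pairing_addDirac (hφ.integrable_variation hμ)]
    simpa using ((hasDerivAt_id (0 : ℝ)).mul_const (φ x)).const_add (pairing φ μ)
  · simpa using QuadRep.smul 0 (QuadRep.tensor (adm_one hw) (adm_one hw))

theorem hasJet_expNeg (hw : IsWeight w) :
    HasJet b σ τ (expNeg w) fun μ => Jet.comp (fun y => Real.exp (-y)) (linJet b σ τ w μ) := by
  obtain ⟨C, hC⟩ := hw.exists_adm
  have hd1 : deriv (fun y : ℝ => Real.exp (-y)) = fun y => -Real.exp (-y) := by
    funext y; simpa using ((hasDerivAt_neg y).exp).deriv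
  have hd2 : deriv (deriv fun y : ℝ => Real.exp (-y)) = fun y => Real.exp (-y) := by
    rw [hd1]; funext y; simpa using ((hasDerivAt_neg y).exp).neg.deriv
  have hlin : ∀ μ : SignedMeasure (Rd d), Integrable w μ.variation → ∀ x,
      HasDerivAt (fun ε => pairing w (addDirac μ ε x)) (w x) 0 := fun μ hμ x => by
    simp only [pairing_addDirac hμ]
    simpa using ((hasDerivAt_id (0 : ℝ)).mul_const (w x)).const_add (pairing w μ)
  have he : ∀ μ : SignedMeasure (Rd d), Integrable w μ.variation → ∀ x,
      HasDerivAt (fun ε => Real.exp (-pairing w (addDirac μ ε x)))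
        (-(Real.exp (-pairing w μ) * w x)) 0 := fun μ hμ x => by
    simpa using (hlin μ hμ x).neg.exp
  refine ⟨fun μ x => -(Real.exp (-pairing w μ) * w x),
    fun μ x y => Real.exp (-pairing w μ) * (w x * w y), fun μ hμ x => ?_, fun μ hμ x y => ?_,
    fun μ => ⟨?_, ?_, ?_, ?_⟩⟩
  -- `w` stays integrable along the perturbation, so the value `0` of `expNeg` is not taken
  · have : (fun ε => expNeg w (addDirac μ ε x))
        = fun ε => Real.exp (-pairing w (addDirac μ ε x)) := by
      funext ε
      simp [expNeg, integrable_variation_addDirac hμ ε x]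
    rw [this]; exact he μ hμ x
  · have := ((he μ hμ x).mul_const (w y)).neg
    convert! this using 1
    ring
  · simp [expNeg, integrable_variation_signed μ, pairing_signed, linJet]
  all_goals
    have hD : (fun x => -(Real.exp (-pairing w μ.signed) * w x))
        = (-Real.exp (-pairing w μ.signed)) • w := by funext x; simp
  · beta_reduce; rw [hD]; exact ⟨_, hC.smul _⟩
  · intro i
    beta_reduce
    rw [hD, linJet_smul hC, Jet.comp_grad, hd1, Jet.smul_grad, pairing_signed]
    rfl
  · refine ⟨_, QuadRep.smul _ (QuadRep.tensor hC hC), ?_⟩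
    beta_reduce
    rw [hD, linJet_smul hC, Jet.comp_drift, hd2, hd1, Jet.smul_drift, pairing_signed, Jet.normSq]
    simp only [linJet]
    ring

theorem hasJet_const (hw : ∀ x, 1 ≤ w x) (a : ℝ) :
    HasJet b σ τ (fun _ => a) fun _ : Pw w => algebraMap ℝ (Jet d) a := by
  have h0 : Adm w (|0| * 1) ((0 : ℝ) • fun _ : Rd d => (1 : ℝ)) := (adm_one hw).smul 0
  have e0 : ((0 : ℝ) • fun _ : Rd d => (1 : ℝ)) = fun _ => 0 := by funext x; simp
  refine ⟨fun _ _ => 0, fun _ _ _ => 0, fun _ _ _ => hasDerivAt_const _ _,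
    fun _ _ _ _ => hasDerivAt_const _ _, fun μ => ⟨by simp, ⟨_, e0 ▸ h0⟩, fun i => ?_, 0, ?_, ?_⟩⟩
  · rw [← e0, linJet_smul (adm_one hw)]; simp
  · simpa using QuadRep.smul 0 (QuadRep.tensor (adm_one hw) (adm_one hw))
  · rw [← e0, linJet_smul (adm_one hw)]; simp

theorem HasJet.add (hB : CoefBounds b σ τ κ c) (hw : ∀ x, 1 ≤ w x)
    {f g : SignedMeasure (Rd d) → ℝ} {J K : Pw w → Jet d}
    (hf : HasJet b σ τ f J) (hg : HasJet b σ τ g K) :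
    HasJet b σ τ (f + g) fun μ => J μ + K μ := by
  obtain ⟨D, D₂, h1, h2, h3⟩ := hf
  obtain ⟨E, E₂, k1, k2, k3⟩ := hg
  refine ⟨fun μ => D μ + E μ, fun μ x y => D₂ μ x y + E₂ μ x y,
    fun μ hμ x => (h1 μ hμ x).add (k1 μ hμ x), fun μ hμ x y => (h2 μ hμ x y).add (k2 μ hμ x y),
    fun μ => ?_⟩
  obtain ⟨a1, ⟨C, hC⟩, a3, p, hp, a4⟩ := h3 μ
  obtain ⟨b1, ⟨C', hC'⟩, b3, q, hq, b4⟩ := k3 μ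
  refine ⟨by simp [a1, b1], ⟨_, hC.add hC'⟩, fun i => ?_, p + q, hp.add hq, ?_⟩
  · rw [linJet_add hB hw hC hC']; simp [a3, b3]
  · rw [linJet_add hB hw hC hC']; simp [a4, b4]; ring

theorem HasJet.mul (hB : CoefBounds b σ τ κ c) (hw : ∀ x, 1 ≤ w x)
    {f g : SignedMeasure (Rd d) → ℝ} {J K : Pw w → Jet d}
    (hf : HasJet b σ τ f J) (hg : HasJet b σ τ g K) :
    HasJet b σ τ (f * g) fun μ => J μ * K μ := by
  obtain ⟨D, D₂, h1, h2, h3⟩ := hf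
  obtain ⟨E, E₂, k1, k2, k3⟩ := hg
  refine ⟨fun μ => f μ • E μ + g μ • D μ,
    fun μ x y => (D μ x * E μ y + f μ * E₂ μ x y) + (E μ x * D μ y + g μ * D₂ μ x y),
    fun μ hμ x => ?_, fun μ hμ x y => ?_, fun μ => ?_⟩
  · have := (h1 μ hμ x).mul (k1 μ hμ x)
    simp only [addDirac_zero] at this
    convert! this using 1
    simp; ring
  · have := ((h1 μ hμ x).mul (k2 μ hμ x y)).add ((k1 μ hμ x).mul (h2 μ hμ x y))
    simp only [addDirac_zero] at this
    exact this
  obtain ⟨a1, ⟨C, hC⟩, a3, p, hp, a4⟩ := h3 μ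
  obtain ⟨b1, ⟨C', hC'⟩, b3, q, hq, b4⟩ := k3 μ
  have hlin : linJet b σ τ (f μ.signed • E μ.signed + g μ.signed • D μ.signed) μ
      = f μ.signed • linJet b σ τ (E μ.signed) μ + g μ.signed • linJet b σ τ (D μ.signed) μ := by
    rw [linJet_add hB hw (hC'.smul _) (hC.smul _), linJet_smul hC', linJet_smul hC]
  refine ⟨by simp [a1, b1], ⟨_, (hC'.smul _).add (hC.smul _)⟩, fun i => ?_, _,
    ((QuadRep.tensor hC hC').add (hq.smul _)).add ((QuadRep.tensor hC' hC).add (hp.smul _)), ?_⟩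
  · rw [hlin]; simp [a3, b3, a1, b1]
  · rw [hlin]
    have hs : ∑ i, (linJet b σ τ (E μ.signed) μ).grad i * (linJet b σ τ (D μ.signed) μ).grad i
        = ∑ i, (linJet b σ τ (D μ.signed) μ).grad i * (linJet b σ τ (E μ.signed) μ).grad i :=
      Finset.sum_congr rfl fun i _ => mul_comm _ _
    simp only [Jet.mul_drift, Jet.add_drift, Jet.smul_drift, a1, b1, a3, b3, a4, b4, hs]
    ring

theorem HasJet.smul (hB : CoefBounds b σ τ κ c) (hw : ∀ x, 1 ≤ w x)
    {f : SignedMeasure (Rd d) → ℝ} {J : Pw w → Jet d} (a : ℝ) (hf : HasJet b σ τ f J) :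
    HasJet b σ τ (a • f) fun μ => a • J μ := by
  have := (hasJet_const (b := b) (σ := σ) (τ := τ) hw a).mul hB hw hf
  simp only [← Algebra.smul_def] at this
  exact this

/-- Every function in `ℰ_w` has a jet. The predicate `p` carries further properties of the jets of
linear functionals through sums and products. -/
theorem exists_hasJet_of_mem_Ew (hB : CoefBounds b σ τ κ c) (hw : IsWeight w)
    {p : (Pw w → Jet d) → Prop} (hlin : ∀ φ C, Adm w C φ → p (linJet b σ τ φ))
    (hconst : ∀ a : ℝ, p fun _ => algebraMap ℝ (Jet d) a)
    (hadd : ∀ J K, p J → p K → p fun μ => J μ + K μ)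
    (hmul : ∀ J K, p J → p K → p fun μ => J μ * K μ)
    {f : SignedMeasure (Rd d) → ℝ} (hf : f ∈ Ew w) : ∃ J, HasJet b σ τ f J ∧ p J := by
  refine Algebra.adjoin_induction (fun f hf => ?_) (fun a => ?_) (fun f g _ _ hf hg => ?_)
    (fun f g _ _ hf hg => ?_) hf
  · obtain ⟨φ, hφ, rfl⟩ := hf
    obtain ⟨C, hC⟩ := hw.Cw_le hφ
    exact ⟨_, hasJet_pairing hw.one_le hC, hlin φ C hC⟩
  · exact ⟨_, hasJet_const hw.one_le a, hconst a⟩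
  · obtain ⟨J, hJ, pJ⟩ := hf
    obtain ⟨K, hK, pK⟩ := hg
    exact ⟨_, hJ.add hB hw.one_le hK, hadd J K pJ pK⟩
  · obtain ⟨J, hJ, pJ⟩ := hf
    obtain ⟨K, hK, pK⟩ := hg
    exact ⟨_, hJ.mul hB hw.one_le hK, hmul J K pJ pK⟩

end HasJet

/-! ### Polynomial approximation and cutoffs on the real line -/

section RealLine

theorem exists_polynomial_antiderivative (Q : Polynomial ℝ) (a : ℝ) :
    ∃ P : Polynomial ℝ, Polynomial.derivative P = Q ∧ P.eval 0 = a := by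
  suffices h : ∃ P : Polynomial ℝ, Polynomial.derivative P = Q by
    obtain ⟨P, hP⟩ := h
    exact ⟨P + Polynomial.C (a - P.eval 0), by simp [hP], by simp⟩
  induction Q using Polynomial.induction_on' with
  | add P Q hP hQ =>
    obtain ⟨P', hP⟩ := hP
    obtain ⟨Q', hQ⟩ := hQ
    exact ⟨P' + Q', by simp [hP, hQ]⟩
  | monomial n c =>
    refine ⟨Polynomial.monomial (n + 1) (c / (n + 1)), ?_⟩
    rw [Polynomial.derivative_monomial]
    congr 1
    push_cast
    field_simp

theorem abs_le_of_abs_deriv_le {f : ℝ → ℝ} (hf : Differentiable ℝ f) (h0 : f 0 = 0) {A e : ℝ}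
    (he : 0 ≤ e) (h : ∀ x ∈ Set.Icc (-A) A, |deriv f x| ≤ e) {x : ℝ} (hx : x ∈ Set.Icc (-A) A) :
    |f x| ≤ e * A := by
  have hA : 0 ≤ A := by linarith [hx.1, hx.2]
  have := (convex_Icc (-A) A).norm_image_sub_le_of_norm_deriv_le (f := f) (C := e)
    (fun x _ => hf x) (fun x hx => h x hx) (show (0 : ℝ) ∈ Set.Icc (-A) A from ⟨by linarith, hA⟩) hx
  rw [h0, sub_zero, sub_zero] at this
  exact this.trans (mul_le_mul_of_nonneg_left (abs_le.2 hx) he)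

/-- Weierstrass approximation together with the first two derivatives on a symmetric interval. -/
theorem exists_polynomial_near_deriv {G : ℝ → ℝ} (hG : ContDiff ℝ 2 G) (A : ℝ) {e : ℝ}
    (he : 0 < e) :
    ∃ P : Polynomial ℝ, ∀ x ∈ Set.Icc (-A) A, |P.eval x - G x| ≤ e * A * A ∧
      |(Polynomial.derivative P).eval x - deriv G x| ≤ e * A ∧
      |(Polynomial.derivative (Polynomial.derivative P)).eval x - deriv (deriv G) x| ≤ e := by
  have hG1 := ((contDiff_succ_iff_deriv (n := 1)).1 hG).2.2
  have hd0 := hG.differentiable (by norm_num)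
  have hd1 := hG1.differentiable (by norm_num)
  -- approximate `G''` uniformly and integrate twice
  obtain ⟨Q, hQ⟩ := exists_polynomial_near_of_continuousOn (-A) A (deriv (deriv G))
    (hG1.continuous_deriv le_rfl).continuousOn e he
  obtain ⟨P₁, hP₁, h1⟩ := exists_polynomial_antiderivative Q (deriv G 0)
  obtain ⟨P, hP, h0⟩ := exists_polynomial_antiderivative P₁ (G 0)
  have e1 : ∀ x ∈ Set.Icc (-A) A, |P₁.eval x - deriv G x| ≤ e * A := by
    intro x hx
    refine abs_le_of_abs_deriv_le (f := fun x => P₁.eval x - deriv G x)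
      (P₁.differentiable.sub hd1) (by simp [h1]) he.le (fun y hy => ?_) hx
    rw [deriv_fun_sub P₁.differentiableAt (hd1 y), Polynomial.deriv, hP₁]
    exact (hQ y hy).le
  refine ⟨P, fun x hx => ⟨?_, by rw [hP]; exact e1 x hx, by rw [hP, hP₁]; exact (hQ x hx).le⟩⟩
  have hA : 0 ≤ A := by linarith [hx.1, hx.2]
  refine abs_le_of_abs_deriv_le (f := fun x => P.eval x - G x)
    (P.differentiable.sub hd0) (by simp [h0]) (by positivity) (fun y hy => ?_) hx
  rw [deriv_fun_sub P.differentiableAt (hd0 y), Polynomial.deriv, hP]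
  exact e1 y hy

theorem exists_bound_Icc {g : ℝ → ℝ} (hg : Continuous g) (a b : ℝ) :
    ∃ M, ∀ x ∈ Set.Icc a b, |g x| ≤ M := by
  obtain ⟨M, hM⟩ := (isCompact_Icc (a := a) (b := b)).exists_bound_of_continuousOn hg.continuousOn
  exact ⟨M, hM⟩

theorem exists_bound_derivs {G : ℝ → ℝ} (hG : ContDiff ℝ 2 G) (a b : ℝ) :
    ∃ M, 0 ≤ M ∧ ∀ x ∈ Set.Icc a b, |G x| ≤ M ∧ |deriv G x| ≤ M ∧ |deriv (deriv G) x| ≤ M := by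
  have hG1 := ((contDiff_succ_iff_deriv (n := 1)).1 hG).2.2
  obtain ⟨M₀, h0⟩ := exists_bound_Icc hG.continuous a b
  obtain ⟨M₁, h1⟩ := exists_bound_Icc hG1.continuous a b
  obtain ⟨M₂, h2⟩ := exists_bound_Icc (hG1.continuous_deriv le_rfl) a b
  refine ⟨max 0 (max M₀ (max M₁ M₂)), le_max_left _ _, fun x hx =>
    ⟨(h0 x hx).trans ?_, (h1 x hx).trans ?_, (h2 x hx).trans ?_⟩⟩ <;> simp

/-- A sequence of polynomials converging on `[-A, A]` to a `C²` function together with the first two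
derivatives, with uniform bounds. -/
theorem exists_polynomial_seq {G : ℝ → ℝ} (hG : ContDiff ℝ 2 G) (A : ℝ) :
    ∃ (P : ℕ → Polynomial ℝ) (M : ℝ), ∀ x ∈ Set.Icc (-A) A,
      (∀ n, |(P n).eval x| ≤ M ∧ |deriv (fun y => (P n).eval y) x| ≤ M ∧
        |deriv (deriv fun y => (P n).eval y) x| ≤ M) ∧
      Tendsto (fun n => (P n).eval x) atTop (𝓝 (G x)) ∧
      Tendsto (fun n => deriv (fun y => (P n).eval y) x) atTop (𝓝 (deriv G x)) ∧
      Tendsto (fun n => deriv (deriv fun y => (P n).eval y) x) atTop (𝓝 (deriv (deriv G) x)) := by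
  have hdP : ∀ P : Polynomial ℝ, (deriv fun y => P.eval y) = fun y => P.derivative.eval y :=
    fun P => funext fun y => Polynomial.deriv P
  choose P hP using fun n : ℕ =>
    exists_polynomial_near_deriv hG A (show (0 : ℝ) < 1 / ((n : ℝ) + 1) by positivity)
  obtain ⟨M, hM0, hM⟩ := exists_bound_derivs hG (-A) A
  have he : Tendsto (fun n : ℕ => 1 / ((n : ℝ) + 1)) atTop (𝓝 0) :=
    tendsto_one_div_add_atTop_nhds_zero_nat
  have hsq : ∀ {u : ℕ → ℝ} {g K : ℝ}, (∀ n : ℕ, |u n - g| ≤ 1 / ((n : ℝ) + 1) * K) →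
      Tendsto u atTop (𝓝 g) := by
    intro u g K h
    rw [tendsto_iff_norm_sub_tendsto_zero]
    exact squeeze_zero (fun _ => norm_nonneg _) h (by simpa using he.mul_const K)
  refine ⟨P, M + (1 + |A| + |A| * |A|), fun x hx => ?_⟩
  have hA : 0 ≤ A := by linarith [hx.1, hx.2]
  simp only [hdP]
  refine ⟨fun n => ?_, hsq fun n => by simpa only [mul_assoc] using (hP n x hx).1,
    hsq fun n => (hP n x hx).2.1, hsq (K := 1) fun n => by simpa using (hP n x hx).2.2⟩
  obtain ⟨a0, a1, a2⟩ := hP n x hx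
  obtain ⟨m0, m1, m2⟩ := hM x hx
  have h1 : 1 / ((n : ℝ) + 1) ≤ 1 := by
    rw [div_le_one (by positivity)]; linarith [Nat.cast_nonneg (α := ℝ) n]
  have b1 : 1 / ((n : ℝ) + 1) * A ≤ 1 * A := mul_le_mul_of_nonneg_right h1 hA
  have b2 : 1 / ((n : ℝ) + 1) * A * A ≤ 1 * A * A := mul_le_mul_of_nonneg_right b1 hA
  have hAA := mul_nonneg hA hA
  rw [abs_of_nonneg hA]
  rw [abs_le] at *
  refine ⟨?_, ?_, ?_⟩ <;> (try rw [abs_le]) <;> constructor <;>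
    linarith [a0.1, a0.2, a1.1, a1.2, a2.1, a2.2, m0.1, m0.2, m1.1, m1.2, m2.1, m2.2]

/-- A smooth cutoff, equal to `1` on `(-∞, R]` and to `0` on `[R + 1, ∞)`. -/
def stepDown (R y : ℝ) : ℝ := Real.smoothTransition (R + 1 - y)

theorem contDiff_stepDown (R : ℝ) : ContDiff ℝ 2 (stepDown R) :=
  Real.smoothTransition.contDiff.comp (contDiff_const.sub contDiff_id)

theorem stepDown_of_le {R y : ℝ} (h : y ≤ R) : stepDown R y = 1 :=
  Real.smoothTransition.one_of_one_le (by linarith)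

theorem stepDown_of_ge {R y : ℝ} (h : R + 1 ≤ y) : stepDown R y = 0 :=
  Real.smoothTransition.zero_of_nonpos (by linarith)

theorem stepDown_nonneg (R y : ℝ) : 0 ≤ stepDown R y := Real.smoothTransition.nonneg _

theorem stepDown_le_one (R y : ℝ) : stepDown R y ≤ 1 := Real.smoothTransition.le_one _

theorem stepDown_eventuallyEq_one {R y : ℝ} (h : y < R) : stepDown R =ᶠ[𝓝 y] fun _ => 1 := by
  filter_upwards [Iio_mem_nhds h] with x hx using stepDown_of_le (le_of_lt hx)

theorem stepDown_eventuallyEq_zero {R y : ℝ} (h : R + 1 < y) : stepDown R =ᶠ[𝓝 y] fun _ => 0 := by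
  filter_upwards [Ioi_mem_nhds h] with x hx using stepDown_of_ge (le_of_lt hx)

/-- The cutoffs have uniformly bounded derivatives, being translates of each other. -/
theorem exists_bound_stepDown : ∃ M, 0 ≤ M ∧ ∀ R y, |stepDown R y| ≤ M ∧
    |deriv (stepDown R) y| ≤ M ∧ |deriv (deriv (stepDown R)) y| ≤ M := by
  obtain ⟨M, hM0, hM⟩ := exists_bound_derivs (contDiff_stepDown 0) 0 1
  have hshift : ∀ R, stepDown R = fun y => stepDown 0 (y - R) := fun R => by
    funext y; simp only [stepDown]; congr 1; ring
  have h1 : ∀ R, deriv (stepDown R) = fun y => deriv (stepDown 0) (y - R) := fun R => by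
    funext y; rw [hshift R]; exact deriv_comp_sub_const (f := stepDown 0) R y
  have h2 : ∀ R, deriv (deriv (stepDown R)) = fun y => deriv (deriv (stepDown 0)) (y - R) :=
    fun R => by
      funext y; rw [h1 R]; exact deriv_comp_sub_const (f := deriv (stepDown 0)) R y
  refine ⟨max M 1, by positivity, fun R y => ?_⟩
  have h0 : |stepDown R y| ≤ max M 1 := by
    rw [abs_of_nonneg (stepDown_nonneg _ _)]
    exact (stepDown_le_one _ _).trans (le_max_right _ _)
  refine ⟨h0, ?_⟩
  rw [h2, h1]
  beta_reduce
  generalize y - R = x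
  have hconst : ∀ a : ℝ, stepDown 0 =ᶠ[𝓝 x] (fun _ => a) →
      |deriv (stepDown 0) x| ≤ max M 1 ∧ |deriv (deriv (stepDown 0)) x| ≤ max M 1 := by
    intro a h
    have e1 : deriv (stepDown 0) =ᶠ[𝓝 x] fun _ => 0 := by simpa using h.deriv
    have e2 : deriv (deriv (stepDown 0)) =ᶠ[𝓝 x] fun _ => 0 := by simpa using e1.deriv
    rw [e1.eq_of_nhds, e2.eq_of_nhds]
    simp
  rcases lt_or_ge x 0 with hx | hx
  · exact hconst 1 (stepDown_eventuallyEq_one hx)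
  rcases le_or_gt x 1 with hx' | hx'
  · exact ⟨(hM x ⟨hx, hx'⟩).2.1.trans (le_max_left _ _), (hM x ⟨hx, hx'⟩).2.2.trans (le_max_left _ _)⟩
  · exact hconst 0 (stepDown_eventuallyEq_zero (by linarith))

/-- A `C²` function vanishing near `+∞` is a `C²` function of `exp (-y)`. -/
theorem exists_contDiff_comp_exp_neg {F : ℝ → ℝ} (hF : ContDiff ℝ 2 F) {R : ℝ}
    (hR : ∀ y, R ≤ y → F y = 0) :
    ∃ G : ℝ → ℝ, ContDiff ℝ 2 G ∧ ∀ y, G (Real.exp (-y)) = F y := by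
  -- the function vanishes for `u < exp (-R)`, so it is smooth across `u = 0`
  refine ⟨fun u => if u ≤ 0 then 0 else F (-Real.log u), ?_, fun y => ?_⟩
  · rw [contDiff_iff_contDiffAt]
    intro u
    rcases lt_or_ge u (Real.exp (-R)) with hu | hu
    · refine (contDiffAt_const (c := (0 : ℝ))).congr_of_eventuallyEq ?_
      filter_upwards [Iio_mem_nhds hu] with v hv
      split_ifs with h
      · rfl
      · refine hR _ ?_
        have := Real.log_lt_log (not_le.1 h) hv
        rw [Real.log_exp] at this
        linarith
    · have hu0 : 0 < u := (Real.exp_pos _).trans_le hu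
      have h1 : ContDiffAt ℝ 2 (fun u => F (-Real.log u)) u :=
        hF.contDiffAt.comp u (Real.contDiffAt_log.2 hu0.ne').neg
      refine h1.congr_of_eventuallyEq ?_
      filter_upwards [Ioi_mem_nhds hu0] with v hv
      rw [if_neg (not_le.2 hv)]
  · simp [not_le.2 (Real.exp_pos (-y))]

theorem contDiff_exp_neg : ContDiff ℝ 2 fun y : ℝ => Real.exp (-y) :=
  Real.contDiff_exp.comp contDiff_neg

theorem deriv_exp_neg : (deriv fun y : ℝ => Real.exp (-y)) = fun y => -Real.exp (-y) := by
  funext y; simpa using ((hasDerivAt_neg y).exp).deriv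

theorem deriv_deriv_exp_neg :
    (deriv (deriv fun y : ℝ => Real.exp (-y))) = fun y => Real.exp (-y) := by
  rw [deriv_exp_neg]; funext y; simpa using ((hasDerivAt_neg y).exp).neg.deriv

theorem Jet.comp_exp_neg {d : ℕ} (J : Jet d) :
    Jet.comp (fun y => Real.exp (-y)) J = Jet.comp Real.exp (-J) := by
  ext
  · simp
  · simp [deriv_exp_neg]
  · simp [Jet.comp_drift, deriv_exp_neg, Jet.normSq]

theorem Jet.comp_exp_neg_mul_comp_exp {d : ℕ} (J : Jet d) :
    Jet.comp (fun y => Real.exp (-y)) J * Jet.comp Real.exp J = 1 := by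
  rw [← Jet.comp_mul contDiff_exp_neg Real.contDiff_exp]
  have : (fun y => Real.exp (-y) * Real.exp y) = fun _ => 1 := by
    funext y; rw [← Real.exp_add]; simp
  rw [this, Jet.comp_const, map_one]

end RealLine

/-! ### The bounded pointwise closure of the domain -/

section Core

variable {d : ℕ} {w : Rd d → ℝ} {b : Pw w → Rd d → Rd d}
  {σ τ : Pw w → Rd d → Matrix (Fin d) (Fin d) ℝ} {κ : Pw w → ℝ} {c : ℝ} {φ ψ : Rd d → ℝ} {C D : ℝ}

/-- The smallest class of jets which contains the jets of `a + f`, for `f ∈ 𝒟_w` with a continuous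
jet whose value and gradient are bounded and whose drift is bounded by a multiple of `κ`, and which
is closed under pointwise limits subject to the same bounds. The limit is required to be continuous,
so that its composition with a right-continuous path is right-continuous. -/
inductive Core (b : Pw w → Rd d → Rd d) (σ τ : Pw w → Rd d → Matrix (Fin d) (Fin d) ℝ)
    (κ : Pw w → ℝ) : (Pw w → Jet d) → Prop
  | base {f : SignedMeasure (Rd d) → ℝ} {J : Pw w → Jet d} {C : ℝ} (a : ℝ) (hf : f ∈ Dw w)
      (hJ : HasJet b σ τ f J) (hc : JetContinuous J) (hC : ∀ μ, (J μ).Le (κ μ) C) :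
      Core b σ τ κ fun μ => algebraMap ℝ (Jet d) a + J μ
  | lim {J : ℕ → Pw w → Jet d} {K : Pw w → Jet d} {C : ℝ} (hJ : ∀ n, Core b σ τ κ (J n))
      (hC : ∀ n μ, (J n μ).Le (κ μ) C) (hK : JetContinuous K)
      (hlim : ∀ μ, Jet.Tendsto (fun n => J n μ) atTop (K μ)) : Core b σ τ κ K

theorem Jet.Le.of_tendsto {κ a : ℝ} {J : ℕ → Jet d} {K : Jet d} (h : ∀ n, (J n).Le κ a)
    (hlim : Jet.Tendsto J atTop K) : K.Le κ a :=
  ⟨le_of_tendsto' hlim.1.abs fun n => (h n).1,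
    fun i => le_of_tendsto' (hlim.2.1 i).abs fun n => (h n).2.1 i,
    le_of_tendsto' hlim.2.2.abs fun n => (h n).2.2⟩

theorem Jet.le_algebraMap (a : ℝ) {κ : ℝ} (hκ : 0 ≤ κ) :
    (algebraMap ℝ (Jet d) a).Le κ |a| := by
  refine ⟨by simp, fun i => by simp, ?_⟩
  simpa using mul_nonneg hκ (abs_nonneg a)

variable {J K : Pw w → Jet d}

theorem Core.continuous (h : Core b σ τ κ J) : JetContinuous J := by
  induction h with
  | base a hf hJ hc hC => exact (jetContinuous_const _).add hc
  | lim hJ hC hK hlim ih => exact hK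

theorem Core.exists_le (h : Core b σ τ κ J) (hκ : ∀ μ, 1 ≤ κ μ) :
    ∃ C, ∀ μ, (J μ).Le (κ μ) C := by
  induction h with
  | base a hf hJ hc hC =>
    exact ⟨_, fun μ => (Jet.le_algebraMap a (zero_le_one.trans (hκ μ))).add (hC μ)⟩
  | lim hJ hC hK hlim ih => exact ⟨_, fun μ => .of_tendsto (fun n => hC n μ) (hlim μ)⟩

theorem Core.add (hB : CoefBounds b σ τ κ c) (hw : ∀ x, 1 ≤ w x) (hJ : Core b σ τ κ J)
    (hK : Core b σ τ κ K) : Core b σ τ κ fun μ => J μ + K μ := by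
  induction hJ generalizing K with
  | @base f J C a hf hJ hc hC =>
    induction hK with
    | @base g K D a' hg hK hc' hD =>
      have := Core.base (κ := κ) (a + a') (add_mem hf hg) (hJ.add hB hw hK) (hc.add hc')
        fun μ => (hC μ).add (hD μ)
      convert this using 2
      rw [map_add]; ring
    | lim _ hC' hK hlim ih =>
      exact .lim ih (fun n μ => ((Jet.le_algebraMap a (zero_le_one.trans (hB.one_le_κ μ))).add
        (hC μ)).add (hC' n μ)) (((jetContinuous_const _).add hc).add hK)
        fun μ => (Jet.tendsto_const _).add (hlim μ)
  | lim _ hC hJ hlim ih =>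
    obtain ⟨D, hD⟩ := hK.exists_le hB.one_le_κ
    exact .lim (fun n => ih n hK) (fun n μ => (hC n μ).add (hD μ)) (hJ.add hK.continuous)
      fun μ => (hlim μ).add (Jet.tendsto_const _)

theorem Core.mul (hB : CoefBounds b σ τ κ c) (hw : ∀ x, 1 ≤ w x) (hJ : Core b σ τ κ J)
    (hK : Core b σ τ κ K) : Core b σ τ κ fun μ => J μ * K μ := by
  induction hJ generalizing K with
  | @base f J C a hf hJ hc hC =>
    induction hK with
    | @base g K D a' hg hK hc' hD =>
      have := Core.base (κ := κ) (a * a')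
        (add_mem (add_mem (SMulMemClass.smul_mem a hg) (SMulMemClass.smul_mem a' hf))
          (mul_mem hf hg))
        (((hK.smul hB hw a).add hB hw (hJ.smul hB hw a')).add hB hw (hJ.mul hB hw hK))
        (((hc'.smul a).add (hc.smul a')).add (hc.mul hc'))
        fun μ => (((hD μ).smul a).add ((hC μ).smul a')).add ((hC μ).mul (hB.one_le_κ μ) (hD μ))
      convert this using 2
      rw [map_mul, Algebra.smul_def, Algebra.smul_def]; ring
    | lim _ hC' hK hlim ih =>
      exact .lim ih (fun n μ => ((Jet.le_algebraMap a (zero_le_one.trans (hB.one_le_κ μ))).add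
        (hC μ)).mul (hB.one_le_κ μ) (hC' n μ)) (((jetContinuous_const _).add hc).mul hK)
        fun μ => (Jet.tendsto_const _).mul (hlim μ)
  | lim _ hC hJ hlim ih =>
    obtain ⟨D, hD⟩ := hK.exists_le hB.one_le_κ
    exact .lim (fun n => ih n hK) (fun n μ => (hC n μ).mul (hB.one_le_κ μ) (hD μ))
      (hJ.mul hK.continuous) fun μ => (hlim μ).mul (Jet.tendsto_const _)

theorem core_const (hw : ∀ x, 1 ≤ w x) (a : ℝ) :
    Core b σ τ κ fun _ => algebraMap ℝ (Jet d) a := by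
  have h0 : HasJet b σ τ (0 : SignedMeasure (Rd d) → ℝ) fun _ : Pw w => (0 : Jet d) := by
    have h := hasJet_const (b := b) (σ := σ) (τ := τ) hw 0
    rw [map_zero] at h
    exact h
  have := Core.base (κ := κ) (C := 0) a (zero_mem _) h0 (jetContinuous_const _)
    fun μ => by simp [Jet.Le]
  simpa using this

theorem Core.sub (hB : CoefBounds b σ τ κ c) (hw : ∀ x, 1 ≤ w x) (hJ : Core b σ τ κ J)
    (hK : Core b σ τ κ K) : Core b σ τ κ fun μ => J μ - K μ := by
  have := hJ.add hB hw ((core_const hw (-1)).mul hB hw hK)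
  convert this using 2
  rw [map_neg, map_one]; ring

theorem Core.aeval (hB : CoefBounds b σ τ κ c) (hw : ∀ x, 1 ≤ w x) (hJ : Core b σ τ κ J)
    (P : Polynomial ℝ) : Core b σ τ κ fun μ => Polynomial.aeval (J μ) P := by
  induction P using Polynomial.induction_on with
  | C a => simpa using core_const hw a
  | add P Q hP hQ => simpa using hP.add hB hw hQ
  | monomial n a ih =>
    have := ih.mul hB hw hJ
    convert this using 2
    simp [pow_succ, mul_assoc]

/-- The class is closed under composition with `C²` functions. -/
theorem Core.comp (hB : CoefBounds b σ τ κ c) (hw : ∀ x, 1 ≤ w x) (hJ : Core b σ τ κ J)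
    {G : ℝ → ℝ} (hG : ContDiff ℝ 2 G) : Core b σ τ κ fun μ => Jet.comp G (J μ) := by
  obtain ⟨A, hA⟩ := hJ.exists_le hB.one_le_κ
  obtain ⟨P, M, hP⟩ := exists_polynomial_seq hG (max A 1)
  have hmem : ∀ μ, (J μ).val ∈ Set.Icc (-max A 1) (max A 1) := fun μ =>
    abs_le.1 ((hA μ).1.trans (le_max_left _ _))
  refine .lim (J := fun n μ => Jet.comp (fun y => (P n).eval y) (J μ))
    (C := (d + 1) * (M * (max A 1) ^ 2)) (fun n => ?_) (fun n μ => ?_) (hJ.continuous.comp hG)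
    (fun μ => ?_)
  · simp only [Jet.comp_aeval]; exact hJ.aeval hB hw (P n)
  · obtain ⟨h0, h1, h2⟩ := (hP _ (hmem μ)).1 n
    exact ((hA μ).mono (zero_le_one.trans (hB.one_le_κ μ)) (le_max_left A 1)).comp
      (hB.one_le_κ μ) (le_max_right _ _) h0 h1 h2
  · obtain ⟨-, h0, h1, h2⟩ := hP _ (hmem μ)
    exact Jet.tendsto_comp_left h0 h1 h2

/-- `J` belongs to the class locally with respect to `Z`: its product with `F(Z)` does, for all
`F` vanishing near `+∞`. -/
def LocCore (b : Pw w → Rd d → Rd d) (σ τ : Pw w → Rd d → Matrix (Fin d) (Fin d) ℝ)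
    (κ : Pw w → ℝ) (Z J : Pw w → Jet d) : Prop :=
  ∀ F : ℝ → ℝ, ContDiff ℝ 2 F → (∃ R, ∀ y, R ≤ y → F y = 0) →
    Core b σ τ κ fun μ => J μ * Jet.comp F (Z μ)

variable {Z : Pw w → Jet d}

theorem LocCore.add (hB : CoefBounds b σ τ κ c) (hw : ∀ x, 1 ≤ w x) (hJ : LocCore b σ τ κ Z J)
    (hK : LocCore b σ τ κ Z K) : LocCore b σ τ κ Z fun μ => J μ + K μ := by
  intro F hF hR
  simpa only [add_mul] using (hJ F hF hR).add hB hw (hK F hF hR)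

theorem LocCore.mul (hB : CoefBounds b σ τ κ c) (hw : ∀ x, 1 ≤ w x) (hJ : LocCore b σ τ κ Z J)
    (hK : LocCore b σ τ κ Z K) : LocCore b σ τ κ Z fun μ => J μ * K μ := by
  rintro F hF ⟨R, hR⟩
  -- `F` is the product of itself with a second cutoff, one for each factor
  have h := (hJ (stepDown R) (contDiff_stepDown R) ⟨R + 1, fun y hy => stepDown_of_ge hy⟩).mul
    hB hw (hK F hF ⟨R, hR⟩)
  have e : (fun y => stepDown R y * F y) = F := by
    funext y
    rcases le_total y R with hy | hy
    · rw [stepDown_of_le hy, one_mul]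
    · rw [hR y hy, mul_zero]
  have e' : ∀ μ, Jet.comp (stepDown R) (Z μ) * Jet.comp F (Z μ) = Jet.comp F (Z μ) := fun μ => by
    rw [← Jet.comp_mul (contDiff_stepDown R) hF, e]
  convert h using 2 with μ
  rw [mul_mul_mul_comm, e']

/-- If `exp (-Z)` belongs to the class, then so does `F(Z)` for `F` vanishing near `+∞`, being a
`C²` function of `exp (-Z)`. -/
theorem core_comp_of_exp_neg (hB : CoefBounds b σ τ κ c) (hw : ∀ x, 1 ≤ w x)
    (hV : Core b σ τ κ fun μ => Jet.comp (fun y => Real.exp (-y)) (Z μ)) {F : ℝ → ℝ}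
    (hF : ContDiff ℝ 2 F) (hR : ∃ R, ∀ y, R ≤ y → F y = 0) :
    Core b σ τ κ fun μ => Jet.comp F (Z μ) := by
  obtain ⟨R, hR⟩ := hR
  obtain ⟨G, hG, h⟩ := exists_contDiff_comp_exp_neg hF hR
  have := hV.comp hB hw hG
  simp only [← Jet.comp_comp hG contDiff_exp_neg, h] at this
  exact this

theorem locCore_const (hB : CoefBounds b σ τ κ c) (hw : ∀ x, 1 ≤ w x)
    (hV : Core b σ τ κ fun μ => Jet.comp (fun y => Real.exp (-y)) (Z μ)) (a : ℝ) :
    LocCore b σ τ κ Z fun _ => algebraMap ℝ (Jet d) a := fun _ hF hR =>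
  (core_const hw a).mul hB hw (core_comp_of_exp_neg hB hw hV hF hR)

/-- Membership of `J exp (-Z)` implies local membership of `J`, as
`J F(Z) = (J exp (-Z)) (exp(Z) F(Z))`. -/
theorem locCore_of_mul_exp_neg (hB : CoefBounds b σ τ κ c) (hw : ∀ x, 1 ≤ w x)
    (hV : Core b σ τ κ fun μ => Jet.comp (fun y => Real.exp (-y)) (Z μ))
    (hJ : Core b σ τ κ fun μ => J μ * Jet.comp (fun y => Real.exp (-y)) (Z μ)) :
    LocCore b σ τ κ Z J := by
  rintro F hF ⟨R, hR⟩
  have h := hJ.mul hB hw (core_comp_of_exp_neg (F := fun y => Real.exp y * F y) hB hw hV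
    (Real.contDiff_exp.mul hF) ⟨R, fun y hy => by simp [hR y hy]⟩)
  convert h using 2 with μ
  rw [Jet.comp_mul Real.contDiff_exp hF, mul_assoc, ← mul_assoc (Jet.comp _ (Z μ)),
    Jet.comp_exp_neg_mul_comp_exp, one_mul]

theorem LocCore.aeval (hB : CoefBounds b σ τ κ c) (hw : ∀ x, 1 ≤ w x)
    (hV : Core b σ τ κ fun μ => Jet.comp (fun y => Real.exp (-y)) (Z μ))
    (hJ : LocCore b σ τ κ Z J) (P : Polynomial ℝ) :
    LocCore b σ τ κ Z fun μ => Polynomial.aeval (J μ) P := by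
  induction P using Polynomial.induction_on with
  | C a => simpa using locCore_const hB hw hV a
  | add P Q hP hQ => simpa using hP.add hB hw hQ
  | monomial n a ih =>
    have := ih.mul hB hw hJ
    convert this using 2
    simp [pow_succ, mul_assoc]

end Core

/-! ### Truncated polynomials in the linear functionals belong to the closure -/

section Truncation

variable {d : ℕ} {w : Rd d → ℝ} {b : Pw w → Rd d → Rd d}
  {σ τ : Pw w → Rd d → Matrix (Fin d) (Fin d) ℝ} {κ : Pw w → ℝ} {c : ℝ} {φ ψ : Rd d → ℝ} {C D : ℝ}

/-- The jet of `μ ↦ exp (-⟨w, μ⟩)`. -/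
def expJet (b : Pw w → Rd d → Rd d) (σ τ : Pw w → Rd d → Matrix (Fin d) (Fin d) ℝ) (μ : Pw w) :
    Jet d :=
  Jet.comp (fun y => Real.exp (-y)) (linJet b σ τ w μ)

/-- The jet of `μ ↦ ⟨ŵ, μ⟩`, where `ŵ` is the outer weight. It replaces `⟨w, μ⟩` as the quantity to
be truncated, because its drift is bounded by a multiple of `⟨w, μ⟩` without the factor `κ`. -/
def outerJet (b : Pw w → Rd d → Rd d) (σ τ : Pw w → Rd d → Matrix (Fin d) (Fin d) ℝ) (μ : Pw w) :
    Jet d :=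
  linJet b σ τ (outerWeight w) μ

/-- Polynomial growth of a jet, in terms of `⟨w, μ⟩`. -/
def PolyLe (κ : Pw w → ℝ) (n : ℕ) (C : ℝ) (J : Pw w → Jet d) : Prop :=
  0 ≤ C ∧ ∀ μ, (J μ).Le (κ μ) (C * μ.moment ^ n)

variable {J K : Pw w → Jet d} {m n : ℕ}

theorem PolyLe.mul (hB : CoefBounds b σ τ κ c) (hJ : PolyLe κ n C J) (hK : PolyLe κ m D K) :
    PolyLe κ (n + m) ((d + 2) * (C * D)) fun μ => J μ * K μ := by
  refine ⟨by have := hJ.1; have := hK.1; positivity, fun μ => ?_⟩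
  have := (hJ.2 μ).mul (hB.one_le_κ μ) (hK.2 μ)
  convert this using 1
  rw [pow_add]; ring

theorem PolyLe.add (hB : CoefBounds b σ τ κ c) (hw : ∀ x, 1 ≤ w x) (hJ : PolyLe κ n C J)
    (hK : PolyLe κ m D K) : PolyLe κ (n + m) (C + D) fun μ => J μ + K μ := by
  refine ⟨add_nonneg hJ.1 hK.1, fun μ => ?_⟩
  have h1 := μ.one_le_moment hw
  refine ((hJ.2 μ).add (hK.2 μ)).mono (zero_le_one.trans (hB.one_le_κ μ)) ?_
  rw [add_mul]
  exact add_le_add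
    (mul_le_mul_of_nonneg_left (pow_le_pow_right₀ h1 (Nat.le_add_right n m)) hJ.1)
    (mul_le_mul_of_nonneg_left (pow_le_pow_right₀ h1 (Nat.le_add_left m n)) hK.1)

theorem polyLe_const (hB : CoefBounds b σ τ κ c) (a : ℝ) :
    PolyLe κ 0 |a| fun _ => algebraMap ℝ (Jet d) a :=
  ⟨abs_nonneg a, fun μ => by
    simpa using Jet.le_algebraMap (d := d) a (zero_le_one.trans (hB.one_le_κ μ))⟩

theorem polyLe_linJet (hB : CoefBounds b σ τ κ c) (hw : ∀ x, 1 ≤ w x) (hφ : Adm w C φ) :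
    PolyLe κ 1 (jetConst d c * C) (linJet b σ τ φ) :=
  ⟨mul_nonneg (jetConst_pos hB.c_nonneg).le (hφ.nonneg hw), fun μ => by
    simpa using linJet_le hB hφ hw μ⟩

theorem PolyLe.comp (hB : CoefBounds b σ τ κ c) (hw : ∀ x, 1 ≤ w x) {F : ℝ → ℝ} {M : ℝ}
    (hM : 0 ≤ M) (hJ : PolyLe κ n C J) (h0 : ∀ μ, |F (J μ).val| ≤ M)
    (h1 : ∀ μ, |deriv F (J μ).val| ≤ M) (h2 : ∀ μ, |deriv (deriv F) (J μ).val| ≤ M) :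
    PolyLe κ (2 * n) ((d + 1) * (M * (1 + C) ^ 2)) fun μ => Jet.comp F (J μ) := by
  refine ⟨by positivity, fun μ => ?_⟩
  have hz := one_le_pow₀ (n := n) (μ.one_le_moment hw)
  have hC := hJ.1
  have hJ' := (hJ.2 μ).mono (zero_le_one.trans (hB.one_le_κ μ))
    (show C * μ.moment ^ n ≤ (1 + C) * μ.moment ^ n by nlinarith)
  have := hJ'.comp (hB.one_le_κ μ) (by nlinarith) (h0 μ) (h1 μ) (h2 μ)
  convert this using 1
  rw [pow_mul']; ring

theorem linJet_val (φ : Rd d → ℝ) (μ : Pw w) :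
    (linJet b σ τ φ μ).val = ∫ x, φ x ∂μ.meas := rfl

theorem linJet_w_val (μ : Pw w) : (linJet b σ τ w μ).val = μ.moment := rfl

theorem jetContinuous_expJet (hw : IsWeight w) (hB : CoefBounds b σ τ κ c) :
    JetContinuous (expJet b σ τ) := by
  obtain ⟨C, hC⟩ := hw.exists_adm
  exact (jetContinuous_linJet hw hB hC).comp contDiff_exp_neg

/-- A jet of polynomial growth times that of `exp (-⟨w, ·⟩)` is bounded. -/
theorem exists_mul_expJet_le (hw : IsWeight w) (hB : CoefBounds b σ τ κ c) (n : ℕ) :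
    ∃ B : ℝ, ∀ (C : ℝ) (μ : Pw w) (J : Jet d), 0 ≤ C → J.Le (κ μ) (C * μ.moment ^ n) →
      (J * expJet b σ τ μ).Le (κ μ) (B * C) := by
  obtain ⟨A, hA⟩ := hw.exists_adm
  have hL := polyLe_linJet hB hw.one_le hA
  set K := jetConst d c * A
  refine ⟨(d + 2) * ((d + 1) * (1 + K) ^ 2) * (n + 2).factorial, fun C μ J hC hJ => ?_⟩
  have hκ := zero_le_one.trans (hB.one_le_κ μ)
  have hz := μ.one_le_moment hw.one_le
  have hL' := (hL.2 μ).mono hκ (show K * μ.moment ^ 1 ≤ (1 + K) * μ.moment by nlinarith)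
  have h1 := hL.1
  have he : |Real.exp (-μ.moment)| ≤ Real.exp (-μ.moment) := by
    rw [abs_of_pos (Real.exp_pos _)]
  have hU : (expJet b σ τ μ).Le (κ μ) _ := hL'.comp (hB.one_le_κ μ) (by nlinarith)
    (m := Real.exp (-μ.moment)) (by rw [linJet_w_val]; exact he)
    (by rw [linJet_w_val, deriv_exp_neg, abs_neg]; exact he)
    (by rw [linJet_w_val, deriv_deriv_exp_neg]; exact he)
  refine (hJ.mul (hB.one_le_κ μ) hU).mono hκ ?_
  have hfac : μ.moment ^ (n + 2) * Real.exp (-μ.moment) ≤ (n + 2).factorial := by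
    have := Real.pow_div_factorial_le_exp μ.moment (by linarith) (n + 2)
    rw [div_le_iff₀ (by positivity)] at this
    rw [Real.exp_neg, ← div_eq_mul_inv, div_le_iff₀ (Real.exp_pos _)]
    linarith
  calc ((d : ℝ) + 2) * (C * μ.moment ^ n *
        ((d + 1) * (Real.exp (-μ.moment) * ((1 + K) * μ.moment) ^ 2)))
      = ((d + 2) * ((d + 1) * (1 + K) ^ 2) * C) *
          (μ.moment ^ (n + 2) * Real.exp (-μ.moment)) := by ring
    _ ≤ ((d + 2) * ((d + 1) * (1 + K) ^ 2) * C) * (n + 2).factorial :=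
        mul_le_mul_of_nonneg_left hfac (by positivity)
    _ = _ := by ring

theorem core_linJet_mul_expJet_of_testFunctions (hw : IsWeight w) (hB : CoefBounds b σ τ κ c)
    (hφ : φ ∈ testFunctions d) : Core b σ τ κ fun μ => linJet b σ τ φ μ * expJet b σ τ μ := by
  obtain ⟨C, hC⟩ := exists_adm_of_mem_testFunctions hw.one_le hφ
  obtain ⟨B, hb⟩ := exists_mul_expJet_le hw hB 1
  have hL := polyLe_linJet hB hw.one_le hC
  have := Core.base (κ := κ) 0
    (show pairing φ * expNeg w ∈ Dw w from NonUnitalAlgebra.subset_adjoin ℝ ⟨φ, hφ, rfl⟩)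
    ((hasJet_pairing hw.one_le hC).mul hB hw.one_le (hasJet_expNeg hw))
    ((jetContinuous_linJet hw hB hC).mul (jetContinuous_expJet hw hB))
    (fun μ => hb _ μ _ hL.1 (hL.2 μ))
  simp only [map_zero, zero_add] at this
  exact this

/-- Cutting off `φ` in space reduces to test functions. In particular `φ = 1` and `φ = w` are
allowed. -/
theorem core_linJet_mul_expJet (hw : IsWeight w) (hB : CoefBounds b σ τ κ c)
    (hφ : Adm w C φ) : Core b σ τ κ fun μ => linJet b σ τ φ μ * expJet b σ τ μ := by
  obtain ⟨D, hD⟩ := hφ.exists_cutoff hw.one_le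
  obtain ⟨B, hb⟩ := exists_mul_expJet_le hw hB 1
  have hL := fun n => polyLe_linJet hB hw.one_le (hD n)
  exact .lim (J := fun n μ => linJet b σ τ (cutoff d n * φ) μ * expJet b σ τ μ)
    (fun n => core_linJet_mul_expJet_of_testFunctions hw hB (cutoff_mul_mem_testFunctions hφ.1 n))
    (fun n μ => hb _ μ _ (hL n).1 ((hL n).2 μ))
    ((jetContinuous_linJet hw hB hφ).mul (jetContinuous_expJet hw hB))
    fun μ => (tendsto_linJet_cutoff hB hw.one_le hφ μ).mul (Jet.tendsto_const _)

theorem core_expJet (hw : IsWeight w) (hB : CoefBounds b σ τ κ c) :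
    Core b σ τ κ (expJet b σ τ) := by
  simpa only [linJet_one, one_mul] using core_linJet_mul_expJet hw hB (adm_one hw.one_le)

theorem locCore_linJet_w (hw : IsWeight w) (hB : CoefBounds b σ τ κ c) (hφ : Adm w C φ) :
    LocCore b σ τ κ (linJet b σ τ w) (linJet b σ τ φ) :=
  locCore_of_mul_exp_neg hB hw.one_le (core_expJet hw hB) (core_linJet_mul_expJet hw hB hφ)

theorem Jet.tendsto_of_eventually_eq {J : ℕ → Jet d} {K : Jet d} (h : ∀ᶠ n in atTop, J n = K) :
    Jet.Tendsto J atTop K :=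
  ⟨tendsto_const_nhds.congr' (h.mono fun _ h => by simp only [h]),
    fun _ => tendsto_const_nhds.congr' (h.mono fun _ h => by simp only [h]),
    tendsto_const_nhds.congr' (h.mono fun _ h => by simp only [h])⟩

/-- The factor `exp (-⟨w, ·⟩)` removes the localization. -/
theorem LocCore.mul_expJet (hw : IsWeight w) (hB : CoefBounds b σ τ κ c)
    (hJ : LocCore b σ τ κ (linJet b σ τ w) J) (hc : JetContinuous J) (hle : PolyLe κ n C J) :
    Core b σ τ κ fun μ => J μ * expJet b σ τ μ := by
  obtain ⟨A, hA⟩ := hw.exists_adm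
  obtain ⟨M, hM0, hM⟩ := exists_bound_stepDown
  have hL := polyLe_linJet hB hw.one_le hA
  obtain ⟨B, hb⟩ := exists_mul_expJet_le hw hB (n + 2 * 1)
  have hle' := fun k : ℕ => hle.mul hB (hL.comp hB hw.one_le (F := stepDown k) hM0
    (fun _ => (hM _ _).1) (fun _ => (hM _ _).2.1) (fun _ => (hM _ _).2.2))
  refine .lim (J := fun (k : ℕ) μ =>
      J μ * Jet.comp (stepDown k) (linJet b σ τ w μ) * expJet b σ τ μ)
    (fun k => (hJ _ (contDiff_stepDown k) ⟨k + 1, fun y hy => stepDown_of_ge hy⟩).mul hB hw.one_le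
      (core_expJet hw hB)) (fun k μ => hb _ μ _ (hle' k).1 ((hle' k).2 μ))
    (hc.mul (jetContinuous_expJet hw hB)) fun μ => ?_
  · have h1 : Jet.Tendsto (fun k : ℕ => Jet.comp (stepDown k) (linJet b σ τ w μ)) atTop 1 := by
      obtain ⟨k₀, hk₀⟩ := exists_nat_gt (linJet b σ τ w μ).val
      refine Jet.tendsto_of_eventually_eq ?_
      filter_upwards [eventually_ge_atTop k₀] with k hk
      rw [Jet.comp_congr (stepDown_eventuallyEq_one (hk₀.trans_le (by exact_mod_cast hk))),
        Jet.comp_const, map_one]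
    simpa using ((Jet.tendsto_const (J μ)).mul h1).mul (Jet.tendsto_const (expJet b σ τ μ))

theorem outerJet_add_innerWeight (hw : IsWeight w) (hB : CoefBounds b σ τ κ c) (μ : Pw w) :
    outerJet b σ τ μ + linJet b σ τ (innerWeight w) μ = linJet b σ τ w μ := by
  obtain ⟨C, hC⟩ := hw.exists_adm_outerWeight
  obtain ⟨D, hD⟩ := hw.exists_adm_innerWeight
  rw [outerJet, ← linJet_add hB hw.one_le hC hD]
  congr 1
  funext x
  simp [outerWeight]

/-- An upper bound of the inner weight, and of its integrals. -/
theorem IsWeight.exists_innerWeight_le (hw : IsWeight w) :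
    ∃ A, 1 ≤ A ∧ (∀ x, innerWeight w x ≤ A) ∧ ∀ μ : Pw w,
      0 ≤ ∫ x, innerWeight w x ∂μ.meas ∧ ∫ x, innerWeight w x ∂μ.meas ≤ A := by
  obtain ⟨A, hA⟩ := hw.innerWeight_mem.2.exists_bound_of_continuous hw.innerWeight_mem.1.continuous
  have hA' : ∀ x, innerWeight w x ≤ max A 1 := fun x =>
    ((le_abs_self _).trans (hA x)).trans (le_max_left _ _)
  refine ⟨max A 1, le_max_right _ _, hA',
    fun μ => ⟨integral_nonneg hw.innerWeight_nonneg, ?_⟩⟩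
  have := integral_mono_of_nonneg (μ := μ.meas) (ae_of_all _ hw.innerWeight_nonneg)
    (integrable_const (max A 1)) (ae_of_all _ hA')
  simpa using this

theorem exp_neg_outerJet (hw : IsWeight w) (hB : CoefBounds b σ τ κ c) (μ : Pw w) :
    Jet.comp (fun y => Real.exp (-y)) (outerJet b σ τ μ)
      = Jet.comp Real.exp (linJet b σ τ (innerWeight w) μ) * expJet b σ τ μ := by
  rw [expJet, Jet.comp_exp_neg, Jet.comp_exp_neg, ← Jet.comp_exp_add,
    ← outerJet_add_innerWeight hw hB]
  congr 1
  ring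

/-- The factor `exp (-⟨ŵ, ·⟩)` removes the localization as well: with `Ψ` the inner weight functional,
`exp (-⟨ŵ, ·⟩) = exp(Ψ) exp (-⟨w, ·⟩)`, and since `Ψ` is bounded, `exp` may be replaced by
polynomials. -/
theorem LocCore.mul_exp_neg_outerJet (hw : IsWeight w) (hB : CoefBounds b σ τ κ c)
    (hJ : LocCore b σ τ κ (linJet b σ τ w) J) (hc : JetContinuous J) (hle : PolyLe κ n C J) :
    Core b σ τ κ fun μ => J μ * Jet.comp (fun y => Real.exp (-y)) (outerJet b σ τ μ) := by
  obtain ⟨A, hA1, -, hA⟩ := hw.exists_innerWeight_le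
  obtain ⟨D, hD⟩ := hw.exists_adm_innerWeight
  obtain ⟨P, M, hP⟩ := exists_polynomial_seq (Real.contDiff_exp (n := 2)) A
  have hmem : ∀ μ : Pw w, (linJet b σ τ (innerWeight w) μ).val ∈ Set.Icc (-A) A := fun μ =>
    ⟨by linarith [(hA μ).1, linJet_val (b := b) (σ := σ) (τ := τ) (innerWeight w) μ],
      (hA μ).2⟩
  have hM0 : 0 ≤ M := (abs_nonneg _).trans
    ((hP 0 ⟨by linarith, by linarith⟩).1 0).1
  have hL := polyLe_linJet hB hw.one_le hD
  have hP1 : ∀ k, LocCore b σ τ κ (linJet b σ τ w) fun μ =>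
      J μ * Jet.comp (fun y => (P k).eval y) (linJet b σ τ (innerWeight w) μ) := fun k => by
    simp only [Jet.comp_aeval]
    exact hJ.mul hB hw.one_le ((locCore_linJet_w hw hB hD).aeval hB hw.one_le (core_expJet hw hB) _)
  have hP2 := fun k => hle.mul hB (hL.comp hB hw.one_le (F := fun y => (P k).eval y) hM0
    (fun μ => ((hP _ (hmem μ)).1 k).1) (fun μ => ((hP _ (hmem μ)).1 k).2.1)
    (fun μ => ((hP _ (hmem μ)).1 k).2.2))
  obtain ⟨B, hb⟩ := exists_mul_expJet_le hw hB (n + 2 * 1)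
  have hcont := jetContinuous_linJet hw hB hD
  have := Core.lim (fun k => (hP1 k).mul_expJet hw hB
      (hc.mul (hcont.comp (by simpa using (P k).contDiff_aeval (𝕜 := ℝ) 2))) (hP2 k))
    (fun k μ => hb _ μ _ (hP2 k).1 ((hP2 k).2 μ))
    ((hc.mul (hcont.comp Real.contDiff_exp)).mul (jetContinuous_expJet hw hB))
    (fun μ => by
      obtain ⟨-, h0, h1, h2⟩ := hP _ (hmem μ)
      exact ((Jet.tendsto_const _).mul (Jet.tendsto_comp_left h0 h1 h2)).mul (Jet.tendsto_const _))
  simpa only [exp_neg_outerJet hw hB, mul_assoc] using this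

theorem core_exp_neg_outerJet (hw : IsWeight w) (hB : CoefBounds b σ τ κ c) :
    Core b σ τ κ fun μ => Jet.comp (fun y => Real.exp (-y)) (outerJet b σ τ μ) := by
  have := (locCore_const hB hw.one_le (core_expJet hw hB) 1).mul_exp_neg_outerJet hw hB
    (jetContinuous_const _) (polyLe_const hB 1)
  simpa only [map_one, one_mul] using this

theorem core_comp_outerJet (hw : IsWeight w) (hB : CoefBounds b σ τ κ c) {F : ℝ → ℝ}
    (hF : ContDiff ℝ 2 F) (hR : ∃ R, ∀ y, R ≤ y → F y = 0) :
    Core b σ τ κ fun μ => Jet.comp F (outerJet b σ τ μ) :=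
  core_comp_of_exp_neg hB hw.one_le (core_exp_neg_outerJet hw hB) hF hR

theorem locCore_linJet (hw : IsWeight w) (hB : CoefBounds b σ τ κ c) (hφ : Adm w C φ) :
    LocCore b σ τ κ (outerJet b σ τ) (linJet b σ τ φ) :=
  locCore_of_mul_exp_neg hB hw.one_le (core_exp_neg_outerJet hw hB)
    ((locCore_linJet_w hw hB hφ).mul_exp_neg_outerJet hw hB (jetContinuous_linJet hw hB hφ)
      (polyLe_linJet hB hw.one_le hφ))

/-- Every `f ∈ ℰ_w` has a continuous jet of polynomial growth which belongs to the closure locally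
with respect to the outer weight. -/
theorem exists_locCore_of_mem_Ew (hw : IsWeight w) (hB : CoefBounds b σ τ κ c)
    {f : SignedMeasure (Rd d) → ℝ} (hf : f ∈ Ew w) :
    ∃ J, HasJet b σ τ f J ∧ JetContinuous J ∧ LocCore b σ τ κ (outerJet b σ τ) J ∧
      ∃ n C, PolyLe κ n C J :=
  exists_hasJet_of_mem_Ew hB hw
    (p := fun J => JetContinuous J ∧ LocCore b σ τ κ (outerJet b σ τ) J ∧ ∃ n C, PolyLe κ n C J)
    (fun _ _ hφ => ⟨jetContinuous_linJet hw hB hφ, locCore_linJet hw hB hφ, 1, _,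
      polyLe_linJet hB hw.one_le hφ⟩)
    (fun a => ⟨jetContinuous_const _, locCore_const hB hw.one_le (core_exp_neg_outerJet hw hB) a,
      0, _, polyLe_const hB a⟩)
    (fun _ _ ⟨h1, h2, _, _, h3⟩ ⟨k1, k2, _, _, k3⟩ =>
      ⟨h1.add k1, h2.add hB hw.one_le k2, _, _, h3.add hB hw.one_le k3⟩)
    (fun _ _ ⟨h1, h2, _, _, h3⟩ ⟨k1, k2, _, _, k3⟩ =>
      ⟨h1.mul k1, h2.mul hB hw.one_le k2, _, _, h3.mul hB k3⟩) hf

theorem outerJet_val (hw : IsWeight w) (hB : CoefBounds b σ τ κ c) (μ : Pw w) :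
    (outerJet b σ τ μ).val = μ.moment - ∫ x, innerWeight w x ∂μ.meas := by
  have := congrArg Jet.val (outerJet_add_innerWeight hw hB μ)
  rw [Jet.add_val, linJet_val, linJet_w_val] at this
  linarith

end Truncation

/-! ### Right-continuous paths and their primitives -/

section Paths

/-- A right-continuous, locally bounded path. -/
structure IsRegPath (y : ℝ≥0 → ℝ) : Prop where
  rc : ∀ t, ContinuousWithinAt y (Set.Ici t) t
  bdd : ∀ T, ∃ K, ∀ s ≤ T, |y s| ≤ K

/-- The primitive `t ↦ ∫₀ᵗ y_s ds`. -/
def prim (y : ℝ≥0 → ℝ) (t : ℝ≥0) : ℝ := ∫ s in (0 : ℝ)..t, y s.toNNReal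

namespace IsRegPath

variable {y u v : ℝ≥0 → ℝ}

theorem of_continuous (h : Continuous y) : IsRegPath y := by
  refine ⟨fun t => h.continuousWithinAt, fun T => ?_⟩
  obtain ⟨K, hK⟩ := (isCompact_Icc (a := (0 : ℝ≥0)) (b := T)).exists_bound_of_continuousOn
    h.continuousOn
  exact ⟨K, fun s hs => hK s ⟨zero_le, hs⟩⟩

theorem const (a : ℝ) : IsRegPath fun _ => a := of_continuous continuous_const

theorem add (hu : IsRegPath u) (hv : IsRegPath v) : IsRegPath fun t => u t + v t := by
  refine ⟨fun t => (hu.rc t).add (hv.rc t), fun T => ?_⟩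
  obtain ⟨K, hK⟩ := hu.bdd T
  obtain ⟨L, hL⟩ := hv.bdd T
  exact ⟨K + L, fun s hs => (abs_add_le _ _).trans (add_le_add (hK s hs) (hL s hs))⟩

theorem mul (hu : IsRegPath u) (hv : IsRegPath v) : IsRegPath fun t => u t * v t := by
  refine ⟨fun t => (hu.rc t).mul (hv.rc t), fun T => ?_⟩
  obtain ⟨K, hK⟩ := hu.bdd T
  obtain ⟨L, hL⟩ := hv.bdd T
  refine ⟨K * L, fun s hs => ?_⟩
  rw [abs_mul]
  exact mul_le_mul (hK s hs) (hL s hs) (abs_nonneg _) ((abs_nonneg _).trans (hK s hs))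

theorem sub (hu : IsRegPath u) (hv : IsRegPath v) : IsRegPath fun t => u t - v t := by
  simpa [sub_eq_add_neg] using hu.add ((const (-1)).mul hv)

theorem comp {F : ℝ → ℝ} (hF : Continuous F) (hu : IsRegPath u) : IsRegPath fun t => F (u t) := by
  refine ⟨fun t => hF.continuousAt.comp_continuousWithinAt (hu.rc t), fun T => ?_⟩
  obtain ⟨K, hK⟩ := hu.bdd T
  obtain ⟨L, hL⟩ := (isCompact_Icc (a := -K) (b := K)).exists_bound_of_continuousOn hF.continuousOn
  exact ⟨L, fun s hs => hL _ (abs_le.1 (hK s hs))⟩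

theorem abs (hu : IsRegPath u) : IsRegPath fun t => |u t| := hu.comp continuous_abs

end IsRegPath

/-- Joint measurability of a right-continuous process up to a fixed time. -/
theorem measurable_min_of_rightContinuous {Ω : Type*} [MeasurableSpace Ω] {Y : ℝ≥0 → Ω → ℝ}
    {T : ℝ≥0} (hm : ∀ s ≤ T, Measurable (Y s))
    (hrc : ∀ ω t, ContinuousWithinAt (fun s => Y s ω) (Set.Ici t) t) :
    Measurable fun p : ℝ≥0 × Ω => Y (min p.1 T) p.2 := by
  -- the dyadic-type approximations `(⌊n s⌋ + 1) / n` decrease to `s` from the right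
  set a : ℕ → ℕ → ℝ≥0 := fun n k => min (((k : ℝ≥0) + 1) / ((n : ℝ≥0) + 1)) T
  have hcomp : ∀ n (f : ℝ≥0 → ℕ), Measurable f →
      Measurable fun p : ℝ≥0 × Ω => Y (a n (f p.1)) p.2 := by
    intro n f hf
    have h1 : Measurable fun q : ℕ × Ω => Y (a n q.1) q.2 :=
      measurable_from_prod_countable_right fun k => hm (a n k) (min_le_right _ _)
    have h2 : Measurable fun p : ℝ≥0 × Ω => (f p.1, p.2) := by fun_prop
    simpa only [Function.comp_def] using h1.comp h2
  have ha : ∀ n, Measurable fun p : ℝ≥0 × Ω => Y (a n ⌊((n : ℝ≥0) + 1) * p.1⌋₊) p.2 := fun n =>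
    hcomp n (fun s => ⌊((n : ℝ≥0) + 1) * s⌋₊) (measurable_id.const_mul _).nat_floor
  refine measurable_of_tendsto_metrizable ha (tendsto_pi_nhds.2 fun p => ?_)
  have h2 : Tendsto (fun n => a n ⌊((n : ℝ≥0) + 1) * p.1⌋₊) atTop (𝓝 (min p.1 T)) := by
    refine Tendsto.min ?_ tendsto_const_nhds
    rw [← NNReal.tendsto_coe]
    have h3 : Tendsto (fun n : ℕ => (p.1 : ℝ) + 1 / ((n : ℝ) + 1)) atTop (𝓝 (p.1 + 0)) :=
      tendsto_const_nhds.add tendsto_one_div_add_atTop_nhds_zero_nat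
    rw [add_zero] at h3
    refine tendsto_of_tendsto_of_tendsto_of_le_of_le tendsto_const_nhds h3 (fun n => ?_)
      fun n => ?_
    · have := (Nat.lt_floor_add_one (((n : ℝ≥0) + 1) * p.1)).le
      have h4 : p.1 ≤ ((⌊((n : ℝ≥0) + 1) * p.1⌋₊ : ℝ≥0) + 1) / ((n : ℝ≥0) + 1) := by
        rw [le_div_iff₀ (by positivity), mul_comm]; exact this
      exact_mod_cast h4
    · have := Nat.floor_le (zero_le (a := ((n : ℝ≥0) + 1) * p.1))
      have h4 : ((⌊((n : ℝ≥0) + 1) * p.1⌋₊ : ℝ≥0) + 1) / ((n : ℝ≥0) + 1)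
          ≤ p.1 + 1 / ((n : ℝ≥0) + 1) := by
        rw [add_div]
        gcongr
        rw [div_le_iff₀ (by positivity), mul_comm p.1]; exact this
      exact_mod_cast h4
  refine ((hrc p.2 (min p.1 T)).tendsto).comp (tendsto_nhdsWithin_iff.2 ⟨h2, ?_⟩)
  filter_upwards with n
  refine Set.mem_Ici.2 (min_le_min ?_ le_rfl)
  have := (Nat.lt_floor_add_one (((n : ℝ≥0) + 1) * p.1)).le
  rw [le_div_iff₀ (by positivity), mul_comm]; exact this

namespace IsRegPath

variable {y u v : ℝ≥0 → ℝ}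

theorem measurable (hy : IsRegPath y) : Measurable y := by
  have h : ∀ n : ℕ, Measurable fun s : ℝ≥0 => y (min s n) := fun n =>
    (measurable_min_of_rightContinuous (Ω := Unit) (Y := fun s _ => y s) (T := n)
      (fun _ _ => measurable_const) (fun _ => hy.rc)).comp
      (measurable_id.prodMk (measurable_const (a := ())))
  refine measurable_of_tendsto_metrizable h (tendsto_pi_nhds.2 fun s => ?_)
  obtain ⟨n, hn⟩ := exists_nat_ge s
  refine tendsto_const_nhds.congr' ?_
  filter_upwards [eventually_ge_atTop n] with m hm
  rw [min_eq_left (hn.trans (by exact_mod_cast hm))]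

theorem measurable_real (hy : IsRegPath y) : Measurable fun s : ℝ => y s.toNNReal :=
  hy.measurable.comp measurable_real_toNNReal

theorem rc_real (hy : IsRegPath y) (s : ℝ) :
    ContinuousWithinAt (fun s : ℝ => y s.toNNReal) (Set.Ioi s) s :=
  (hy.rc s.toNNReal).comp continuous_real_toNNReal.continuousWithinAt
    fun _ hx => Real.toNNReal_mono (le_of_lt hx)

theorem intervalIntegrable (hy : IsRegPath y) (a b : ℝ) :
    IntervalIntegrable (fun s : ℝ => y s.toNNReal) volume a b := by
  obtain ⟨K, hK⟩ := hy.bdd (max a b).toNNReal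
  refine (intervalIntegrable_const (c := K)).mono_fun' hy.measurable_real.aestronglyMeasurable ?_
  refine (ae_restrict_iff' measurableSet_uIoc).2 (ae_of_all _ fun s hs => ?_)
  exact hK _ (Real.toNNReal_mono hs.2)

theorem hasDerivWithinAt_integral (hy : IsRegPath y) (s : ℝ) :
    HasDerivWithinAt (fun x => ∫ r in (0 : ℝ)..x, y r.toNNReal) (y s.toNNReal) (Set.Ioi s) s :=
  (intervalIntegral.integral_hasDerivWithinAt_right (s := Set.Ici s) (t := Set.Ioi s)
    (hy.intervalIntegrable 0 s) (hy.measurable_real.stronglyMeasurable.stronglyMeasurableAtFilter)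
    (hy.rc_real s)).mono Set.Ioi_subset_Ici_self

theorem continuous_integral (hy : IsRegPath y) :
    Continuous fun x => ∫ r in (0 : ℝ)..x, y r.toNNReal :=
  intervalIntegral.continuous_primitive hy.intervalIntegrable 0

theorem continuous_prim (hy : IsRegPath y) : Continuous (prim y) :=
  hy.continuous_integral.comp NNReal.continuous_coe

theorem prim (hy : IsRegPath y) : IsRegPath (prim y) := of_continuous hy.continuous_prim

end IsRegPath

variable {y u v : ℝ≥0 → ℝ}

theorem prim_add (hu : IsRegPath u) (hv : IsRegPath v) (t : ℝ≥0) :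
    prim (fun s => u s + v s) t = prim u t + prim v t :=
  intervalIntegral.integral_add (hu.intervalIntegrable 0 t) (hv.intervalIntegrable 0 t)

theorem prim_sub (hu : IsRegPath u) (hv : IsRegPath v) (t : ℝ≥0) :
    prim (fun s => u s - v s) t = prim u t - prim v t :=
  intervalIntegral.integral_sub (hu.intervalIntegrable 0 t) (hv.intervalIntegrable 0 t)

theorem prim_const_mul (a : ℝ) (u : ℝ≥0 → ℝ) (t : ℝ≥0) :
    prim (fun s => a * u s) t = a * prim u t :=
  intervalIntegral.integral_const_mul _ _

@[simp] theorem prim_zero_time (u : ℝ≥0 → ℝ) : prim u 0 = 0 := by simp [prim]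

theorem prim_const (a : ℝ) (t : ℝ≥0) : prim (fun _ => a) t = a * t := by
  simp [prim, mul_comm]

theorem prim_mono (hu : IsRegPath u) (hv : IsRegPath v) {t : ℝ≥0} (h : ∀ s ≤ t, u s ≤ v s) :
    prim u t ≤ prim v t :=
  intervalIntegral.integral_mono_on t.2 (hu.intervalIntegrable 0 t) (hv.intervalIntegrable 0 t)
    fun s hs => h _ (by rw [Real.toNNReal_le_iff_le_coe]; exact hs.2)

theorem abs_prim_le (hu : IsRegPath u) (hv : IsRegPath v) {t : ℝ≥0} (h : ∀ s ≤ t, |u s| ≤ v s) :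
    |prim u t| ≤ prim v t :=
  (intervalIntegral.abs_integral_le_integral_abs t.2).trans (prim_mono hu.abs hv h)

theorem prim_nonneg {t : ℝ≥0} (h : ∀ s, 0 ≤ u s) : 0 ≤ prim u t :=
  intervalIntegral.integral_nonneg t.2 fun _ _ => h _

theorem prim_le_prim_of_le (hu : IsRegPath u) (h : ∀ s, 0 ≤ u s) {s t : ℝ≥0} (hst : s ≤ t) :
    prim u s ≤ prim u t := by
  have := intervalIntegral.integral_add_adjacent_intervals (hu.intervalIntegrable 0 s)
    (hu.intervalIntegrable s t)
  have h2 : 0 ≤ ∫ r in (s : ℝ)..t, u r.toNNReal :=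
    intervalIntegral.integral_nonneg (by exact_mod_cast hst) fun r _ => h _
  simp only [prim]
  linarith

/-- The product rule for two primitives. -/
theorem prim_mul {g : ℝ≥0 → ℝ} (hv : IsRegPath v) (hg : IsRegPath g) (V₀ G₀ : ℝ) (t : ℝ≥0) :
    (V₀ + prim v t) * (G₀ + prim g t)
      = V₀ * G₀ + prim (fun s => (V₀ + prim v s) * g s + v s * (G₀ + prim g s)) t := by
  have h := intervalIntegral.integral_deriv_mul_eq_sub_of_hasDeriv_right (a := 0) (b := t)
    (u := fun x => V₀ + ∫ r in (0 : ℝ)..x, v r.toNNReal)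
    (v := fun x => G₀ + ∫ r in (0 : ℝ)..x, g r.toNNReal)
    (continuous_const.add hv.continuous_integral).continuousOn
    (continuous_const.add hg.continuous_integral).continuousOn
    (fun x _ => (hv.hasDerivWithinAt_integral x).const_add V₀)
    (fun x _ => (hg.hasDerivWithinAt_integral x).const_add G₀)
    (hv.intervalIntegrable 0 t) (hg.intervalIntegrable 0 t)
  simp only [intervalIntegral.integral_same, add_zero] at h
  rw [eq_comm, ← eq_sub_iff_add_eq', prim, prim, prim, ← h]
  refine intervalIntegral.integral_congr fun s hs => ?_
  rw [Set.uIcc_of_le t.coe_nonneg] at hs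
  simp only [prim, Real.coe_toNNReal s hs.1]
  ring

/-- The chain rule for a primitive. -/
theorem comp_prim {a : ℝ≥0 → ℝ} (ha : IsRegPath a) {F F' : ℝ → ℝ} (hF : ∀ x, HasDerivAt F (F' x) x)
    (hF' : Continuous F') (t : ℝ≥0) :
    F (prim a t) = F 0 + prim (fun s => F' (prim a s) * a s) t := by
  have hreg : IsRegPath fun s => F' (MVJD.prim a s) * a s := (ha.prim.comp hF').mul ha
  have hFc : Continuous F := continuous_iff_continuousAt.2 fun x => (hF x).continuousAt
  have h := intervalIntegral.integral_eq_sub_of_hasDeriv_right (a := 0) (b := t)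
    (f := fun x => F (∫ r in (0 : ℝ)..x, a r.toNNReal))
    (f' := fun x => F' (prim a x.toNNReal) * a x.toNNReal)
    (hFc.comp ha.continuous_integral).continuousOn
    (fun x hx => by
      rw [min_eq_left t.coe_nonneg] at hx
      have := (hF (∫ r in (0 : ℝ)..x, a r.toNNReal)).comp_hasDerivWithinAt x
        (ha.hasDerivWithinAt_integral x)
      simpa only [prim, Real.coe_toNNReal x hx.1.le, Function.comp_def] using this) (hreg.intervalIntegrable 0 t)
  simp only [intervalIntegral.integral_same] at h
  rw [eq_comm, ← eq_sub_iff_add_eq', prim, prim]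
  exact h

/-- Bounded-on-compacts pointwise convergence of paths implies convergence of the primitives. -/
theorem tendsto_prim {f : ℕ → ℝ≥0 → ℝ} (hf : ∀ n, IsRegPath (f n)) (hv : IsRegPath v)
    (hle : ∀ n s, |f n s| ≤ v s) (hlim : ∀ s, Tendsto (fun n => f n s) atTop (𝓝 (u s)))
    (t : ℝ≥0) : Tendsto (fun n => prim (f n) t) atTop (𝓝 (prim u t)) :=
  intervalIntegral.tendsto_integral_filter_of_dominated_convergence (fun s => v s.toNNReal)
    (Eventually.of_forall fun n => (hf n).measurable_real.aestronglyMeasurable)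
    (Eventually.of_forall fun n => ae_of_all _ fun _ _ => hle n _) (hv.intervalIntegrable 0 t)
    (ae_of_all _ fun _ _ => hlim _)

end Paths

/-! ### Right-continuous martingales and integration by parts -/

section Processes

variable {Ω : Type*} [m : MeasurableSpace Ω] {P : Measure Ω} {ℱ : Filtration ℝ≥0 m}

/-- An adapted real process with right-continuous locally bounded paths. -/
structure IsRegProcess (ℱ : Filtration ℝ≥0 m) (Y : ℝ≥0 → Ω → ℝ) : Prop where
  adapted : StronglyAdapted ℱ Y
  path : ∀ ω, IsRegPath fun t => Y t ω

/-- The time integral of a process. -/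
def primProc (Y : ℝ≥0 → Ω → ℝ) (t : ℝ≥0) (ω : Ω) : ℝ := prim (fun s => Y s ω) t

theorem stronglyMeasurable_primProc {Ω : Type*} [MeasurableSpace Ω] {Y : ℝ≥0 → Ω → ℝ} {t : ℝ≥0}
    (hm : ∀ s ≤ t, Measurable (Y s))
    (hrc : ∀ ω t, ContinuousWithinAt (fun s => Y s ω) (Set.Ici t) t) :
    StronglyMeasurable (primProc Y t) := by
  have h1 : Measurable fun p : ℝ × Ω => Y (min p.1.toNNReal t) p.2 :=
    (measurable_min_of_rightContinuous hm hrc).comp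
      ((measurable_real_toNNReal.comp measurable_fst).prodMk measurable_snd)
  have h2 := h1.stronglyMeasurable.integral_prod_left' (μ := volume.restrict (Set.Ioc (0 : ℝ) t))
  convert h2 using 1
  funext ω
  rw [primProc, prim, intervalIntegral.integral_of_le t.coe_nonneg]
  refine setIntegral_congr_fun measurableSet_Ioc fun s hs => ?_
  dsimp only
  rw [min_eq_left]
  rw [Real.toNNReal_le_iff_le_coe]; exact hs.2

namespace IsRegProcess

variable {Y Z : ℝ≥0 → Ω → ℝ}

theorem const (a : ℝ) : IsRegProcess ℱ fun _ _ => a :=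
  ⟨fun _ => stronglyMeasurable_const, fun _ => .const a⟩

theorem add (hY : IsRegProcess ℱ Y) (hZ : IsRegProcess ℱ Z) :
    IsRegProcess ℱ fun t ω => Y t ω + Z t ω :=
  ⟨fun t => (hY.adapted t).add (hZ.adapted t), fun ω => (hY.path ω).add (hZ.path ω)⟩

theorem sub (hY : IsRegProcess ℱ Y) (hZ : IsRegProcess ℱ Z) :
    IsRegProcess ℱ fun t ω => Y t ω - Z t ω :=
  ⟨fun t => (hY.adapted t).sub (hZ.adapted t), fun ω => (hY.path ω).sub (hZ.path ω)⟩

theorem mul (hY : IsRegProcess ℱ Y) (hZ : IsRegProcess ℱ Z) :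
    IsRegProcess ℱ fun t ω => Y t ω * Z t ω :=
  ⟨fun t => (hY.adapted t).mul (hZ.adapted t), fun ω => (hY.path ω).mul (hZ.path ω)⟩

theorem comp {F : ℝ → ℝ} (hF : Continuous F) (hY : IsRegProcess ℱ Y) :
    IsRegProcess ℱ fun t ω => F (Y t ω) :=
  ⟨fun t => hF.comp_stronglyMeasurable (hY.adapted t), fun ω => (hY.path ω).comp hF⟩

theorem primProc (hY : IsRegProcess ℱ Y) : IsRegProcess ℱ (primProc Y) :=
  ⟨fun t => @stronglyMeasurable_primProc _ (ℱ t) _ _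
      (fun _ hs => ((hY.adapted _).mono (ℱ.mono hs)).measurable) fun ω => (hY.path ω).rc,
    fun ω => (hY.path ω).prim⟩

theorem stronglyMeasurable (hY : IsRegProcess ℱ Y) (t : ℝ≥0) : StronglyMeasurable (Y t) :=
  (hY.adapted t).mono (ℱ.le t)

theorem measurable_uncurry (hY : IsRegProcess ℱ Y) :
    Measurable fun p : ℝ≥0 × Ω => Y p.1 p.2 := by
  have h : ∀ n : ℕ, Measurable fun p : ℝ≥0 × Ω => Y (min p.1 n) p.2 := fun n =>
    measurable_min_of_rightContinuous (fun s _ => (hY.stronglyMeasurable s).measurable)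
      fun ω => (hY.path ω).rc
  refine measurable_of_tendsto_metrizable h (tendsto_pi_nhds.2 fun p => ?_)
  obtain ⟨n, hn⟩ := exists_nat_ge p.1
  refine tendsto_const_nhds.congr' ?_
  filter_upwards [eventually_ge_atTop n] with k hk
  rw [min_eq_left (hn.trans (by exact_mod_cast hk))]

theorem measurable_swap_real (hY : IsRegProcess ℱ Y) :
    Measurable fun p : Ω × ℝ => Y p.2.toNNReal p.1 :=
  hY.measurable_uncurry.comp ((measurable_real_toNNReal.comp measurable_snd).prodMk measurable_fst)

end IsRegProcess

theorem martingale_of_setIntegral_eq [IsFiniteMeasure P] {M : ℝ≥0 → Ω → ℝ}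
    (hadp : StronglyAdapted ℱ M) (hint : ∀ t, Integrable (M t) P)
    (h : ∀ s t, s ≤ t → ∀ F, MeasurableSet[ℱ s] F →
      ∫ ω in F, M s ω ∂P = ∫ ω in F, M t ω ∂P) : Martingale M ℱ P :=
  ⟨hadp, fun s t hst => (ae_eq_condExp_of_forall_setIntegral_eq (ℱ.le s) (hint t)
    (fun _ _ _ => (hint s).integrableOn) (fun F hF _ => h s t hst F hF)
    (hadp s).aestronglyMeasurable).symm⟩

/-- A bounded pointwise limit of martingales is a martingale. -/
theorem martingale_of_tendsto_of_bounded [IsFiniteMeasure P] {M : ℕ → ℝ≥0 → Ω → ℝ}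
    {N : ℝ≥0 → Ω → ℝ} (hM : ∀ n, Martingale (M n) ℱ P) (hadp : StronglyAdapted ℱ N)
    {C : ℝ≥0 → ℝ} (hC : ∀ n t ω, |M n t ω| ≤ C t)
    (hlim : ∀ t, ∀ᵐ ω ∂P, Tendsto (fun n => M n t ω) atTop (𝓝 (N t ω))) : Martingale N ℱ P := by
  have hlim' : ∀ t (F : Set Ω), Tendsto (fun n => ∫ ω in F, M n t ω ∂P) atTop
      (𝓝 (∫ ω in F, N t ω ∂P)) := fun t F =>
    tendsto_integral_of_dominated_convergence (fun _ => C t)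
      (fun n => ((hM n).integrable t).aestronglyMeasurable.restrict) (integrable_const _)
      (fun n => ae_of_all _ fun ω => hC n t ω) (ae_restrict_of_ae (hlim t))
  refine martingale_of_setIntegral_eq hadp (fun t => ?_) fun s t hst F hF => ?_
  · refine (integrable_const (C t)).mono' ((hadp t).mono (ℱ.le t)).aestronglyMeasurable ?_
    filter_upwards [hlim t] with ω hω
    exact le_of_tendsto' hω.abs fun n => hC n t ω
  · refine tendsto_nhds_unique (hlim' s F) ((hlim' t F).congr fun n => ?_)
    exact ((hM n).setIntegral_eq hst hF).symm

/-- The martingale property integrated against a random variable known at time `s`. -/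
theorem setIntegral_mul_martingale [IsFiniteMeasure P] {N : ℝ≥0 → Ω → ℝ}
    (hN : Martingale N ℱ P) {s t : ℝ≥0} (hst : s ≤ t) {Z : Ω → ℝ} (hZ : StronglyMeasurable[ℱ s] Z)
    (hint : Integrable (fun ω => Z ω * N t ω) P) {F : Set Ω} (hF : MeasurableSet[ℱ s] F) :
    ∫ ω in F, Z ω * N t ω ∂P = ∫ ω in F, Z ω * N s ω ∂P := by
  rw [← setIntegral_condExp (ℱ.le s) hint hF]
  refine setIntegral_congr_ae (ℱ.le s F hF) ?_
  filter_upwards [condExp_mul_of_stronglyMeasurable_left hZ hint (hN.integrable t), hN.2 s t hst]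
    with ω h1 h2 _
  rw [show (fun ω => Z ω * N t ω) = Z * N t from rfl, h1, Pi.mul_apply, h2]

/-- Integrability on the product of `Ω` and a time interval. -/
theorem integrable_prod_of_prim_le [IsFiniteMeasure P] {H : ℝ≥0 → Ω → ℝ} {t : ℝ≥0} {s : ℝ≥0}
    (hH : Measurable fun p : Ω × ℝ => H p.2.toNNReal p.1) (hr : ∀ ω, IsRegPath fun s => H s ω)
    {g : Ω → ℝ} (hg : Integrable g P) (hle : ∀ ω, prim (fun s => |H s ω|) t ≤ g ω) :
    Integrable (fun p : Ω × ℝ => H p.2.toNNReal p.1)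
      (P.prod (volume.restrict (Set.Ioc (s : ℝ) t))) := by
  rw [integrable_prod_iff hH.aestronglyMeasurable]
  have h1 : ∀ ω, IntegrableOn (fun r : ℝ => H r.toNNReal ω) (Set.Ioc (0 : ℝ) t) := fun ω =>
    (intervalIntegrable_iff_integrableOn_Ioc_of_le t.2).1 ((hr ω).intervalIntegrable 0 t)
  have hsub : Set.Ioc (s : ℝ) t ⊆ Set.Ioc (0 : ℝ) t := Set.Ioc_subset_Ioc_left s.2
  refine ⟨ae_of_all _ fun ω => (h1 ω).mono_set hsub, ?_⟩
  refine hg.mono' hH.norm.aestronglyMeasurable.integral_prod_right' (ae_of_all _ fun ω => ?_)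
  rw [Real.norm_of_nonneg (integral_nonneg fun _ => norm_nonneg _)]
  refine le_trans ?_ (hle ω)
  rw [prim, intervalIntegral.integral_of_le t.coe_nonneg]
  exact setIntegral_mono_set (h1 ω).norm (ae_of_all _ fun _ => norm_nonneg _)
    hsub.eventuallyLE

/-- Integration by parts: the product of a martingale `N` with an absolutely continuous process
`V = V₀ + ∫ v`, compensated by `∫ N v`, is a martingale. -/
theorem Martingale.mul_absolutelyContinuous [IsFiniteMeasure P] {N v : ℝ≥0 → Ω → ℝ}
    (hN : Martingale N ℱ P) (hNr : IsRegProcess ℱ N) (hv : IsRegProcess ℱ v) (V₀ : ℝ)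
    {C : ℝ≥0 → ℝ} (hvC : ∀ t ω, prim (fun s => |v s ω|) t ≤ C t)
    (hNv : ∀ t ω, prim (fun s => |v s ω * N s ω|) t ≤ C t) :
    Martingale (fun t ω => (V₀ + primProc v t ω) * N t ω
      - primProc (fun s ω => v s ω * N s ω) t ω) ℱ P := by
  have hvN := hv.mul hNr
  have hV : ∀ t ω, |V₀ + primProc v t ω| ≤ |V₀| + C t := fun t ω =>
    (abs_add_le _ _).trans (add_le_add le_rfl
      ((abs_prim_le (hv.path ω) (hv.path ω).abs fun _ _ => le_rfl).trans (hvC t ω)))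
  have hVr : IsRegProcess ℱ fun t ω => V₀ + primProc v t ω := (IsRegProcess.const V₀).add hv.primProc
  have hVN : ∀ s t, Integrable (fun ω => (V₀ + primProc v s ω) * N t ω) P := fun s t =>
    (hN.integrable t).bdd_mul (hVr.stronglyMeasurable s).aestronglyMeasurable
      (ae_of_all _ fun ω => hV s ω)
  have hI : ∀ t, Integrable (primProc (fun s ω => v s ω * N s ω) t) P := fun t =>
    (integrable_const (C t)).mono' (hvN.primProc.stronglyMeasurable t).aestronglyMeasurable
      (ae_of_all _ fun ω =>
        (abs_prim_le (hvN.path ω) (hvN.path ω).abs fun _ _ => le_rfl).trans (hNv t ω))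
  refine martingale_of_setIntegral_eq ((hVr.mul hNr).sub hvN.primProc).adapted
    (fun t => (hVN t t).sub (hI t)) fun s t hst F hF => ?_
  have hFm := ℱ.le s F hF
  -- both parts of `∫ v_r (N_t - N_r) dr` are integrable on `F × (s, t]`
  have i1 : ∀ F : Set Ω, Integrable (fun p : Ω × ℝ => v p.2.toNNReal p.1 * N t p.1)
      ((P.restrict F).prod (volume.restrict (Set.Ioc (s : ℝ) t))) := fun F =>
    integrable_prod_of_prim_le (H := fun r ω => v r ω * N t ω)
      (hv.measurable_swap_real.mul ((hNr.stronglyMeasurable t).measurable.comp measurable_fst))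
      (fun ω => (hv.path ω).mul (.const _)) ((hN.integrable t).norm.mul_const (C t)).restrict
      fun ω => by
        simp only [abs_mul, mul_comm _ |N t ω|, prim_const_mul, Real.norm_eq_abs]
        exact mul_le_mul_of_nonneg_left (hvC t ω) (abs_nonneg _)
  have i2 : Integrable (fun p : Ω × ℝ => v p.2.toNNReal p.1 * N p.2.toNNReal p.1)
      ((P.restrict F).prod (volume.restrict (Set.Ioc (s : ℝ) t))) :=
    integrable_prod_of_prim_le (H := fun r ω => v r ω * N r ω) hvN.measurable_swap_real hvN.path
      (integrable_const (C t)) (hNv t)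
  -- `v_r` is known at time `r ≤ t`, so that `N t` may be replaced by `N r`
  have hswap : ∫ ω in F, (∫ r in Set.Ioc (s : ℝ) t, v r.toNNReal ω * N t ω) ∂P
      = ∫ ω in F, (∫ r in Set.Ioc (s : ℝ) t, v r.toNNReal ω * N r.toNNReal ω) ∂P := by
    refine (integral_integral_swap (f := fun ω (r : ℝ) => v r.toNNReal ω * N t ω) (i1 F)).trans
      (Eq.trans ?_ (integral_integral_swap
        (f := fun ω (r : ℝ) => v r.toNNReal ω * N r.toNNReal ω) i2).symm)
    refine setIntegral_congr_ae measurableSet_Ioc ?_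
    have h3 := (integrable_prod_iff' (i1 Set.univ).aestronglyMeasurable).1 (i1 Set.univ)
    rw [Measure.restrict_univ] at h3
    filter_upwards [(ae_restrict_iff' measurableSet_Ioc).1 h3.1] with r hr hrm
    have hsr : s ≤ r.toNNReal := NNReal.le_toNNReal_of_coe_le hrm.1.le
    have hrt : r.toNNReal ≤ t := Real.toNNReal_le_iff_le_coe.2 hrm.2
    exact setIntegral_mul_martingale hN hrt (hv.adapted _) (hr hrm) (ℱ.mono hsr F hF)
  have hinc : ∀ (y : ℝ≥0 → ℝ), IsRegPath y →
      prim y t = prim y s + ∫ r in Set.Ioc (s : ℝ) t, y r.toNNReal := fun y hy => by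
    rw [← intervalIntegral.integral_of_le (by exact_mod_cast hst : (s : ℝ) ≤ t), prim, prim,
      intervalIntegral.integral_add_adjacent_intervals] <;> exact hy.intervalIntegrable _ _
  have e : ∀ ω, (V₀ + primProc v t ω) * N t ω - primProc (fun s ω => v s ω * N s ω) t ω
      = ((V₀ + primProc v s ω) * N t ω - primProc (fun s ω => v s ω * N s ω) s ω)
        + ((∫ r in Set.Ioc (s : ℝ) t, v r.toNNReal ω * N t ω)
          - ∫ r in Set.Ioc (s : ℝ) t, v r.toNNReal ω * N r.toNNReal ω) := fun ω => by
    have h1 := hinc _ (hv.path ω)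
    have h2 := hinc _ (hvN.path ω)
    simp only [primProc, integral_mul_const]
    rw [h1, h2]
    ring
  simp only [e]
  rw [integral_add, integral_sub, integral_sub, integral_sub, hswap, sub_self, add_zero,
    setIntegral_mul_martingale hN hst (hVr.adapted s) (hVN s t) hF]
  · exact (i1 F).integral_prod_left
  · exact i2.integral_prod_left
  · exact (hVN s t).restrict
  · exact (hI s).restrict
  · exact (hVN s s).restrict
  · exact (hI s).restrict
  · exact ((hVN s t).sub (hI s)).restrict
  · exact ((i1 F).integral_prod_left).sub i2.integral_prod_left

end Processes

/-! ### Discounting removes the unboundedness of the drift -/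

section Discount

/-- The discount factor `exp (-l ∫₀ᵗ a_s ds)`. -/
def discount (l : ℝ) (a : ℝ≥0 → ℝ) (t : ℝ≥0) : ℝ := Real.exp (-(l * prim a t))

/-- The compensated discounted path of `y` with drift `g`. -/
def discounted (l : ℝ) (a y g : ℝ≥0 → ℝ) (t : ℝ≥0) : ℝ :=
  discount l a t * y t - prim (fun s => discount l a s * (g s - l * a s * y s)) t

variable {l : ℝ} {a y g u : ℝ≥0 → ℝ}

theorem IsRegPath.discount (ha : IsRegPath a) (l : ℝ) : IsRegPath (discount l a) :=
  ha.prim.comp (F := fun x => Real.exp (-(l * x))) (by fun_prop)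

theorem discount_pos (l : ℝ) (a : ℝ≥0 → ℝ) (t : ℝ≥0) : 0 < discount l a t := Real.exp_pos _

theorem discount_le_one (hl : 0 ≤ l) (ha : ∀ s, 0 ≤ a s) (t : ℝ≥0) : discount l a t ≤ 1 :=
  Real.exp_le_one_iff.2 (neg_nonpos.2 (mul_nonneg hl (prim_nonneg ha)))

theorem discount_eq (ha : IsRegPath a) (l : ℝ) (t : ℝ≥0) :
    discount l a t = 1 + prim (fun s => -(l * a s) * discount l a s) t := by
  have h := comp_prim ha (F := fun x => Real.exp (-(l * x)))
    (F' := fun x => Real.exp (-(l * x)) * -(l * 1))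
    (fun x => (((hasDerivAt_id x).const_mul l).neg).exp) (by fun_prop) t
  simp only [mul_zero, neg_zero, Real.exp_zero] at h
  rw [discount, h]
  congr 2
  funext s
  rw [discount]
  ring

theorem prim_mul_discount_le (ha : IsRegPath a) (l : ℝ) (t : ℝ≥0) :
    prim (fun s => l * a s * discount l a s) t ≤ 1 := by
  have h := discount_eq ha l t
  have e : (fun s => -(l * a s) * discount l a s)
      = fun s => (-1) * (l * a s * discount l a s) := by funext s; ring
  rw [e, prim_const_mul] at h
  have := discount_pos l a t
  linarith

theorem discount_mul_le (hl : 0 < l) (a : ℝ≥0 → ℝ) {k : ℝ} (hk : 0 ≤ k) (ha : ∀ s, 0 ≤ a s)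
    (t : ℝ≥0) : discount l a t * (2 * k + k * prim a t) ≤ 2 * k + k / l := by
  have h1 := discount_le_one hl.le ha t
  have h2 : discount l a t * (l * prim a t) ≤ 1 := by
    rw [discount, Real.exp_neg, inv_mul_le_iff₀ (Real.exp_pos _), mul_one]
    linarith [Real.add_one_le_exp (l * prim a t)]
  have h3 : discount l a t * prim a t ≤ 1 / l := by
    rw [le_div_iff₀ hl]; linarith
  have h4 : k * (discount l a t * prim a t) ≤ k * (1 / l) := mul_le_mul_of_nonneg_left h3 hk
  have h5 : discount l a t * (2 * k) ≤ 1 * (2 * k) := by gcongr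
  rw [mul_add]
  calc _ ≤ 1 * (2 * k) + k * (1 / l) := add_le_add h5 (by linarith)
    _ = _ := by ring

/-- If `|u| ≤ 2 k + k ∫ a`, the integral of `u` against the derivative of the discount factor is
bounded: half of the discount absorbs the growth of `u`, the other half makes the integral
converge. -/
theorem prim_abs_discount_mul_le (hl : 0 < l) (har : IsRegPath a) (ha : ∀ s, 0 ≤ a s)
    (hu : IsRegPath u) {k : ℝ} (hk : 0 ≤ k) (hle : ∀ s, |u s| ≤ 2 * k + k * prim a s) (t : ℝ≥0) :
    prim (fun s => |-(l * a s) * discount l a s * u s|) t ≤ 2 * (2 * k + k / (l / 2)) := by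
  have hl2 : 0 < l / 2 := half_pos hl
  have hsq : ∀ s, discount l a s = discount (l / 2) a s * discount (l / 2) a s := fun s => by
    rw [discount, discount, ← Real.exp_add]; congr 1; ring
  have h1 : ∀ s, |-(l * a s) * discount l a s * u s|
      ≤ (2 * (2 * k + k / (l / 2))) * (l / 2 * a s * discount (l / 2) a s) := fun s => by
    have h2 := discount_mul_le hl2 a hk ha s
    have h3 := (mul_le_mul_of_nonneg_left (hle s) (discount_pos (l / 2) a s).le).trans h2
    have h4 := mul_le_mul_of_nonneg_left h3
      (mul_nonneg (mul_nonneg hl.le (ha s)) (discount_pos (l / 2) a s).le)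
    rw [abs_mul, abs_mul, abs_neg, abs_of_nonneg (mul_nonneg hl.le (ha s)),
      abs_of_pos (discount_pos _ _ _), hsq s]
    calc _ = l * a s * discount (l / 2) a s * (discount (l / 2) a s * |u s|) := by ring
      _ ≤ _ := h4
      _ = _ := by ring
  have hreg := ((IsRegPath.const (l / 2)).mul har).mul (har.discount (l / 2))
  have hreg' : IsRegPath fun s => -(l * a s) * discount l a s * u s := by
    simpa only [neg_mul, mul_assoc] using
      (((IsRegPath.const (-l)).mul har).mul ((har.discount l).mul hu))
  refine (prim_mono hreg'.abs ((IsRegPath.const _).mul hreg) fun s _ => h1 s).trans ?_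
  rw [prim_const_mul]
  have h5 := prim_mul_discount_le har (l / 2) t
  have h6 : 0 ≤ 2 * (2 * k + k / (l / 2)) := by positivity
  exact (mul_le_mul_of_nonneg_left h5 h6).trans_eq (mul_one _)

/-- Integration by parts of the discount factor against `y - y₀ - ∫ g`. -/
theorem discounted_eq (ha : IsRegPath a) (hy : IsRegPath y) (hg : IsRegPath g) (l y₀ : ℝ)
    (t : ℝ≥0) :
    discounted l a y g t = y₀ +
      ((1 + prim (fun s => -(l * a s) * discount l a s) t) * (y t - y₀ - prim g t)
        - prim (fun s => -(l * a s) * discount l a s * (y s - y₀ - prim g s)) t) := by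
  have hD := ha.discount l
  have hv : IsRegPath fun s => -(l * a s) * discount l a s := by
    simpa only [neg_mul] using ((IsRegPath.const (-l)).mul ha).mul hD
  have h1 := prim_mul hv hg 1 0 t
  simp only [← discount_eq ha, zero_add, mul_zero] at h1
  have h2 : prim (fun s => discount l a s * (g s - l * a s * y s)) t
      = prim (fun s => discount l a s * g s) t
        + prim (fun s => -(l * a s) * discount l a s * y s) t := by
    rw [← prim_add (hD.mul hg) (hv.mul hy)]
    congr 1; funext s; ring
  have h3 : prim (fun s => -(l * a s) * discount l a s * (y s - y₀ - prim g s)) t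
      = prim (fun s => -(l * a s) * discount l a s * y s) t
        - y₀ * prim (fun s => -(l * a s) * discount l a s) t
        - prim (fun s => -(l * a s) * discount l a s * prim g s) t := by
    rw [← prim_const_mul, ← prim_sub (hv.mul hy) ((IsRegPath.const y₀).mul hv),
      ← prim_sub ((hv.mul hy).sub ((IsRegPath.const y₀).mul hv)) (hv.mul hg.prim)]
    congr 1; funext s; ring
  rw [prim_add (hD.mul hg) (hv.mul hg.prim)] at h1
  have h4 := discount_eq ha l t
  rw [discounted, h2, h3, ← h4]
  linear_combination h1 + y₀ * h4

theorem discounted_const (ha : IsRegPath a) (l k : ℝ) (t : ℝ≥0) :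
    discounted l a (fun _ => k) (fun _ => 0) t = k := by
  rw [discounted_eq ha (.const k) (.const 0) l k t]
  simp [prim_const]

theorem discounted_add {y' g' : ℝ≥0 → ℝ} (ha : IsRegPath a) (hy : IsRegPath y) (hg : IsRegPath g)
    (hy' : IsRegPath y') (hg' : IsRegPath g') (l : ℝ) (t : ℝ≥0) :
    discounted l a (fun s => y s + y' s) (fun s => g s + g' s) t
      = discounted l a y g t + discounted l a y' g' t := by
  have hD := ha.discount l
  have hla : IsRegPath fun s => l * a s := (IsRegPath.const l).mul ha
  rw [discounted, discounted, discounted]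
  have : prim (fun s => discount l a s * (g s + g' s - l * a s * (y s + y' s))) t
      = prim (fun s => discount l a s * (g s - l * a s * y s)) t
        + prim (fun s => discount l a s * (g' s - l * a s * y' s)) t := by
    rw [← prim_add (hD.mul (hg.sub (hla.mul hy))) (hD.mul (hg'.sub (hla.mul hy')))]
    congr 1; funext s; ring
  rw [this]; ring

/-- A uniform bound of discounted paths. -/
theorem abs_discounted_le (hl : 0 < l) (har : IsRegPath a) (ha : ∀ s, 0 ≤ a s) (hy : IsRegPath y)
    (hg : IsRegPath g) {k k' k'' : ℝ} (hk' : 0 ≤ k')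
    (hk'' : 0 ≤ k'') (hyk : ∀ s, |y s| ≤ k)
    (hgk : ∀ s, |g s| ≤ k' + k'' * a s) (t : ℝ≥0) :
    |discounted l a y g t| ≤ 2 * k + k' * t + k'' / l := by
  have hD := har.discount l
  have hk : 0 ≤ k := (abs_nonneg _).trans (hyk 0)
  have h0 : ∀ s, |discount l a s| = discount l a s := fun s => abs_of_pos (discount_pos _ _ _)
  have hDa : IsRegPath fun s => l * a s * discount l a s := ((IsRegPath.const l).mul har).mul hD
  have h1 : ∀ s, |discount l a s * (g s - l * a s * y s)|
      ≤ k' + (k'' / l + k) * (l * a s * discount l a s) := fun s => by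
    have hDp := discount_pos l a s
    have hD1 := discount_le_one hl.le ha s
    have hla := mul_nonneg hl.le (ha s)
    have h2 : |g s - l * a s * y s| ≤ k' + k'' * a s + l * a s * k := by
      refine (abs_sub _ _).trans (add_le_add (hgk s) ?_)
      rw [abs_mul, abs_of_nonneg hla]
      exact mul_le_mul_of_nonneg_left (hyk s) hla
    rw [abs_mul, h0]
    refine (mul_le_mul_of_nonneg_left h2 hDp.le).trans ?_
    have h3 : k'' / l * (l * a s * discount l a s) = discount l a s * (k'' * a s) := by
      field_simp
    have h5 : discount l a s * k' ≤ 1 * k' := mul_le_mul_of_nonneg_right hD1 hk'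
    rw [add_mul, h3]
    nlinarith
  have h2 := abs_prim_le (t := t) (hD.mul (hg.sub (((IsRegPath.const l).mul har).mul hy)))
    ((IsRegPath.const k').add ((IsRegPath.const (k'' / l + k)).mul hDa)) fun s _ => h1 s
  rw [prim_add (.const k') ((IsRegPath.const (k'' / l + k)).mul hDa), prim_const, prim_const_mul]
    at h2
  have h3 : (k'' / l + k) * prim (fun s => l * a s * discount l a s) t ≤ (k'' / l + k) * 1 :=
    mul_le_mul_of_nonneg_left (prim_mul_discount_le har l t) (by positivity)
  have h4 : |discount l a t * y t| ≤ 1 * k := by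
    rw [abs_mul, h0]
    exact mul_le_mul (discount_le_one hl.le ha t) (hyk t) (abs_nonneg _) zero_le_one
  rw [discounted]
  refine (abs_sub _ _).trans ((add_le_add h4 h2).trans ?_)
  linarith

end Discount

/-! ### Discounting turns local martingales into martingales -/

section Solutions

variable {Ω : Type*} [m : MeasurableSpace Ω] {P : Measure Ω} {ℱ : Filtration ℝ≥0 m}

theorem IsRCLL.isRegPath {Ω S : Type*} [TopologicalSpace S] {X : ℝ≥0 → Ω → S} (hX : IsRCLL X)
    {g : S → ℝ} (hg : Continuous g) (ω : Ω) : IsRegPath fun t => g (X t ω) := by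
  refine ⟨fun t => hg.continuousAt.comp_continuousWithinAt (hX ω t).1, fun T => ?_⟩
  -- the path is bounded near every point, and `[0, T]` is compact
  have h := (isCompact_Icc (a := (0 : ℝ≥0)) (b := T)).induction_on
    (p := fun s => ∃ K, ∀ x ∈ s, |g (X x ω)| ≤ K) ⟨0, by simp⟩
    (fun s t hst ⟨K, hK⟩ => ⟨K, fun x hx => hK x (hst hx)⟩)
    (fun s t ⟨K, hK⟩ ⟨L, hL⟩ => ⟨max K L, fun x hx => hx.elim
      (fun h => (hK x h).trans (le_max_left _ _)) (fun h => (hL x h).trans (le_max_right _ _))⟩)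
    (fun x _ => by
      obtain ⟨hr, z, hz⟩ := hX ω x
      have h1 : Tendsto (fun s => |g (X s ω)|) (𝓝[≥] x) (𝓝 |g (X x ω)|) :=
        ((hg.continuousAt.tendsto.comp hr)).abs
      have h2 : Tendsto (fun s => |g (X s ω)|) (𝓝[<] x) (𝓝 |g z|) :=
        ((hg.tendsto z).comp hz).abs
      have e1 := h1.eventually_le_const (lt_add_one _)
      have e2 := h2.eventually_le_const (lt_add_one _)
      refine ⟨{s | |g (X s ω)| ≤ max (|g (X x ω)| + 1) (|g z| + 1)}, mem_nhdsWithin_of_mem_nhds ?_,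
        _, fun s hs => hs⟩
      rw [← nhdsLT_sup_nhdsGE]
      exact ⟨e2.mono fun s hs => hs.trans (le_max_right _ _),
        e1.mono fun s hs => hs.trans (le_max_left _ _)⟩)
  obtain ⟨K, hK⟩ := h
  exact ⟨K, fun s hs => hK s ⟨zero_le, hs⟩⟩

theorem isRegProcess_comp {S : Type*} [TopologicalSpace S] {X : ℝ≥0 → Ω → S}
    (hXa : StronglyAdapted ℱ X) (hX : IsRCLL X) {g : S → ℝ} (hg : Continuous g) :
    IsRegProcess ℱ fun t ω => g (X t ω) :=
  ⟨fun t => hg.comp_stronglyMeasurable (hXa t), hX.isRegPath hg⟩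

theorem untopA_coe (t : ℝ≥0) : (t : WithTop ℝ≥0).untopA = t := rfl

/-- Right-continuity and boundedness are inherited by a stopped path. -/
theorem IsRegPath.comp_min_untopA {y : ℝ≥0 → ℝ} (hy : IsRegPath y) (r : WithTop ℝ≥0) :
    IsRegPath fun t : ℝ≥0 => y (min (t : WithTop ℝ≥0) r).untopA := by
  induction r using WithTop.recTopCoe with
  | top => simpa only [min_eq_left le_top, untopA_coe] using hy
  | coe r =>
    have e : ∀ t : ℝ≥0, (min (t : WithTop ℝ≥0) r).untopA = min t r := fun t => by
      rw [← WithTop.coe_min, untopA_coe]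
    simp only [e]
    refine ⟨fun t => ContinuousWithinAt.comp (t := Set.Ici (min t r)) (hy.rc _)
      (continuous_id.min continuous_const).continuousWithinAt
      fun s hs => min_le_min_right r hs, fun T => ?_⟩
    obtain ⟨K, hK⟩ := hy.bdd T
    exact ⟨K, fun s hs => hK _ ((min_le_left _ _).trans hs)⟩

theorem min_untopA_le (t : ℝ≥0) (r : WithTop ℝ≥0) : (min (t : WithTop ℝ≥0) r).untopA ≤ t := by
  induction r using WithTop.recTopCoe with
  | top => rw [min_eq_left le_top, untopA_coe]
  | coe r => rw [← WithTop.coe_min, untopA_coe]; exact min_le_left _ _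

theorem min_untopA_of_lt {t : ℝ≥0} {r : WithTop ℝ≥0} (h : (t : WithTop ℝ≥0) ≤ r) :
    (min (t : WithTop ℝ≥0) r).untopA = t := by
  rw [min_eq_left h, untopA_coe]

theorem martingale_of_stronglyMeasurable_zero [IsFiniteMeasure P] {Z : Ω → ℝ}
    (hZ : StronglyMeasurable[ℱ 0] Z) (hint : Integrable Z P) :
    Martingale (fun _ : ℝ≥0 => Z) ℱ P :=
  ⟨fun t => hZ.mono (ℱ.mono zero_le), fun s t _ => by
    rw [condExp_of_stronglyMeasurable (ℱ.le s) (hZ.mono (ℱ.mono zero_le)) hint]⟩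

/-- If `M = Y - Y₀ - ∫ G` is a local martingale with `Y` bounded and `G` bounded by a multiple of
`a`, then the compensated discounted process is a true martingale. -/
theorem martingale_discounted_of_locally [IsFiniteMeasure P] {Y G A : ℝ≥0 → Ω → ℝ}
    (hY : IsRegProcess ℱ Y) (hG : IsRegProcess ℱ G) (hA : IsRegProcess ℱ A)
    (hA0 : ∀ t ω, 0 ≤ A t ω) {k : ℝ} (hYk : ∀ t ω, |Y t ω| ≤ k)
    (hGk : ∀ t ω, |G t ω| ≤ k * A t ω)
    (hM : Locally (fun M : ℝ≥0 → Ω → ℝ => Martingale M ℱ P) ℱ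
      (fun t ω => Y t ω - Y 0 ω - primProc G t ω) P) {l : ℝ} (hl : 0 < l) :
    Martingale (fun t ω => discounted l (fun s => A s ω) (fun s => Y s ω) (fun s => G s ω) t)
      ℱ P := by
  obtain ⟨τ, hτ, hN⟩ := hM
  set M : ℝ≥0 → Ω → ℝ := fun t ω => Y t ω - Y 0 ω - primProc G t ω with hMdef
  have hY0 : IsRegProcess ℱ fun (_ : ℝ≥0) ω => Y 0 ω :=
    ⟨fun t => (hY.adapted 0).mono (ℱ.mono zero_le), fun ω => .const _⟩
  have hMr : IsRegProcess ℱ M := (hY.sub hY0).sub hG.primProc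
  have hM0 : ∀ ω, M 0 ω = 0 := fun ω => by simp [hMdef, primProc]
  -- stopping at time `0` gives `0`, so that the indicator in the stopped process plays no role
  have hstopped : ∀ n t ω,
      stoppedProcess (fun i => {ω | ⊥ < τ n ω}.indicator (M i)) (τ n) t ω
        = M (min (t : WithTop ℝ≥0) (τ n ω)).untopA ω := fun n t ω => by
    rw [stoppedProcess]
    by_cases h : ⊥ < τ n ω
    · exact Set.indicator_of_mem (s := {ω | ⊥ < τ n ω}) h _
    · rw [Set.indicator_of_notMem (s := {ω | ⊥ < τ n ω}) h]
      have h0 : τ n ω = ((0 : ℝ≥0) : WithTop ℝ≥0) := by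
        rw [not_bot_lt_iff] at h; rw [h]; rfl
      rw [h0, ← WithTop.coe_min, untopA_coe, min_eq_right zero_le, hM0]
  have hk : ∀ ω : Ω, 0 ≤ k := fun ω => (abs_nonneg _).trans (hYk 0 ω)
  have hMk : ∀ t ω, |M t ω| ≤ 2 * k + k * prim (fun s => A s ω) t := fun t ω => by
    have h1 := abs_prim_le (t := t) (hG.path ω) ((IsRegPath.const k).mul (hA.path ω))
      fun s _ => hGk s ω
    rw [prim_const_mul] at h1
    have h2 := hYk t ω
    have h3 := hYk 0 ω
    rw [abs_le] at h1 h2 h3 ⊢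
    simp only [hMdef, primProc]
    constructor <;> linarith [h1.1, h1.2, h2.1, h2.2, h3.1, h3.2]
  -- the derivative of the discount factor, whose total variation is at most `1`
  set v : ℝ≥0 → Ω → ℝ := fun s ω => -(l * A s ω) * discount l (fun s => A s ω) s with hvdef
  have hD : IsRegProcess ℱ fun t ω => discount l (fun s => A s ω) t :=
    hA.primProc.comp (F := fun x => Real.exp (-(l * x))) (by fun_prop)
  have hv : IsRegProcess ℱ v := by
    simpa only [hvdef, neg_mul] using ((IsRegProcess.const (-l)).mul hA).mul hD
  have hvle : ∀ t ω, prim (fun s => |v s ω|) t ≤ 1 := fun t ω => by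
    have e : (fun s => |v s ω|) = fun s => l * A s ω * discount l (fun s => A s ω) s := by
      funext s
      simp only [hvdef]
      rw [abs_mul, abs_neg, abs_of_nonneg (mul_nonneg hl.le (hA0 s ω)),
        abs_of_pos (discount_pos _ _ _)]
    rw [e]
    exact prim_mul_discount_le (hA.path ω) l t
  set C : ℝ := 2 * (2 * |k| + |k| / (l / 2)) with hC
  have hMk' : ∀ (r : WithTop ℝ≥0) (t : ℝ≥0) ω, |M (min (t : WithTop ℝ≥0) r).untopA ω|
      ≤ 2 * |k| + |k| * prim (fun s => A s ω) t := fun r t ω => by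
    rw [abs_of_nonneg (hk ω)]
    refine (hMk _ ω).trans (add_le_add le_rfl (mul_le_mul_of_nonneg_left ?_ (hk ω)))
    exact prim_le_prim_of_le (hA.path ω) (fun s => hA0 s ω) (min_untopA_le t r)
  set N : ℕ → ℝ≥0 → Ω → ℝ := fun n t ω => M (min (t : WithTop ℝ≥0) (τ n ω)).untopA ω with hNdef
  have hNm : ∀ n, Martingale (N n) ℱ P := fun n => by
    have := hN n
    rwa [show stoppedProcess (fun i => {ω | ⊥ < τ n ω}.indicator (M i)) (τ n) = N n from
      funext fun t => funext fun ω => hstopped n t ω] at this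
  have hNr : ∀ n, IsRegProcess ℱ (N n) := fun n =>
    ⟨(hNm n).1, fun ω => (hMr.path ω).comp_min_untopA (τ n ω)⟩
  have hvN : ∀ n t ω, prim (fun s => |v s ω * N n s ω|) t ≤ C := fun n t ω =>
    prim_abs_discount_mul_le hl (hA.path ω) (fun s => hA0 s ω) ((hNr n).path ω) (abs_nonneg k)
      (fun s => hMk' _ s ω) t
  have hC1 : 1 ≤ max C 1 := le_max_right _ _
  -- integrate by parts for the stopped martingales; the bounds do not depend on the stopping times
  have hQ : ∀ n, Martingale (fun t ω => (1 + primProc v t ω) * N n t ω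
      - primProc (fun s ω => v s ω * N n s ω) t ω) ℱ P := fun n =>
    Martingale.mul_absolutelyContinuous (hNm n) (hNr n) hv 1 (C := fun _ => max C 1)
      (fun t ω => (hvle t ω).trans (le_max_right _ _))
      (fun t ω => (hvN n t ω).trans (le_max_left _ _))
  have hlim : Martingale (fun t ω => (1 + primProc v t ω) * M t ω
      - primProc (fun s ω => v s ω * M s ω) t ω) ℱ P := by
    refine martingale_of_tendsto_of_bounded hQ
      ((((IsRegProcess.const 1).add hv.primProc).mul hMr).sub (hv.mul hMr).primProc).adapted
      (C := fun _ => 2 * |k| + |k| / l + C) (fun n t ω => ?_) fun t => ?_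
    · refine (abs_sub _ _).trans (add_le_add ?_ ?_)
      · rw [primProc, ← discount_eq (hA.path ω), abs_mul, abs_of_pos (discount_pos _ _ _)]
        exact (mul_le_mul_of_nonneg_left (hMk' _ t ω) (discount_pos _ _ _).le).trans
          (discount_mul_le hl _ (abs_nonneg k) (fun s => hA0 s ω) t)
      · exact (abs_prim_le ((hv.mul (hNr n)).path ω) ((hv.mul (hNr n)).path ω).abs
          fun _ _ => le_rfl).trans (hvN n t ω)
    · filter_upwards [hτ.tendsto_top] with ω hω
      refine tendsto_const_nhds.congr' ?_
      filter_upwards [hω.eventually (lt_mem_nhds (WithTop.coe_lt_top t))] with n hn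
      have e : ∀ s ≤ t, N n s ω = M s ω := fun s hs => by
        simp only [hNdef]
        rw [min_untopA_of_lt ((WithTop.coe_le_coe.2 hs).trans hn.le)]
      rw [e t le_rfl]
      congr 1
      refine intervalIntegral.integral_congr fun s hs => ?_
      rw [Set.uIcc_of_le t.coe_nonneg] at hs
      rw [e _ (Real.toNNReal_le_iff_le_coe.2 hs.2)]
  have hconst : Martingale (fun _ : ℝ≥0 => Y 0) ℱ P :=
    martingale_of_stronglyMeasurable_zero (hY.adapted 0) ((integrable_const k).mono'
      (hY.stronglyMeasurable 0).aestronglyMeasurable (ae_of_all _ (hYk 0)))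
  convert hconst.add hlim using 1
  funext t ω
  exact discounted_eq (hA.path ω) (hY.path ω) (hG.path ω) l (Y 0 ω) t

end Solutions

/-! ### True martingales for bounded drifts -/

section Drift

variable {Ω : Type*} [m : MeasurableSpace Ω] {P : Measure Ω} {ℱ : Filtration ℝ≥0 m}

/-- A process is bounded, uniformly in `ω`, on every finite time interval. -/
def LocBounded (Y : ℝ≥0 → Ω → ℝ) : Prop := ∀ T, ∃ K, ∀ s ≤ T, ∀ ω, |Y s ω| ≤ K

/-- `Y` is a regular process with drift `G`: the process `Y - ∫ G` is a martingale, and both are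
bounded on finite time intervals. -/
structure HasDrift (ℱ : Filtration ℝ≥0 m) (P : Measure Ω) (Y G : ℝ≥0 → Ω → ℝ) : Prop where
  regular : IsRegProcess ℱ Y
  regular_drift : IsRegProcess ℱ G
  bdd : LocBounded Y
  bdd_drift : LocBounded G
  martingale : Martingale (fun t ω => Y t ω - primProc G t ω) ℱ P

variable {d : ℕ} {w : Rd d → ℝ} {b : Pw w → Rd d → Rd d}
  {σ τ : Pw w → Rd d → Matrix (Fin d) (Fin d) ℝ} {κ : Pw w → ℝ} {c : ℝ} {μ₀ : Pw w}
  {X : ℝ≥0 → Ω → Pw w} {J : Pw w → Jet d}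

theorem isRegProcess_discounted {A Y G : ℝ≥0 → Ω → ℝ} (hA : IsRegProcess ℱ A)
    (hY : IsRegProcess ℱ Y) (hG : IsRegProcess ℱ G) (l : ℝ) :
    IsRegProcess ℱ fun t ω =>
      discounted l (fun s => A s ω) (fun s => Y s ω) (fun s => G s ω) t := by
  have hD : IsRegProcess ℱ fun t ω => discount l (fun s => A s ω) t :=
    hA.primProc.comp (F := fun x => Real.exp (-(l * x))) (by fun_prop)
  exact (hD.mul hY).sub (hD.mul (hG.sub (((IsRegProcess.const l).mul hA).mul hY))).primProc

/-- For every jet in the closure the discounted process is a true martingale. -/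
theorem Core.martingale_discounted [IsFiniteMeasure P] (hB : CoefBounds b σ τ κ c)
    (hX : SolvesMartingaleProblem (generator b σ τ) (Dw w) μ₀ P ℱ X)
    (hJ : Core b σ τ κ J) {l : ℝ} (hl : 0 < l) :
    Martingale (fun t ω => discounted l (fun s => κ (X s ω)) (fun s => (J (X s ω)).val)
      (fun s => (J (X s ω)).drift) t) ℱ P := by
  have hκ0 : ∀ μ, 0 ≤ κ μ := fun μ => zero_le_one.trans (hB.one_le_κ μ)
  have hreg : ∀ {g : Pw w → ℝ}, Continuous g → IsRegProcess ℱ fun t ω => g (X t ω) :=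
    fun hg => isRegProcess_comp hX.adapted hX.rcll hg
  have hA := hreg hB.κ_cont
  induction hJ with
  | @base f J C a hf hJ hc hC =>
    have h1 := martingale_discounted_of_locally (P := P) (hreg hc.1) (hreg hc.2.2) hA
      (fun t ω => hκ0 _) (k := C) (fun t ω => (hC _).1)
      (fun t ω => (hC _).2.2.trans_eq (mul_comm _ _)) (by
        have := hX.localMartingale f hf
        convert this using 3 with t ω
        simp only [mgProcess, (hJ.generator_eq hB _).1, (hJ.generator_eq hB _).2, primProc, prim]) hl
    convert (martingale_const ℱ P a).add h1 using 1
    funext t ω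
    have h2 := discounted_add (hA.path ω) (.const a) (.const 0) ((hreg hc.1).path ω)
      ((hreg hc.2.2).path ω) l t
    rw [discounted_const (hA.path ω)] at h2
    simpa using h2
  | @lim J K C hJ hC hK hlim ih =>
    have hJc := fun n => (hJ n).continuous
    have hC0 : ∀ ω : Ω, 0 ≤ C := fun ω => (hC 0 (X 0 ω)).nonneg
    refine martingale_of_tendsto_of_bounded ih
      (isRegProcess_discounted hA (hreg hK.1) (hreg hK.2.2) l).adapted
      (C := fun t => 2 * C + 0 * t + C / l)
      (fun n t ω => abs_discounted_le hl (hA.path ω) (fun s => hκ0 _) ((hreg (hJc n).1).path ω)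
        ((hreg (hJc n).2.2).path ω) le_rfl (hC0 ω) (fun s => (hC n _).1)
        (fun s => by simpa [mul_comm] using (hC n (X s ω)).2.2) t)
      fun t => ae_of_all _ fun ω => ?_
    have hD := (hA.path ω).discount l
    refine ((hlim (X t ω)).1.const_mul _).sub (tendsto_prim
      (v := fun s => (1 + l) * C * κ (X s ω)) (fun n => hD.mul (((hreg (hJc n).2.2).path ω).sub
        (((IsRegPath.const l).mul (hA.path ω)).mul ((hreg (hJc n).1).path ω))))
      ((IsRegPath.const _).mul (hA.path ω)) (fun n s => ?_)
      (fun s => ((hlim (X s ω)).2.2.sub ((hlim (X s ω)).1.const_mul _)).const_mul _) t)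
    rw [abs_mul, abs_of_pos (discount_pos _ _ _)]
    have hlk := mul_nonneg hl.le (hκ0 (X s ω))
    have h1 : |(J n (X s ω)).drift - l * κ (X s ω) * (J n (X s ω)).val|
        ≤ (1 + l) * C * κ (X s ω) := by
      refine (abs_sub _ _).trans ((add_le_add (hC n _).2.2 (?_ : _ ≤ l * κ (X s ω) * C)).trans_eq
        (by ring))
      rw [abs_mul, abs_of_nonneg hlk]
      exact mul_le_mul_of_nonneg_left (hC n _).1 hlk
    exact (mul_le_mul (discount_le_one hl.le (fun s => hκ0 _) s) h1 (abs_nonneg _)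
      zero_le_one).trans_eq (one_mul _)

/-- For a jet in the closure with bounded drift, letting the discount rate tend to zero shows that
the compensated process is a true martingale. -/
theorem Core.hasDrift [IsFiniteMeasure P] (hB : CoefBounds b σ τ κ c)
    (hX : SolvesMartingaleProblem (generator b σ τ) (Dw w) μ₀ P ℱ X)
    (hJ : Core b σ τ κ J) {k : ℝ} (hk : ∀ μ, |(J μ).drift| ≤ k) :
    HasDrift ℱ P (fun t ω => (J (X t ω)).val) (fun t ω => (J (X t ω)).drift) := by
  have hκ0 : ∀ μ, 0 ≤ κ μ := fun μ => zero_le_one.trans (hB.one_le_κ μ)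
  have hreg : ∀ {g : Pw w → ℝ}, Continuous g → IsRegProcess ℱ fun t ω => g (X t ω) :=
    fun hg => isRegProcess_comp hX.adapted hX.rcll hg
  have hA := hreg hB.κ_cont
  obtain ⟨C, hC⟩ := hJ.exists_le hB.one_le_κ
  have hY := hreg hJ.continuous.1
  have hG := hreg hJ.continuous.2.2
  refine ⟨hY, hG, fun T => ⟨C, fun s _ ω => (hC _).1⟩, fun T => ⟨k, fun s _ ω => hk _⟩, ?_⟩
  have hl : ∀ n : ℕ, 0 < 1 / ((n : ℝ) + 1) := fun n => by positivity
  have hk0 : ∀ ω : Ω, 0 ≤ k := fun ω => (abs_nonneg _).trans (hk (X 0 ω))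
  refine martingale_of_tendsto_of_bounded (fun n => hJ.martingale_discounted hB hX (hl n))
    (hY.sub hG.primProc).adapted (C := fun t => 2 * C + k * t + 0)
    (fun n t ω => ?_) fun t => ae_of_all _ fun ω => ?_
  · have := abs_discounted_le (hl n) (hA.path ω) (fun s => hκ0 _) (hY.path ω) (hG.path ω)
      (hk0 ω) le_rfl (fun s => (hC _).1) (k'' := 0) (fun s => by simpa using hk (X s ω)) t
    simpa using this
  · have hl0 : Tendsto (fun n : ℕ => 1 / ((n : ℝ) + 1)) atTop (𝓝 0) :=
      tendsto_one_div_add_atTop_nhds_zero_nat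
    have hD : ∀ s, Tendsto (fun n : ℕ => discount (1 / ((n : ℝ) + 1)) (fun r => κ (X r ω)) s) atTop
        (𝓝 1) := fun s => by
      have : Continuous fun l : ℝ => discount l (fun r => κ (X r ω)) s := by
        unfold discount; fun_prop
      have h := (this.tendsto 0).comp hl0
      simpa [discount, Function.comp_def] using h
    have h1 := (hD t).mul_const (J (X t ω)).val
    rw [one_mul] at h1
    refine h1.sub (tendsto_prim (v := fun s => k + C * κ (X s ω)) (fun n =>
      ((hA.path ω).discount _).mul ((hG.path ω).sub
        (((IsRegPath.const _).mul (hA.path ω)).mul (hY.path ω))))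
      ((IsRegPath.const _).add ((IsRegPath.const _).mul (hA.path ω))) (fun n s => ?_)
      (fun s => ?_) t)
    · rw [abs_mul, abs_of_pos (discount_pos _ _ _)]
      have h2 : 1 / ((n : ℝ) + 1) ≤ 1 := by
        rw [div_le_one (by positivity)]; linarith [Nat.cast_nonneg (α := ℝ) n]
      have h3 : |(J (X s ω)).drift - 1 / ((n : ℝ) + 1) * κ (X s ω) * (J (X s ω)).val|
          ≤ k + C * κ (X s ω) := by
        refine (abs_sub _ _).trans (add_le_add (hk _) ?_)
        rw [abs_mul, abs_of_nonneg (mul_nonneg (hl n).le (hκ0 _)), mul_comm C]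
        refine mul_le_mul ?_ (hC _).1 (abs_nonneg _) (hκ0 _)
        exact mul_le_of_le_one_left (hκ0 _) h2
      exact (mul_le_mul (discount_le_one (hl n).le (fun s => hκ0 _) s) h3 (abs_nonneg _)
        zero_le_one).trans_eq (one_mul _)
    · have h2 : Tendsto (fun n : ℕ => (J (X s ω)).drift
          - 1 / ((n : ℝ) + 1) * κ (X s ω) * (J (X s ω)).val) atTop
          (𝓝 ((J (X s ω)).drift - 0 * κ (X s ω) * (J (X s ω)).val)) :=
        tendsto_const_nhds.sub ((hl0.mul_const _).mul_const _)
      have h3 := (hD s).mul h2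
      simpa using h3

theorem LocBounded.add {Ω : Type*} {Y Z : ℝ≥0 → Ω → ℝ} (hY : LocBounded Y) (hZ : LocBounded Z) :
    LocBounded fun t ω => Y t ω + Z t ω := fun T => by
  obtain ⟨K, hK⟩ := hY T
  obtain ⟨L, hL⟩ := hZ T
  exact ⟨K + L, fun s hs ω => (abs_add_le _ _).trans (add_le_add (hK s hs ω) (hL s hs ω))⟩

theorem LocBounded.mul {Ω : Type*} {Y Z : ℝ≥0 → Ω → ℝ} (hY : LocBounded Y) (hZ : LocBounded Z) :
    LocBounded fun t ω => Y t ω * Z t ω := fun T => by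
  obtain ⟨K, hK⟩ := hY T
  obtain ⟨L, hL⟩ := hZ T
  refine ⟨K * L, fun s hs ω => ?_⟩
  rw [abs_mul]
  exact mul_le_mul (hK s hs ω) (hL s hs ω) (abs_nonneg _) ((abs_nonneg _).trans (hK s hs ω))

theorem locBounded_const {Ω : Type*} (a : ℝ) : LocBounded fun (_ : ℝ≥0) (_ : Ω) => a :=
  fun _ => ⟨|a|, fun _ _ _ => le_rfl⟩

theorem LocBounded.sub {Ω : Type*} {Y Z : ℝ≥0 → Ω → ℝ} (hY : LocBounded Y) (hZ : LocBounded Z) :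
    LocBounded fun t ω => Y t ω - Z t ω := by
  simpa [sub_eq_add_neg] using hY.add ((locBounded_const (-1)).mul hZ)

theorem LocBounded.primProc {Y : ℝ≥0 → Ω → ℝ} (hY : LocBounded Y) (hr : IsRegProcess ℱ Y) :
    LocBounded (primProc Y) := fun T => by
  obtain ⟨K, hK⟩ := hY T
  refine ⟨|K| * T, fun s hs ω => ?_⟩
  have := abs_prim_le (t := s) (hr.path ω) (.const |K|)
    fun r hr => (hK r (hr.trans hs) ω).trans (le_abs_self K)
  rw [prim_const] at this
  exact this.trans (mul_le_mul_of_nonneg_left (by exact_mod_cast hs) (abs_nonneg K))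

namespace HasDrift

variable {Y G Z H v : ℝ≥0 → Ω → ℝ}

theorem add (hY : HasDrift ℱ P Y G) (hZ : HasDrift ℱ P Z H) :
    HasDrift ℱ P (fun t ω => Y t ω + Z t ω) fun t ω => G t ω + H t ω := by
  refine ⟨hY.regular.add hZ.regular, hY.regular_drift.add hZ.regular_drift, hY.bdd.add hZ.bdd,
    hY.bdd_drift.add hZ.bdd_drift, ?_⟩
  convert hY.martingale.add hZ.martingale using 1
  funext t ω
  have := prim_add (hY.regular_drift.path ω) (hZ.regular_drift.path ω) t
  simp only [Pi.add_apply, primProc, this]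
  ring

/-- The product rule for a process with drift and an absolutely continuous process. -/
theorem mul_absolutelyContinuous [IsFiniteMeasure P] (hY : HasDrift ℱ P Y G)
    (hv : IsRegProcess ℱ v) (hvb : LocBounded v) (V₀ : ℝ) :
    HasDrift ℱ P (fun t ω => (V₀ + primProc v t ω) * Y t ω)
      fun t ω => (V₀ + primProc v t ω) * G t ω + v t ω * Y t ω := by
  have hV : IsRegProcess ℱ fun t ω => V₀ + primProc v t ω :=
    (IsRegProcess.const V₀).add hv.primProc
  have hVb : LocBounded fun t ω => V₀ + primProc v t ω :=
    (locBounded_const V₀).add (hvb.primProc hv)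
  have hN := hY.regular.sub hY.regular_drift.primProc
  have hNb := hY.bdd.sub (hY.bdd_drift.primProc hY.regular_drift)
  refine ⟨hV.mul hY.regular, (hV.mul hY.regular_drift).add (hv.mul hY.regular), hVb.mul hY.bdd,
    (hVb.mul hY.bdd_drift).add (hvb.mul hY.bdd), ?_⟩
  choose K₂ hK₂ using hvb.mul hNb
  choose K₁ hK₁ using hvb
  have h := Martingale.mul_absolutelyContinuous hY.martingale hN hv V₀
    (C := fun t => max (K₁ t * t) (K₂ t * t)) (fun t ω => ?_) (fun t ω => ?_)
  · convert h using 1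
    funext t ω
    have h1 := prim_mul (hv.path ω) (hY.regular_drift.path ω) V₀ 0 t
    simp only [zero_add, mul_zero] at h1
    have e : (fun s => (V₀ + primProc v s ω) * G s ω + v s ω * Y s ω)
        = fun s => ((V₀ + prim (fun r => v r ω) s) * G s ω + v s ω * prim (fun r => G r ω) s)
          + v s ω * (Y s ω - primProc G s ω) := by
      funext s; simp only [primProc]; ring
    have hGp := hY.regular_drift.primProc
    have h2 := prim_add (((hV.mul hY.regular_drift).add (hv.mul hGp)).path ω)
      ((hv.mul hN).path ω) t
    simp only [primProc] at h2 e h1 ⊢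
    rw [e, h2, ← h1]
    ring
  · refine le_trans ?_ (le_max_left _ _)
    rw [← prim_const]
    exact prim_mono (hv.path ω).abs (.const _) fun s hs => hK₁ t s hs ω
  · refine le_trans ?_ (le_max_right _ _)
    rw [← prim_const]
    exact prim_mono ((hv.mul hN).path ω).abs (.const _) fun s hs => hK₂ t s hs ω

theorem integrable [IsFiniteMeasure P] (hY : HasDrift ℱ P Y G) (t : ℝ≥0) :
    Integrable (Y t) P := by
  obtain ⟨K, hK⟩ := hY.bdd t
  exact (integrable_const K).mono' (hY.regular.stronglyMeasurable t).aestronglyMeasurable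
    (ae_of_all _ (hK t le_rfl))

theorem integral_le_of_drift_nonpos [IsFiniteMeasure P] (hY : HasDrift ℱ P Y G)
    (h : ∀ t ω, G t ω ≤ 0) (t : ℝ≥0) : ∫ ω, Y t ω ∂P ≤ ∫ ω, Y 0 ω ∂P := by
  have h1 := hY.martingale.setIntegral_eq (zero_le (a := t)) MeasurableSet.univ
  simp only [setIntegral_univ, primProc, prim_zero_time, sub_zero] at h1
  rw [h1]
  refine integral_mono (hY.integrable t) (hY.martingale.integrable t) fun ω => ?_
  have := prim_mono (t := t) (hY.regular_drift.path ω) (.const 0) fun s _ => h s ω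
  rw [prim_const, zero_mul] at this
  simpa using this

/-- Gronwall's inequality for a process with drift: discounting by `exp (-K t)` makes the drift
non-positive. -/
theorem integral_le_exp [IsFiniteMeasure P] (hY : HasDrift ℱ P Y G) {K : ℝ}
    (h : ∀ t ω, G t ω ≤ K * Y t ω) (t : ℝ≥0) :
    ∫ ω, Y t ω ∂P ≤ Real.exp (K * t) * ∫ ω, Y 0 ω ∂P := by
  have hD : ∀ t : ℝ≥0, Real.exp (-(K * t))
      = 1 + prim (fun s : ℝ≥0 => -(K * 1) * Real.exp (-(K * s))) t := fun t => by
    have := discount_eq (.const 1) K t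
    simpa only [discount, prim_const, one_mul] using this
  have hc : Continuous fun s : ℝ≥0 => -(K * 1) * Real.exp (-(K * s)) := by fun_prop
  have h1 := hY.mul_absolutelyContinuous
    (v := fun s _ => -(K * 1) * Real.exp (-(K * s)))
    ⟨fun _ => stronglyMeasurable_const, fun _ => .of_continuous hc⟩
    (fun T => by
      obtain ⟨L, hL⟩ := (IsRegPath.of_continuous hc).bdd T
      exact ⟨L, fun s hs _ => hL s hs⟩) 1
  simp only [primProc, ← hD] at h1
  have h2 := h1.integral_le_of_drift_nonpos (fun s ω => by
    have := mul_le_mul_of_nonneg_left (h s ω) (Real.exp_pos (-(K * s))).le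
    linarith) t
  simp only [integral_const_mul, NNReal.coe_zero, mul_zero, neg_zero, Real.exp_zero, one_mul] at h2
  rw [Real.exp_neg, inv_mul_le_iff₀ (Real.exp_pos _)] at h2
  exact h2

end HasDrift

end Drift

/-! ### A smooth truncation of the weight functional and its moments -/

section Lyapunov

/-- A smooth concave truncation of the identity: equal to `y` for `y ≤ R` and constant for
`y ≥ R + 1`. -/
def softMin (R y : ℝ) : ℝ := ∫ s in (0 : ℝ)..y, stepDown R s

theorem hasDerivAt_softMin (R y : ℝ) : HasDerivAt (softMin R) (stepDown R y) y :=
  intervalIntegral.integral_hasDerivAt_right ((contDiff_stepDown R).continuous.intervalIntegrable _ _)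
    (contDiff_stepDown R).continuous.stronglyMeasurable.stronglyMeasurableAtFilter
    (contDiff_stepDown R).continuous.continuousAt

theorem deriv_softMin (R : ℝ) : deriv (softMin R) = stepDown R :=
  funext fun y => (hasDerivAt_softMin R y).deriv

theorem contDiff_softMin (R : ℝ) : ContDiff ℝ 2 (softMin R) := by
  rw [show (2 : WithTop ℕ∞) = 1 + 1 by norm_num, contDiff_succ_iff_deriv]
  refine ⟨fun y => (hasDerivAt_softMin R y).differentiableAt, by simp, ?_⟩
  rw [deriv_softMin]
  exact (contDiff_stepDown R).of_le (by norm_num)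

theorem monotone_softMin (R : ℝ) : Monotone (softMin R) :=
  monotone_of_deriv_nonneg (fun y => (hasDerivAt_softMin R y).differentiableAt)
    fun y => by rw [deriv_softMin]; exact stepDown_nonneg R y

theorem deriv_stepDown_nonpos (R y : ℝ) : deriv (stepDown R) y ≤ 0 :=
  Antitone.deriv_nonpos fun _ _ h => Real.smoothTransition.monotone (by linarith)

theorem softMin_of_le {R y : ℝ} (hR : 0 ≤ R) (hy : y ≤ R) : softMin R y = y := by
  have : softMin R y = ∫ _ in (0 : ℝ)..y, (1 : ℝ) :=
    intervalIntegral.integral_congr fun s hs =>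
      stepDown_of_le (hs.2.trans (sup_le hR hy))
  simpa using this

theorem softMin_of_ge {R y : ℝ} (hy : R + 1 ≤ y) : softMin R y = softMin R (R + 1) := by
  have h := intervalIntegral.integral_add_adjacent_intervals (μ := volume)
    ((contDiff_stepDown R).continuous.intervalIntegrable 0 (R + 1))
    ((contDiff_stepDown R).continuous.intervalIntegrable (R + 1) y)
  have h2 : ∫ s in (R + 1)..y, stepDown R s = ∫ _ in (R + 1)..y, (0 : ℝ) :=
    intervalIntegral.integral_congr fun s hs => by
      rw [Set.uIcc_of_le hy] at hs; exact stepDown_of_ge hs.1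
  rw [h2, intervalIntegral.integral_zero, add_zero] at h
  exact h.symm

theorem sub_one_le_softMin {R y : ℝ} (hR : 0 ≤ R) (hy : y ≤ R + 1) : y - 1 ≤ softMin R y := by
  rcases le_total y R with h | h
  · rw [softMin_of_le hR h]; linarith
  · have := monotone_softMin R h
    rw [softMin_of_le hR le_rfl] at this
    linarith

variable {d : ℕ} {w : Rd d → ℝ} {b : Pw w → Rd d → Rd d}
  {σ τ : Pw w → Rd d → Matrix (Fin d) (Fin d) ℝ} {κ : Pw w → ℝ} {c : ℝ} {μ₀ : Pw w}
  {J : Pw w → Jet d}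

/-- The outer weight is constant near the origin, so its drift is bounded without `κ`. -/
theorem exists_outerJet_le (hw : IsWeight w) (hB : CoefBounds b σ τ κ c) :
    ∃ K, 0 ≤ K ∧ ∀ μ, (outerJet b σ τ μ).Le 1 (K * μ.moment) := by
  obtain ⟨C, hC⟩ := hw.exists_adm_outerWeight
  refine ⟨jetConst d c * C, mul_nonneg (jetConst_pos hB.c_nonneg).le (hC.nonneg hw.one_le),
    fun μ => linJet_le_of_const hB hC hw.one_le (fun x hx i => ?_) μ⟩
  rw [(partialDeriv_congr (outerWeight_eventuallyEq w hx) i).eq_of_nhds, partialDeriv_const]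
  rfl

theorem Core.pow (hB : CoefBounds b σ τ κ c) (hw : ∀ x, 1 ≤ w x) (hJ : Core b σ τ κ J) (k : ℕ) :
    Core b σ τ κ fun μ => J μ ^ k := by
  simpa using hJ.aeval hB hw (Polynomial.X ^ k)

theorem moment_le_of_outerJet_le (hw : IsWeight w) (hB : CoefBounds b σ τ κ c) {A : ℝ}
    (hA : ∀ μ : Pw w, 0 ≤ ∫ x, innerWeight w x ∂μ.meas ∧ ∫ x, innerWeight w x ∂μ.meas ≤ A) {R : ℝ}
    {μ : Pw w} (h : (outerJet b σ τ μ).val ≤ R) : μ.moment ≤ R + A := by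
  rw [outerJet_val hw hB] at h
  linarith [(hA μ).2]

/-- A jet in the closure whose drift vanishes for large outer weight has bounded drift. -/
theorem Core.exists_drift_le (hw : IsWeight w) (hB : CoefBounds b σ τ κ c) (hJ : Core b σ τ κ J)
    {R : ℝ} (h : ∀ μ, R < (outerJet b σ τ μ).val → (J μ).drift = 0) :
    ∃ k, ∀ μ, |(J μ).drift| ≤ k := by
  obtain ⟨A, -, -, hA⟩ := hw.exists_innerWeight_le
  obtain ⟨C, hC⟩ := hJ.exists_le hB.one_le_κ
  obtain ⟨K, hK⟩ := hB.κ_bdd (R + A)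
  refine ⟨|K * C|, fun μ => ?_⟩
  rcases lt_or_ge R (outerJet b σ τ μ).val with hμ | hμ
  · rw [h μ hμ, abs_zero]; exact abs_nonneg _
  · refine (hC μ).2.2.trans (le_trans ?_ (le_abs_self _))
    exact mul_le_mul_of_nonneg_right (hK μ (moment_le_of_outerJet_le hw hB hA hμ)) (hC μ).nonneg

/-- The smooth truncation of `⟨w, ·⟩` at level `R`: with `Z` the outer weight functional and `Ψ`
the inner one, it is `T(Z + A) - ρ(Z) (A - Ψ)`, where `T = softMin R` and `ρ = stepDown r`. This is
`Z + Ψ = ⟨w, ·⟩` as long as `Z ≤ r` and `Z + A ≤ R`, and `T(Z + A)`, with drift free of `κ`, once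
`Z ≥ r + 1`. -/
def truncJet (b : Pw w → Rd d → Rd d) (σ τ : Pw w → Rd d → Matrix (Fin d) (Fin d) ℝ)
    (A r R : ℝ) (μ : Pw w) : Jet d :=
  Jet.comp (fun y => softMin R (y + A)) (outerJet b σ τ μ)
    - Jet.comp (stepDown r) (outerJet b σ τ μ)
      * (algebraMap ℝ (Jet d) A - linJet b σ τ (innerWeight w) μ)

theorem contDiff_softMin_add (R A : ℝ) : ContDiff ℝ 2 fun y => softMin R (y + A) :=
  (contDiff_softMin R).comp (contDiff_id.add contDiff_const)

theorem deriv_softMin_add (R A : ℝ) :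
    (deriv fun y => softMin R (y + A)) = fun y => stepDown R (y + A) := by
  funext y
  rw [deriv_comp_add_const (f := softMin R), deriv_softMin]

theorem core_truncJet (hw : IsWeight w) (hB : CoefBounds b σ τ κ c) (A r R : ℝ) :
    Core b σ τ κ (truncJet b σ τ A r R) := by
  obtain ⟨D, hD⟩ := hw.exists_adm_innerWeight
  have h1 : Core b σ τ κ fun μ => Jet.comp (fun y => softMin R (y + A)) (outerJet b σ τ μ) := by
    have hF : ContDiff ℝ 2 fun y => softMin R (y + A) + -softMin R (R + 1) :=
      (contDiff_softMin_add R A).add contDiff_const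
    have h := (core_comp_outerJet hw hB hF ⟨R + 1 - A, fun y hy => by
      rw [softMin_of_ge (by linarith)]; ring⟩).add hB hw.one_le
        (core_const hw.one_le (softMin R (R + 1)))
    convert h using 2 with μ
    rw [Jet.comp_add (contDiff_softMin_add R A) contDiff_const, Jet.comp_const, map_neg]
    ring
  have h2 := (locCore_const hB hw.one_le (core_exp_neg_outerJet hw hB) A).add hB hw.one_le
    ((locCore_const hB hw.one_le (core_exp_neg_outerJet hw hB) (-1)).mul hB hw.one_le
      (locCore_linJet hw hB hD))
  have h3 := h2 _ (contDiff_stepDown r) ⟨r + 1, fun y hy => stepDown_of_ge hy⟩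
  have h4 := h1.sub hB hw.one_le h3
  convert h4 using 2 with μ
  rw [truncJet, map_neg, map_one]
  ring

/-- Lyapunov functions `h n` in the bounded closure which agree with `⟨w, ·⟩` at the given point `μ₀`
and dominate it where the outer weight is at most `n`. The drift of `(h n) ^ k` is at most a multiple
of `(h n) ^ k`, uniformly in `n`. -/
theorem exists_lyapunov (hw : IsWeight w) (hB : CoefBounds b σ τ κ c) (μ₀ : Pw w) :
    ∃ (h : ℕ → Pw w → Jet d) (C : ℝ), 0 < C ∧
      (∀ n k, Core b σ τ κ fun μ => h n μ ^ k) ∧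
      (∀ n k, ∃ K, ∀ μ, |(h n μ ^ k).drift| ≤ K) ∧
      (∀ n (k : ℕ) μ, (h n μ ^ k).drift ≤ k * (k + 1) * C * (h n μ).val ^ k) ∧
      (∀ n, (h n μ₀).val = μ₀.moment) ∧ (∀ n μ, 1 ≤ (h n μ).val) ∧
      ∀ (n : ℕ) μ, (outerJet b σ τ μ).val ≤ n → μ.moment ≤ (h n μ).val := by
  obtain ⟨A, hA1, -, hA⟩ := hw.exists_innerWeight_le
  obtain ⟨K, hK0, hK⟩ := exists_outerJet_le hw hB
  obtain ⟨D, hD⟩ := hw.exists_adm_innerWeight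
  obtain ⟨Do, hDo⟩ := hw.exists_adm_outerWeight
  obtain ⟨M, hM0, hM⟩ := exists_bound_stepDown
  set r : ℝ := μ₀.moment with hr
  have hr1 : 1 ≤ r := μ₀.one_le_moment hw.one_le
  obtain ⟨κ₀, hκ₀⟩ := hB.κ_bdd (r + 1 + A)
  -- the correction term is bounded since it lives on a set of bounded moments
  set S : Pw w → Jet d := fun μ => Jet.comp (stepDown r) (outerJet b σ τ μ)
      * (algebraMap ℝ (Jet d) A - linJet b σ τ (innerWeight w) μ) with hS
  have hvy : ∀ μ, (outerJet b σ τ μ).val = μ.moment - ∫ x, innerWeight w x ∂μ.meas :=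
    outerJet_val hw hB
  have hv1 : ∀ μ, 1 ≤ (outerJet b σ τ μ).val := fun μ => by
    have h := integral_mono (μ := μ.meas) (integrable_const 1) (hDo.integrable μ)
      hw.one_le_outerWeight
    rw [outerJet, linJet_val]
    simpa using h
  have hS0 : ∀ μ, r + 1 < (outerJet b σ τ μ).val → S μ = 0 := fun μ hμ => by
    simp only [hS]
    rw [Jet.comp_congr (stepDown_eventuallyEq_zero hμ), Jet.comp_const, map_zero, zero_mul]
  obtain ⟨B, hB0, hSB⟩ : ∃ B, 0 ≤ B ∧ ∀ μ, (S μ).drift ≥ -B ∧ ∀ i, |(S μ).grad i| ≤ B := by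
    have hp := (((polyLe_linJet hB hw.one_le hDo).comp hB hw.one_le (F := stepDown r) hM0
      (fun _ => (hM _ _).1) (fun _ => (hM _ _).2.1) (fun _ => (hM _ _).2.2))).mul hB
      ((polyLe_const hB A).add hB hw.one_le ((polyLe_const hB (-1)).mul hB
        (polyLe_linJet hB hw.one_le hD)))
    have hSe : ∀ μ, S μ = Jet.comp (stepDown r) (linJet b σ τ (outerWeight w) μ)
        * (algebraMap ℝ (Jet d) A + algebraMap ℝ (Jet d) (-1) * linJet b σ τ (innerWeight w) μ) :=
      fun μ => by simp only [hS, outerJet, map_neg, map_one]; ring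
    simp only [PolyLe, ← hSe] at hp
    obtain ⟨hE0, hE⟩ := hp
    generalize (d + 2 : ℝ) * _ = E at hE0 hE
    generalize 2 * 1 + (0 + (0 + 1)) = N at hE
    refine ⟨max 1 κ₀ * (E * (r + 1 + A) ^ N), by positivity, fun μ => ?_⟩
    have hEN : 0 ≤ E * (r + 1 + A) ^ N := by positivity
    rcases lt_or_ge (r + 1) (outerJet b σ τ μ).val with hμ | hμ
    · rw [hS0 μ hμ]
      have : 0 ≤ max 1 κ₀ * (E * (r + 1 + A) ^ N) := by positivity
      exact ⟨by rw [Jet.zero_drift]; linarith, fun i => by rw [Jet.zero_grad]; simpa using this⟩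
    · have hz : μ.moment ≤ r + 1 + A := moment_le_of_outerJet_le hw hB hA hμ
      have hz0 : 0 ≤ μ.moment := zero_le_one.trans (μ.one_le_moment hw.one_le)
      have h1 : E * μ.moment ^ N ≤ E * (r + 1 + A) ^ N := by gcongr
      have hκ := hB.one_le_κ μ
      refine ⟨?_, fun i => ?_⟩
      · have h2 : κ μ * (E * μ.moment ^ N) ≤ max 1 κ₀ * (E * (r + 1 + A) ^ N) :=
          mul_le_mul ((hκ₀ μ hz).trans (le_max_right _ _)) h1 (by positivity) (by positivity)
        exact neg_le_of_abs_le ((hE μ).2.2.trans h2)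
      · refine ((hE μ).2.1 i).trans (h1.trans ?_)
        exact le_mul_of_one_le_left hEN (le_max_left _ _)
  -- the truncation in `h n` acts where the correction term has already vanished
  set R : ℕ → ℝ := fun n => r + 1 + A + n with hR
  have hR0 : ∀ n, 0 ≤ R n := fun n => by simp only [hR]; positivity
  have hRn : ∀ n, r + 1 + A ≤ R n := fun n => by simp [hR]
  set h : ℕ → Pw w → Jet d := fun n => truncJet b σ τ A r (R n) with hh
  have hhS : ∀ n μ, h n μ = Jet.comp (fun y => softMin (R n) (y + A)) (outerJet b σ τ μ) - S μ :=
    fun n μ => rfl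
  have hval : ∀ n μ, (h n μ).val = softMin (R n) ((outerJet b σ τ μ).val + A)
      - stepDown r (outerJet b σ τ μ).val * (A - ∫ x, innerWeight w x ∂μ.meas) := fun n μ => by
    simp [hh, truncJet, linJet_val]
  have hle : ∀ n μ, (outerJet b σ τ μ).val + A ≤ R n → μ.moment ≤ (h n μ).val := fun n μ hμ => by
    rw [hval, softMin_of_le (hR0 n) hμ]
    have := mul_le_mul_of_nonneg_right (stepDown_le_one r (outerJet b σ τ μ).val)
      (sub_nonneg.2 (hA μ).2)
    have := hvy μ
    linarith
  have hle' : ∀ n μ, (outerJet b σ τ μ).val + A ≤ R n + 1 →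
      (outerJet b σ τ μ).val ≤ (h n μ).val := fun n μ hμ => by
    rcases le_or_gt ((outerJet b σ τ μ).val + A) (R n) with h1 | h1
    · have := hle n μ h1
      linarith [hvy μ, (hA μ).1]
    · have h2 := hRn n
      rw [hval, stepDown_of_ge (by linarith), zero_mul, sub_zero]
      linarith [sub_one_le_softMin (hR0 n) hμ]
  have hone : ∀ n μ, 1 ≤ (h n μ).val := fun n μ => by
    rcases le_or_gt ((outerJet b σ τ μ).val + A) (R n) with h1 | h1
    · exact (μ.one_le_moment hw.one_le).trans (hle n μ h1)
    · have h2 := hRn n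
      rw [hval, stepDown_of_ge (by linarith), zero_mul, sub_zero]
      have := monotone_softMin (R n) h1.le
      rw [softMin_of_le (hR0 n) le_rfl] at this
      linarith
  have hout : ∀ n μ, R n + 1 < (outerJet b σ τ μ).val + A →
      h n μ = algebraMap ℝ (Jet d) (softMin (R n) (R n + 1)) := fun n μ hμ => by
    have h2 := hRn n
    rw [hhS, hS0 μ (by linarith), sub_zero, ← Jet.comp_const]
    refine Jet.comp_congr ?_
    have h3 : ∀ᶠ y in 𝓝 (outerJet b σ τ μ).val, R n + 1 - A < y :=
      lt_mem_nhds (by linarith)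
    filter_upwards [h3] with y hy using softMin_of_ge (by linarith)
  -- drift and gradient are bounded by a multiple of the truncation itself
  set a : ℝ := K * (1 + A) + B with ha
  have ha0 : 0 ≤ a := by positivity
  have hJac : ∀ n μ, (h n μ).drift ≤ a * (h n μ).val ∧ ∀ i, |(h n μ).grad i| ≤ a * (h n μ).val := by
    intro n μ
    rcases lt_or_ge (R n + 1) ((outerJet b σ τ μ).val + A) with hμ | hμ
    · have := mul_nonneg ha0 (zero_le_one.trans (hone n μ))
      rw [hout n μ hμ] at this ⊢
      exact ⟨by simpa using this, fun i => by simpa using this⟩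
    · have hz : μ.moment ≤ (1 + A) * (h n μ).val := by
        have h1 := hle' n μ hμ
        have h2 := hv1 μ
        have h3 := hvy μ
        have h4 := (hA μ).2
        nlinarith
      have hKz : K * μ.moment ≤ K * (1 + A) * (h n μ).val := by
        rw [mul_assoc]; exact mul_le_mul_of_nonneg_left hz hK0
      have hz0 : 0 ≤ K * μ.moment :=
        mul_nonneg hK0 (zero_le_one.trans (μ.one_le_moment hw.one_le))
      have hT0 := stepDown_nonneg (R n) ((outerJet b σ τ μ).val + A)
      have hT1 := stepDown_le_one (R n) ((outerJet b σ τ μ).val + A)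
      have hBv : B ≤ B * (h n μ).val := le_mul_of_one_le_right hB0 (hone n μ)
      have habs : ∀ y, |y| ≤ K * μ.moment →
          |stepDown (R n) ((outerJet b σ τ μ).val + A) * y| ≤ K * μ.moment := fun y hy => by
        rw [abs_mul, abs_of_nonneg hT0]
        exact (mul_le_mul hT1 hy (abs_nonneg _) zero_le_one).trans_eq (one_mul _)
      have hd2 : deriv (deriv fun y => softMin (R n) (y + A)) (outerJet b σ τ μ).val ≤ 0 := by
        rw [deriv_softMin_add, deriv_comp_add_const (f := stepDown (R n))]
        exact deriv_stepDown_nonpos _ _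
      refine ⟨?_, fun i => ?_⟩
      · have h1 := (le_abs_self _).trans (habs _ (by simpa using (hK μ).2.2))
        have h2 := mul_nonneg (neg_nonneg.2 hd2) (outerJet b σ τ μ).normSq_nonneg
        have h3 := (hSB μ).1
        have h4 : (h n μ).drift = stepDown (R n) ((outerJet b σ τ μ).val + A)
              * (outerJet b σ τ μ).drift
            + deriv (deriv fun y => softMin (R n) (y + A)) (outerJet b σ τ μ).val / 2
              * (outerJet b σ τ μ).normSq - (S μ).drift := by
          rw [hhS, Jet.sub_drift, Jet.comp_drift]
          congr 3
          rw [deriv_softMin_add]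
        rw [h4, ha, add_mul]
        linarith
      · rw [hhS, Jet.sub_grad, Jet.comp_grad, deriv_softMin_add, ← hhS]
        refine (abs_sub _ _).trans ?_
        rw [ha, add_mul]
        exact add_le_add ((habs _ ((hK μ).2.1 i)).trans hKz) (((hSB μ).2 i).trans hBv)
  -- concavity of the truncation gives the second order term of the drift a good sign above; only
  -- the powers of `h n` produce a squared gradient
  have hnsq : ∀ n μ, (h n μ).normSq ≤ d * a ^ 2 * (h n μ).val ^ 2 := fun n μ => by
    have h1 : ∀ i ∈ Finset.univ, (h n μ).grad i * (h n μ).grad i ≤ (a * (h n μ).val) ^ 2 :=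
      fun i _ => by
        rw [← sq, ← sq_abs]
        exact pow_le_pow_left₀ (abs_nonneg _) ((hJac n μ).2 i) 2
    refine (Finset.sum_le_card_nsmul _ _ _ h1).trans_eq ?_
    simp; ring
  refine ⟨h, 1 + a + d * a ^ 2, by positivity, fun n k => ?_, fun n k => ?_, fun n k μ => ?_,
    fun n => ?_, hone, fun n μ hμ => hle n μ (by simp only [hR]; linarith)⟩
  · exact (core_truncJet hw hB A r (R n)).pow hB hw.one_le k
  · refine ((core_truncJet hw hB A r (R n)).pow hB hw.one_le k).exists_drift_le hw hB
      (R := R n + 1 - A) fun μ hμ => ?_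
    rw [hout n μ (by linarith), ← map_pow]
    exact Jet.algebraMap_drift _
  · have hv := zero_le_one.trans (hone n μ)
    rw [Jet.pow_drift]
    have e1 : (k : ℝ) * (h n μ).val ^ (k - 1) * (h n μ).drift ≤ k * a * (h n μ).val ^ k := by
      rcases k with _ | k
      · simp
      · have := mul_le_mul_of_nonneg_left (hJac n μ).1
          (show 0 ≤ ((k + 1 : ℕ) : ℝ) * (h n μ).val ^ k by positivity)
        refine this.trans_eq ?_
        rw [pow_succ]; ring
    have e2 : (k * (k - 1) / 2 : ℝ) * (h n μ).val ^ (k - 2) * (h n μ).normSq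
        ≤ k * (k - 1) / 2 * (d * a ^ 2) * (h n μ).val ^ k := by
      rcases k with _ | _ | k
      · simp
      · simp
      · have hk : (0 : ℝ) ≤ ((k + 1 + 1 : ℕ) : ℝ) * (((k + 1 + 1 : ℕ) : ℝ) - 1) / 2 := by
          push_cast
          have : (0 : ℝ) ≤ (k : ℝ) + 1 + 1 - 1 := by linarith [Nat.cast_nonneg (α := ℝ) k]
          positivity
        have := mul_le_mul_of_nonneg_left (hnsq n μ)
          (show 0 ≤ ((k + 1 + 1 : ℕ) : ℝ) * (((k + 1 + 1 : ℕ) : ℝ) - 1) / 2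
            * (h n μ).val ^ k by positivity)
        refine this.trans_eq ?_
        rw [show k + 1 + 1 = k + 2 from rfl, pow_add]; ring
    refine (add_le_add e1 e2).trans ?_
    rw [← add_mul]
    refine mul_le_mul_of_nonneg_right ?_ (by positivity)
    have hk0 : (0 : ℝ) ≤ k := Nat.cast_nonneg k
    have hda : 0 ≤ d * a ^ 2 := by positivity
    nlinarith [mul_nonneg hk0 ha0, mul_nonneg (mul_nonneg hk0 hk0) ha0, mul_nonneg hk0 hda,
      mul_nonneg (mul_nonneg hk0 hk0) hda, mul_nonneg hk0 hk0]
  · have h1 : (outerJet b σ τ μ₀).val ≤ r := by linarith [hvy μ₀, (hA μ₀).1]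
    rw [hval, stepDown_of_le h1, softMin_of_le (hR0 n) (by linarith [hRn n]), hvy μ₀]
    ring

end Lyapunov

/-! ### Passing to the limit in moments and martingales -/

section Limits

variable {Ω : Type*} [m : MeasurableSpace Ω] {P : Measure Ω} {ℱ : Filtration ℝ≥0 m}

/-- Fatou's lemma for a function that is eventually dominated by functions of bounded integral. -/
theorem integrable_and_integral_le_of_eventually_le {f : Ω → ℝ} {g : ℕ → Ω → ℝ} {B : ℝ}
    (hf : AEStronglyMeasurable f P) (hf0 : 0 ≤ f) (hg : ∀ n, Integrable (g n) P)
    (hg0 : ∀ n, 0 ≤ g n) (hB : ∀ n, ∫ ω, g n ω ∂P ≤ B)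
    (h : ∀ᵐ ω ∂P, ∀ᶠ n in atTop, f ω ≤ g n ω) : Integrable f P ∧ ∫ ω, f ω ∂P ≤ B := by
  have hB0 : 0 ≤ B := (integral_nonneg (hg0 0)).trans (hB 0)
  have h1 : ∫⁻ ω, ENNReal.ofReal (f ω) ∂P ≤ ENNReal.ofReal B := by
    calc ∫⁻ ω, ENNReal.ofReal (f ω) ∂P
        ≤ ∫⁻ ω, liminf (fun n => ENNReal.ofReal (g n ω)) atTop ∂P := by
          refine lintegral_mono_ae ?_
          filter_upwards [h] with ω hω
          refine le_liminf_of_le (by isBoundedDefault) ?_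
          filter_upwards [hω] with n hn using ENNReal.ofReal_le_ofReal hn
      _ ≤ liminf (fun n => ∫⁻ ω, ENNReal.ofReal (g n ω) ∂P) atTop :=
          lintegral_liminf_le' fun n => (hg n).aestronglyMeasurable.aemeasurable.ennreal_ofReal
      _ ≤ ENNReal.ofReal B := by
          refine liminf_le_of_le (by isBoundedDefault) fun b hb => ?_
          obtain ⟨n, hn⟩ := hb.exists
          refine hn.trans ?_
          rw [← ofReal_integral_eq_lintegral_ofReal (hg n) (ae_of_all _ (hg0 n))]
          exact ENNReal.ofReal_le_ofReal (hB n)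
  have hi : Integrable f P := by
    refine ⟨hf, ?_⟩
    rw [hasFiniteIntegral_iff_ofReal (ae_of_all _ hf0)]
    exact h1.trans_lt ENNReal.ofReal_lt_top
  refine ⟨hi, ?_⟩
  rw [integral_eq_lintegral_of_nonneg_ae (ae_of_all _ hf0) hf]
  exact ENNReal.toReal_le_of_le_ofReal hB0 h1

/-- Boundedness in `L²` and almost sure convergence give convergence in `L¹`. -/
theorem tendsto_integral_abs_sub_of_sq_le [IsFiniteMeasure P] {f : ℕ → Ω → ℝ} {g : Ω → ℝ} {B : ℝ}
    (hf : ∀ n, AEStronglyMeasurable (f n) P) (hf2 : ∀ n, Integrable (fun ω => f n ω ^ 2) P)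
    (hB : ∀ n, ∫ ω, f n ω ^ 2 ∂P ≤ B) (hg : AEStronglyMeasurable g P)
    (hg2 : Integrable (fun ω => g ω ^ 2) P)
    (hlim : ∀ᵐ ω ∂P, Tendsto (fun n => f n ω) atTop (𝓝 (g ω))) :
    Tendsto (fun n => ∫ ω, |f n ω - g ω| ∂P) atTop (𝓝 0) := by
  set D : ℝ := 2 * B + 2 * ∫ ω, g ω ^ 2 ∂P with hD
  have hB0 : 0 ≤ B := (integral_nonneg fun ω => sq_nonneg (f 0 ω)).trans (hB 0)
  have hD0 : 0 ≤ D := by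
    have : 0 ≤ ∫ ω, g ω ^ 2 ∂P := integral_nonneg fun ω => sq_nonneg (g ω)
    positivity
  have hmin : ∀ K : ℝ, 0 < K →
      Tendsto (fun n => ∫ ω, min |f n ω - g ω| K ∂P) atTop (𝓝 0) := fun K hK => by
    have h := tendsto_integral_of_dominated_convergence (μ := P)
      (F := fun n ω => min |f n ω - g ω| K) (f := fun _ => 0) (fun _ => K)
      (fun n => (((hf n).sub hg).norm.inf aestronglyMeasurable_const)) (integrable_const K)
      (fun n => ae_of_all _ fun ω => ?_) ?_
    · simpa using h
    · rw [Real.norm_of_nonneg (le_min (abs_nonneg _) hK.le)]; exact min_le_right _ _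
    · filter_upwards [hlim] with ω hω
      have h1 : Tendsto (fun n => min |f n ω - g ω| K) atTop (𝓝 (min |g ω - g ω| K)) :=
        ((hω.sub_const _).abs).min tendsto_const_nhds
      simpa [hK.le] using h1
  rw [Metric.tendsto_atTop']
  intro ε hε
  set K : ℝ := 2 * (D + 1) / ε with hK
  have hK0 : 0 < K := by positivity
  obtain ⟨N, hN⟩ := (Metric.tendsto_atTop'.1 (hmin K hK0)) (ε / 2) (by positivity)
  refine ⟨N, fun n hn => ?_⟩
  have h1 := (le_abs_self _).trans_lt (by simpa [Real.dist_eq] using hN n hn)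
  have hpt : ∀ ω, |f n ω - g ω| ≤ min |f n ω - g ω| K + (2 * f n ω ^ 2 + 2 * g ω ^ 2) / K := by
    intro ω
    rcases le_total |f n ω - g ω| K with h | h
    · rw [min_eq_left h]
      have : 0 ≤ (2 * f n ω ^ 2 + 2 * g ω ^ 2) / K := by positivity
      linarith
    · rw [min_eq_right h]
      have h2 : |f n ω - g ω| ≤ (2 * f n ω ^ 2 + 2 * g ω ^ 2) / K := by
        rw [le_div_iff₀ hK0]
        have := mul_le_mul_of_nonneg_left h (abs_nonneg (f n ω - g ω))
        nlinarith [abs_mul_abs_self (f n ω - g ω), sq_nonneg (f n ω + g ω)]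
      linarith
  have hi1 : Integrable (fun ω => min |f n ω - g ω| K) P := by
    refine (integrable_const K).mono' (((hf n).sub hg).norm.inf aestronglyMeasurable_const)
      (ae_of_all _ fun ω => ?_)
    rw [Real.norm_of_nonneg (le_min (abs_nonneg _) hK0.le)]; exact min_le_right _ _
  have hi2 : Integrable (fun ω => (2 * f n ω ^ 2 + 2 * g ω ^ 2) / K) P :=
    (((hf2 n).const_mul 2).add (hg2.const_mul 2)).div_const K
  have hi3 : Integrable (fun ω => |f n ω - g ω|) P :=
    (hi1.add hi2).mono' ((hf n).sub hg).norm (ae_of_all _ fun ω => by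
      rw [Real.norm_eq_abs, abs_abs]; exact hpt ω)
  have h2 := integral_mono hi3 (hi1.add hi2) hpt
  simp only [Pi.add_apply] at h2
  rw [integral_add hi1 hi2, integral_div, integral_add ((hf2 n).const_mul 2) (hg2.const_mul 2),
    integral_const_mul, integral_const_mul] at h2
  have h3 : (2 * ∫ ω, f n ω ^ 2 ∂P + 2 * ∫ ω, g ω ^ 2 ∂P) / K < ε / 2 := by
    rw [div_lt_iff₀ hK0, hK]
    have : ε / 2 * (2 * (D + 1) / ε) = D + 1 := by field_simp
    linarith [hB n]
  rw [Real.dist_eq, sub_zero, abs_of_nonneg (integral_nonneg fun ω => abs_nonneg _)]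
  linarith

/-- An almost sure limit of martingales that are bounded in `L²` is a martingale. -/
theorem martingale_of_tendsto_of_sq_le [IsFiniteMeasure P] {M : ℕ → ℝ≥0 → Ω → ℝ}
    {N : ℝ≥0 → Ω → ℝ} (hM : ∀ n, Martingale (M n) ℱ P) (hadp : StronglyAdapted ℱ N)
    {B : ℝ≥0 → ℝ} (hM2 : ∀ n t, Integrable (fun ω => M n t ω ^ 2) P)
    (hB : ∀ n t, ∫ ω, M n t ω ^ 2 ∂P ≤ B t) (hN2 : ∀ t, Integrable (fun ω => N t ω ^ 2) P)
    (hlim : ∀ t, ∀ᵐ ω ∂P, Tendsto (fun n => M n t ω) atTop (𝓝 (N t ω))) : Martingale N ℱ P := by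
  have hmeas : ∀ t, AEStronglyMeasurable (N t) P := fun t =>
    ((hadp t).mono (ℱ.le t)).aestronglyMeasurable
  have hint : ∀ t, Integrable (N t) P := fun t =>
    ((memLp_two_iff_integrable_sq (hmeas t)).2 (hN2 t)).integrable one_le_two
  have hlim' : ∀ t (F : Set Ω), Tendsto (fun n => ∫ ω in F, M n t ω ∂P) atTop
      (𝓝 (∫ ω in F, N t ω ∂P)) := fun t F => by
    rw [tendsto_iff_dist_tendsto_zero]
    refine squeeze_zero (fun _ => dist_nonneg) (fun n => ?_)
      (tendsto_integral_abs_sub_of_sq_le (fun n => ((hM n).integrable t).aestronglyMeasurable)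
        (fun n => hM2 n t) (fun n => hB n t) (hmeas t) (hN2 t) (hlim t))
    have hi := ((hM n).integrable t).sub (hint t)
    rw [Real.dist_eq, ← integral_sub ((hM n).integrable t).integrableOn (hint t).integrableOn]
    refine (abs_integral_le_integral_abs).trans ?_
    exact setIntegral_le_integral hi.abs (ae_of_all _ fun ω => abs_nonneg _)
  refine martingale_of_setIntegral_eq hadp hint fun s t hst F hF => ?_
  refine tendsto_nhds_unique (hlim' s F) ((hlim' t F).congr fun n => ?_)
  exact ((hM n).setIntegral_eq hst hF).symm

end Limits

/-! ### Moments of the weight functional -/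

section Moments

variable {Ω : Type*} [m : MeasurableSpace Ω] {P : Measure Ω} {ℱ : Filtration ℝ≥0 m}
  {d : ℕ} {w : Rd d → ℝ} {b : Pw w → Rd d → Rd d}
  {σ τ : Pw w → Rd d → Matrix (Fin d) (Fin d) ℝ} {κ : Pw w → ℝ} {c : ℝ} {μ₀ : Pw w}
  {X : ℝ≥0 → Ω → Pw w}

theorem integral_val_zero [IsProbabilityMeasure P] {J : Pw w → Jet d}
    (hX : ∀ᵐ ω ∂P, X 0 ω = μ₀) : ∫ ω, (J (X 0 ω)).val ∂P = (J μ₀).val := by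
  have : (fun ω => (J (X 0 ω)).val) =ᵐ[P] fun _ => (J μ₀).val := by
    filter_upwards [hX] with ω hω
    rw [hω]
  rw [integral_congr_ae this]
  simp

/-- Moment bounds for `⟨w, X⟩`, from truncations whose powers satisfy a Gronwall inequality. -/
theorem integrable_moment_pow_and_le [IsProbabilityMeasure P] (hB : CoefBounds b σ τ κ c)
    (hw : IsWeight w) (hX : SolvesMartingaleProblem (generator b σ τ) (Dw w) μ₀ P ℱ X)
    {h : ℕ → Pw w → Jet d} {C : ℝ} {k : ℕ} (hcore : ∀ n, Core b σ τ κ fun μ => h n μ ^ k)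
    (hbdd : ∀ n, ∃ K, ∀ μ, |(h n μ ^ k).drift| ≤ K)
    (hdrift : ∀ n μ, (h n μ ^ k).drift ≤ k * (k + 1) * C * (h n μ).val ^ k)
    (hinit : ∀ n, (h n μ₀).val = μ₀.moment) (hone : ∀ n μ, 1 ≤ (h n μ).val)
    (hle : ∀ (n : ℕ) μ, (outerJet b σ τ μ).val ≤ n → μ.moment ≤ (h n μ).val) (t : ℝ≥0) :
    Integrable (fun ω => (X t ω).moment ^ k) P ∧
      ∫ ω, (X t ω).moment ^ k ∂P ≤ μ₀.moment ^ k * Real.exp (k * (k + 1) * C * t) := by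
  have hz0 : ∀ μ : Pw w, 0 ≤ μ.moment := fun μ => zero_le_one.trans (μ.one_le_moment hw.one_le)
  have hreg := isRegProcess_comp hX.adapted hX.rcll (Pw.continuous_moment (w := w))
  have hD : ∀ n, HasDrift ℱ P (fun t ω => (h n (X t ω) ^ k).val)
      fun t ω => (h n (X t ω) ^ k).drift := fun n => by
    obtain ⟨K, hK⟩ := hbdd n
    exact (hcore n).hasDrift hB hX hK
  refine integrable_and_integral_le_of_eventually_le (g := fun n ω => (h n (X t ω) ^ k).val)
    ((hreg.stronglyMeasurable t).pow k).aestronglyMeasurable (fun ω => pow_nonneg (hz0 _) k)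
    (fun n => (hD n).integrable t) (fun n ω => ?_) (fun n => ?_) (ae_of_all _ fun ω => ?_)
  · simp only [Jet.pow_val]
    exact pow_nonneg (zero_le_one.trans (hone n _)) k
  · have h1 := (hD n).integral_le_exp (K := k * (k + 1) * C) (fun s ω => by
      rw [Jet.pow_val]; exact hdrift n _) t
    rw [integral_val_zero (J := fun μ => h n μ ^ k) hX.initial, Jet.pow_val, hinit] at h1
    rwa [mul_comm]
  · filter_upwards [eventually_ge_atTop ⌈(outerJet b σ τ (X t ω)).val⌉₊] with n hn
    rw [Jet.pow_val]
    exact pow_le_pow_left₀ (hz0 _) (hle n _ (Nat.ceil_le.1 hn)) k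

end Moments

/-! ### Powers of compensated processes -/

section Powers

variable {Ω : Type*} [m : MeasurableSpace Ω] {P : Measure Ω} {ℱ : Filtration ℝ≥0 m}

theorem HasDrift.sub {Y G Z H : ℝ≥0 → Ω → ℝ} [IsFiniteMeasure P] (hY : HasDrift ℱ P Y G)
    (hZ : HasDrift ℱ P Z H) :
    HasDrift ℱ P (fun t ω => Y t ω - Z t ω) fun t ω => G t ω - H t ω := by
  have h0 : IsRegProcess ℱ fun (_ : ℝ≥0) (_ : Ω) => (0 : ℝ) := .const 0
  have h := hY.add (hZ.mul_absolutelyContinuous h0 (locBounded_const 0) (-1))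
  simp only [primProc, prim_const, zero_mul, add_zero, neg_mul, one_mul, ← sub_eq_add_neg] at h
  exact h

/-- The drift of `Y ^ j * M ^ k`, when `Y = M + ∫ g` and `M` is a martingale with quadratic
variation `∫ Γ`. -/
def powDrift (j k : ℕ) (y x g Γ : ℝ) : ℝ :=
  j * y ^ (j - 1) * x ^ k * g
    + (j * (j - 1) / 2 * y ^ (j - 2) * x ^ k + j * k * y ^ (j - 1) * x ^ (k - 1)
      + k * (k - 1) / 2 * y ^ j * x ^ (k - 2)) * Γ

theorem powDrift_succ (j k : ℕ) (y v g Γ : ℝ) :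
    powDrift (j + 1) k y (y - v) g Γ - (v * powDrift j k y (y - v) g Γ + g * (y ^ j * (y - v) ^ k))
      = powDrift j (k + 1) y (y - v) g Γ := by
  rcases j with _ | _ | j <;> rcases k with _ | _ | k <;>
    simp only [powDrift, Nat.add_sub_cancel, Nat.zero_sub, Nat.reduceAdd, Nat.reduceSub,
      show ∀ n : ℕ, n + 1 + 1 - 2 = n from fun n => rfl] <;> push_cast <;> ring

/-- If the powers of `Y` have the drifts given by Itô's formula with drift `g` and squared gradient
`Γ`, then so do the products of powers of `Y` and of its compensated process. Only the product rule
with the absolutely continuous compensator enters. -/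
theorem hasDrift_pow_mul_pow [IsFiniteMeasure P] {Y g Γ : ℝ≥0 → Ω → ℝ}
    (hY : ∀ j : ℕ, HasDrift ℱ P (fun t ω => Y t ω ^ j)
      fun t ω => j * Y t ω ^ (j - 1) * g t ω + j * (j - 1) / 2 * Y t ω ^ (j - 2) * Γ t ω)
    (hg : IsRegProcess ℱ g) (hgb : LocBounded g) (V₀ : ℝ) (k : ℕ) :
    ∀ j, HasDrift ℱ P (fun t ω => Y t ω ^ j * (Y t ω - (V₀ + primProc g t ω)) ^ k)
      fun t ω => powDrift j k (Y t ω) (Y t ω - (V₀ + primProc g t ω)) (g t ω) (Γ t ω) := by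
  induction k with
  | zero =>
    intro j
    simpa [powDrift] using hY j
  | succ k ih =>
    intro j
    have h := (ih (j + 1)).sub ((ih j).mul_absolutelyContinuous hg hgb V₀)
    simp only [powDrift_succ] at h
    convert h using 3 with t ω
    ring

end Powers

/-! ### The martingale problem for polynomial functionals -/

section Polynomials

variable {Ω : Type*} [m : MeasurableSpace Ω] {P : Measure Ω} {ℱ : Filtration ℝ≥0 m}
  {d : ℕ} {w : Rd d → ℝ} {b : Pw w → Rd d → Rd d}
  {σ τ : Pw w → Rd d → Matrix (Fin d) (Fin d) ℝ} {κ : Pw w → ℝ} {c : ℝ} {μ₀ : Pw w}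
  {X : ℝ≥0 → Ω → Pw w} {J T H : Pw w → Jet d}

/-- Itô's formula for powers of a jet in the bounded closure that vanishes for large outer
weight. -/
theorem Core.hasDrift_pow [IsFiniteMeasure P] (hw : IsWeight w) (hB : CoefBounds b σ τ κ c)
    (hX : SolvesMartingaleProblem (generator b σ τ) (Dw w) μ₀ P ℱ X) (hT : Core b σ τ κ T) {R : ℝ}
    (hT0 : ∀ μ, R < (outerJet b σ τ μ).val → T μ = 0) (j : ℕ) :
    HasDrift ℱ P (fun t ω => (T (X t ω)).val ^ j)
      fun t ω => j * (T (X t ω)).val ^ (j - 1) * (T (X t ω)).drift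
        + j * (j - 1) / 2 * (T (X t ω)).val ^ (j - 2) * (T (X t ω)).normSq := by
  have hTj := hT.pow hB hw.one_le j
  obtain ⟨K, hK⟩ := hTj.exists_drift_le hw hB (R := R) fun μ hμ => by
    rw [hT0 μ hμ, Jet.pow_drift]; simp [Jet.normSq]
  simpa only [Jet.pow_val, Jet.pow_drift] using hTj.hasDrift hB hX hK

/-- The process `f(X_t) - f(μ₀) - ∫₀ᵗ L f(X_s) ds`, where the values of `f` and of `L f` are read off
from the jet `T` of `f`, and the deterministic initial value stands for `X_0`. -/
def compensated (T : Pw w → Jet d) (μ₀ : Pw w) (X : ℝ≥0 → Ω → Pw w) (t : ℝ≥0) (ω : Ω) : ℝ :=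
  (T (X t ω)).val - ((T μ₀).val + primProc (fun s ω => (T (X s ω)).drift) t ω)

theorem martingale_compensated [IsFiniteMeasure P] (hw : IsWeight w) (hB : CoefBounds b σ τ κ c)
    (hX : SolvesMartingaleProblem (generator b σ τ) (Dw w) μ₀ P ℱ X) (hT : Core b σ τ κ T) {R : ℝ}
    (hT0 : ∀ μ, R < (outerJet b σ τ μ).val → T μ = 0) :
    Martingale (compensated T μ₀ X) ℱ P := by
  have h := (hT.hasDrift_pow hw hB hX hT0 1).martingale.sub
    (martingale_const ℱ P (T μ₀).val)
  convert h using 1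
  funext t ω
  simp [compensated]
  ring

/-- A crude form of Young's inequality. -/
theorem pow_mul_le_add_pow {x y : ℝ} (hx : 0 ≤ x) (hy : 0 ≤ y) (k : ℕ) :
    x ^ k * y ≤ x ^ (k + 1) + y ^ (k + 1) := by
  rcases le_total x y with h | h
  · have := mul_le_mul_of_nonneg_right (pow_le_pow_left₀ hx h k) hy
    rw [← pow_succ] at this
    linarith [pow_nonneg hx (k + 1)]
  · have := mul_le_mul_of_nonneg_left h (pow_nonneg hx k)
    rw [← pow_succ] at this
    linarith [pow_nonneg hy (k + 1)]

/-- Moment bound for the martingale of a truncated functional. Its even powers satisfy a Gronwall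
inequality once a power of the Lyapunov function `H` controlling the squared gradient is added; the
drift of `T` does not enter the bound. -/
theorem integral_compensated_pow_le [IsProbabilityMeasure P] (hw : IsWeight w)
    (hB : CoefBounds b σ τ κ c)
    (hX : SolvesMartingaleProblem (generator b σ τ) (Dw w) μ₀ P ℱ X) (hT : Core b σ τ κ T) {R : ℝ}
    (hT0 : ∀ μ, R < (outerJet b σ τ μ).val → T μ = 0) {q k : ℕ} {D E : ℝ} (hD : 0 ≤ D)
    (hH : Core b σ τ κ fun μ => H μ ^ q) (hHb : ∃ K, ∀ μ, |(H μ ^ q).drift| ≤ K)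
    (hHd : ∀ μ, (H μ ^ q).drift ≤ E * (H μ).val ^ q) (hH1 : ∀ μ, 1 ≤ (H μ).val) (hE : 0 ≤ E)
    (hΓ : ∀ μ, (T μ).normSq ^ (k + 1) ≤ D * (H μ).val ^ q) (t : ℝ≥0) :
    Integrable (fun ω => compensated T μ₀ X t ω ^ (2 * (k + 1))) P ∧
      ∫ ω, compensated T μ₀ X t ω ^ (2 * (k + 1)) ∂P
        ≤ Real.exp (((k + 1) * (2 * k + 1) * (1 + D) + E) * t) * (H μ₀).val ^ q := by
  obtain ⟨K, hK⟩ := hHb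
  have hT1 := hT.hasDrift_pow hw hB hX hT0
  have hg : IsRegProcess ℱ fun t ω => (T (X t ω)).drift := by simpa using (hT1 1).regular_drift
  have hgb : LocBounded fun t ω => (T (X t ω)).drift := by simpa using (hT1 1).bdd_drift
  have hM : HasDrift ℱ P (fun t ω => compensated T μ₀ X t ω ^ (2 * (k + 1))) fun t ω =>
      powDrift 0 (2 * (k + 1)) (T (X t ω)).val (compensated T μ₀ X t ω) (T (X t ω)).drift
        (T (X t ω)).normSq := by
    have h := hasDrift_pow_mul_pow hT1 hg hgb (T μ₀).val (2 * (k + 1)) 0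
    simp only [pow_zero, one_mul] at h
    exact h
  have hHq := hH.hasDrift hB hX hK
  have hQ := hM.add hHq
  have hMi := hM.integrable t
  have hHi := hHq.integrable t
  refine ⟨hMi, ?_⟩
  have hHp : ∀ s ω, 1 ≤ (H (X s ω) ^ q).val := fun s ω => by
    rw [Jet.pow_val]; exact one_le_pow₀ (hH1 _)
  have h1 := hQ.integral_le_exp (K := (k + 1) * (2 * k + 1) * (1 + D) + E) (fun s ω => ?_) t
  · have h0 : ∫ ω, (compensated T μ₀ X 0 ω ^ (2 * (k + 1)) + (H (X 0 ω) ^ q).val) ∂P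
        = (H μ₀).val ^ q := by
      have : (fun ω => compensated T μ₀ X 0 ω ^ (2 * (k + 1)) + (H (X 0 ω) ^ q).val)
          =ᵐ[P] fun _ => (H μ₀).val ^ q := by
        filter_upwards [hX.initial] with ω hω
        simp [compensated, hω, primProc, Jet.pow_val]
      rw [integral_congr_ae this]
      simp
    rw [h0] at h1
    refine le_trans (integral_mono hMi (hMi.add hHi) fun ω => ?_) h1
    have := hHp t ω
    simp only [Pi.add_apply]
    linarith
  · set x := compensated T μ₀ X s ω with hx
    set Γ := (T (X s ω)).normSq with hG
    have hΓ0 : 0 ≤ Γ := (T (X s ω)).normSq_nonneg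
    have hx2 : 0 ≤ x ^ 2 := sq_nonneg x
    have e1 : powDrift 0 (2 * (k + 1)) (T (X s ω)).val x (T (X s ω)).drift Γ
        = (k + 1) * (2 * k + 1) * ((x ^ 2) ^ k * Γ) := by
      rw [powDrift, show 2 * (k + 1) - 2 = 2 * k by omega, ← pow_mul]
      push_cast
      ring
    have e2 : (x ^ 2) ^ k * Γ ≤ x ^ (2 * (k + 1)) + D * (H (X s ω) ^ q).val := by
      have h2 := pow_mul_le_add_pow hx2 hΓ0 k
      rw [← pow_mul] at h2
      have h3 := hΓ (X s ω)
      rw [Jet.pow_val]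
      rw [← pow_mul] at h2 ⊢
      linarith
    have e3 := hHd (X s ω)
    rw [← Jet.pow_val] at e3
    have hv := hHp s ω
    have hxp : 0 ≤ x ^ (2 * (k + 1)) := by rw [pow_mul]; positivity
    rw [e1]
    have hc : (0 : ℝ) ≤ (k + 1) * (2 * k + 1) := by positivity
    have e4 := mul_le_mul_of_nonneg_left e2 hc
    have e5 : 0 ≤ (k + 1 : ℝ) * (2 * k + 1) * (D * x ^ (2 * (k + 1)) + (H (X s ω) ^ q).val) := by
      have := mul_nonneg hD hxp
      positivity
    have e6 : 0 ≤ E * x ^ (2 * (k + 1)) := mul_nonneg hE hxp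
    linarith

/-- Path by path, the martingales of the truncated functionals are eventually equal to the
martingale of the functional. -/
theorem eventually_compensated_eq {Ω : Type*} {X : ℝ≥0 → Ω → Pw w} (hw : IsWeight w)
    (hB : CoefBounds b σ τ κ c) (hX : IsRCLL X)
    {f : SignedMeasure (Rd d) → ℝ} (hf : HasJet b σ τ f J) {ω : Ω} (h0 : X 0 ω = μ₀) (t : ℝ≥0) :
    ∀ᶠ n : ℕ in atTop,
      compensated (fun μ => J μ * Jet.comp (stepDown n) (outerJet b σ τ μ)) μ₀ X t ω
        = mgProcess (generator b σ τ) X f t ω := by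
  obtain ⟨D, hD⟩ := hw.exists_adm_outerWeight
  obtain ⟨K, hK⟩ := (hX.isRegPath (jetContinuous_linJet hw hB hD).1 ω).bdd t
  filter_upwards [eventually_gt_atTop ⌈K⌉₊] with n hn
  have hJ : ∀ s ≤ t, J (X s ω) * Jet.comp (stepDown n) (outerJet b σ τ (X s ω)) = J (X s ω) := by
    intro s hs
    have h1 : (outerJet b σ τ (X s ω)).val < n :=
      ((le_abs_self _).trans (hK s hs)).trans_lt (Nat.lt_of_ceil_lt hn)
    rw [Jet.comp_congr (stepDown_eventuallyEq_one h1), Jet.comp_const, map_one, mul_one]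
  have h2 := hJ 0 (zero_le (a := t))
  rw [h0] at h2
  simp only [compensated, hJ t le_rfl, h2, mgProcess, h0, (hf.generator_eq hB _).1,
    (hf.generator_eq hB _).2, primProc, prim]
  have h3 : ∫ s in (0 : ℝ)..t, (J (X s.toNNReal ω)
        * Jet.comp (stepDown n) (outerJet b σ τ (X s.toNNReal ω))).drift
      = ∫ s in (0 : ℝ)..t, (J (X s.toNNReal ω)).drift := by
    refine intervalIntegral.integral_congr fun s hs => ?_
    rw [Set.uIcc_of_le (NNReal.coe_nonneg t)] at hs
    rw [hJ _ (by rw [Real.toNNReal_le_iff_le_coe]; exact hs.2)]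
  rw [h3]
  ring

/-- The truncations of a jet of polynomial growth have polynomial growth, uniformly in the
truncation. -/
theorem exists_polyLe_truncation (hw : IsWeight w) (hB : CoefBounds b σ τ κ c) {N : ℕ} {C : ℝ}
    (hJ : PolyLe κ N C J) : ∃ N' C', ∀ n : ℕ,
      PolyLe κ N' C' fun μ => J μ * Jet.comp (stepDown n) (outerJet b σ τ μ) := by
  obtain ⟨D, hD⟩ := hw.exists_adm_outerWeight
  obtain ⟨M, hM0, hM⟩ := exists_bound_stepDown
  exact ⟨_, _, fun n => hJ.mul hB ((polyLe_linJet hB hw.one_le hD).comp hB hw.one_le hM0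
    (fun _ => (hM _ _).1) (fun _ => (hM _ _).2.1) (fun _ => (hM _ _).2.2))⟩

/-- For a polynomial functional, the process of the martingale problem is a martingale with finite
moments, as the limit of the martingales of its truncations. -/
theorem martingale_mgProcess_of_mem_Ew [IsProbabilityMeasure P] (hw : IsWeight w)
    (hB : CoefBounds b σ τ κ c)
    (hX : SolvesMartingaleProblem (generator b σ τ) (Dw w) μ₀ P ℱ X)
    {f : SignedMeasure (Rd d) → ℝ} (hf : f ∈ Ew w) :
    (∀ ω (t : ℝ≥0), IntervalIntegrable (fun s : ℝ => generator b σ τ f (X s.toNNReal ω)) volume 0 t) ∧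
    Martingale (mgProcess (generator b σ τ) X f) ℱ P ∧
      ∀ (k : ℕ) (t : ℝ≥0), MemLp (mgProcess (generator b σ τ) X f t) k P := by
  obtain ⟨J, hfJ, hJc, hJ, N₀, C₀, hJp⟩ := exists_locCore_of_mem_Ew hw hB hf
  obtain ⟨N, C, hTp⟩ := exists_polyLe_truncation hw hB hJp
  obtain ⟨H, E, hE, hH, hHb, hHd, hH0, hH1, hHle⟩ := exists_lyapunov hw hB μ₀
  set T : ℕ → Pw w → Jet d := fun n μ => J μ * Jet.comp (stepDown n) (outerJet b σ τ μ) with hTdef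
  have hT : ∀ n, Core b σ τ κ (T n) := fun n =>
    hJ _ (contDiff_stepDown n) ⟨n + 1, fun y hy => stepDown_of_ge hy⟩
  have hT0 : ∀ (n : ℕ) μ, (n : ℝ) + 1 < (outerJet b σ τ μ).val → T n μ = 0 := fun n μ hμ => by
    simp only [hTdef]
    rw [Jet.comp_congr (stepDown_eventuallyEq_zero hμ), Jet.comp_const, map_zero, mul_zero]
  have hC : 0 ≤ C := (hTp 0).1
  have hΓ : ∀ (k n : ℕ) μ, (T n μ).normSq ^ (k + 1)
      ≤ (d * (C * C)) ^ (k + 1) * (H (n + 1) μ).val ^ (2 * N * (k + 1)) := fun k n μ => by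
    have hv := zero_le_one.trans (hH1 (n + 1) μ)
    rcases lt_or_ge ((n : ℝ) + 1) (outerJet b σ τ μ).val with hμ | hμ
    · rw [hT0 n μ hμ, show (0 : Jet d).normSq = 0 by simp [Jet.normSq], zero_pow k.succ_ne_zero]
      positivity
    · have hz0 : 0 ≤ μ.moment := zero_le_one.trans (μ.one_le_moment hw.one_le)
      have hz := hHle (n + 1) μ (by push_cast; exact hμ)
      rw [pow_mul, ← mul_pow]
      refine pow_le_pow_left₀ (T n μ).normSq_nonneg (((hTp n).2 μ).normSq_le.trans ?_) _
      have : C * μ.moment ^ N * (C * μ.moment ^ N) = C * C * μ.moment ^ (2 * N) := by ring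
      rw [this, ← mul_assoc]
      gcongr
  have hbound : ∀ k : ℕ, ∃ B : ℝ≥0 → ℝ, ∀ (n : ℕ) t,
      Integrable (fun ω => compensated (T n) μ₀ X t ω ^ (2 * (k + 1))) P ∧
        ∫ ω, compensated (T n) μ₀ X t ω ^ (2 * (k + 1)) ∂P ≤ B t := fun k =>
    ⟨_, fun n t => by
      have h := integral_compensated_pow_le hw hB hX (hT n) (hT0 n) (by positivity)
        (hH (n + 1) _) (hHb (n + 1) _) (hHd (n + 1) _) (hH1 (n + 1)) (by positivity)
        (hΓ k n) t
      rwa [hH0] at h⟩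
  have hreg : IsRegProcess ℱ (mgProcess (generator b σ τ) X f) := by
    have h1 := isRegProcess_comp hX.adapted hX.rcll hJc.1
    have h2 := isRegProcess_comp hX.adapted hX.rcll hJc.2.2
    have h0 : IsRegProcess ℱ fun (_ : ℝ≥0) ω => (J (X 0 ω)).val :=
      ⟨fun t => (h1.adapted 0).mono (ℱ.mono (zero_le (a := t))), fun ω => .const _⟩
    convert (h1.sub h0).sub h2.primProc using 1
    funext t ω
    simp only [mgProcess, (hfJ.generator_eq hB _).1, (hfJ.generator_eq hB _).2, primProc, prim]
  have hlim : ∀ t, ∀ᵐ ω ∂P, ∀ᶠ n : ℕ in atTop,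
      compensated (T n) μ₀ X t ω = mgProcess (generator b σ τ) X f t ω := fun t => by
    filter_upwards [hX.initial] with ω hω
    exact eventually_compensated_eq hw hB hX.rcll hfJ hω t
  have hpow : ∀ (k : ℕ) t,
      Integrable (fun ω => mgProcess (generator b σ τ) X f t ω ^ (2 * (k + 1))) P := fun k t => by
    obtain ⟨B, hBd⟩ := hbound k
    have heven : ∀ x : ℝ, 0 ≤ x ^ (2 * (k + 1)) := fun x => by rw [pow_mul]; positivity
    refine (integrable_and_integral_le_of_eventually_le
      (g := fun n ω => compensated (T n) μ₀ X t ω ^ (2 * (k + 1)))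
      ((hreg.stronglyMeasurable t).pow _).aestronglyMeasurable (fun ω => heven _)
      (fun n => (hBd n t).1) (fun n ω => heven _) (fun n => (hBd n t).2) ?_).1
    filter_upwards [hlim t] with ω hω
    filter_upwards [hω] with n hn
    rw [hn]
    exact le_rfl
  refine ⟨fun ω t => ?_, ?_, fun k t => ?_⟩
  · simp only [(hfJ.generator_eq hB _).2]
    exact_mod_cast (hX.rcll.isRegPath hJc.2.2 ω).intervalIntegrable 0 t
  · obtain ⟨B, hBd⟩ := hbound 0
    refine martingale_of_tendsto_of_sq_le
      (fun n => martingale_compensated hw hB hX (hT n) (hT0 n)) hreg.adapted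
      (fun n t => (hBd n t).1) (fun n t => (hBd n t).2) (fun t => hpow 0 t) fun t => ?_
    filter_upwards [hlim t] with ω hω
    exact tendsto_const_nhds.congr' (hω.mono fun n hn => hn.symm)
  · have hmeas := (hreg.stronglyMeasurable t).aestronglyMeasurable (μ := P)
    have h2 : MemLp (mgProcess (generator b σ τ) X f t) ((2 * (k + 1) : ℕ) : ℝ≥0∞) P := by
      rw [← integrable_norm_rpow_iff hmeas (by simp) (ENNReal.natCast_ne_top _)]
      refine (hpow k t).congr (ae_of_all _ fun ω => ?_)
      simp only [ENNReal.toReal_natCast, Real.rpow_natCast, Real.norm_eq_abs]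
      rw [pow_mul, pow_mul, sq_abs]
    exact h2.mono_exponent (by exact_mod_cast (by omega : k ≤ 2 * (k + 1)))

end Polynomials

end MVJD

end

theorem proposition7p6 {d : ℕ} (w : MVJD.Rd d → ℝ) (hw : MVJD.IsWeight w)
    (b : MVJD.Pw w → MVJD.Rd d → MVJD.Rd d)
    (σ τ : MVJD.Pw w → MVJD.Rd d → Matrix (Fin d) (Fin d) ℝ)
    (hcoef : MVJD.CoefficientConditions 0 b σ τ) (μ₀ : MVJD.Pw w) :
    ∃ C : ℝ, 0 < C ∧ ∀ (Ω : Type*) [MeasurableSpace Ω] (P : Measure Ω) [IsProbabilityMeasure P]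
      (ℱ : Filtration ℝ≥0 ‹MeasurableSpace Ω›) (X : ℝ≥0 → Ω → MVJD.Pw w),
      MVJD.SolvesMartingaleProblem (MVJD.generator b σ τ) (MVJD.Dw w) μ₀ P ℱ X →
        (∀ (k : ℕ) (t : ℝ≥0), Integrable (fun ω => (X t ω).moment ^ k) P ∧
          ∫ ω, (X t ω).moment ^ k ∂P ≤ μ₀.moment ^ k * Real.exp (k * (k + 1) * C * t)) ∧
        MVJD.SolvesMartingaleProblem (MVJD.generator b σ τ) (MVJD.Ew w) μ₀ P ℱ X ∧
        ∀ f ∈ MVJD.Ew w,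
          Martingale (MVJD.mgProcess (MVJD.generator b σ τ) X f) ℱ P ∧
          ∀ (k : ℕ) (t : ℝ≥0), MemLp (MVJD.mgProcess (MVJD.generator b σ τ) X f t) k P := by
  obtain ⟨κ, c, hB⟩ := MVJD.exists_coefBounds hw hcoef
  obtain ⟨h, C, hC, hcore, hbdd, hdrift, hinit, hone, hle⟩ := MVJD.exists_lyapunov hw hB μ₀
  refine ⟨C, hC, fun Ω _ P _ ℱ X hX => ⟨fun k t => ?_, ⟨hX.adapted, hX.rcll, hX.initial,
    fun f hf => (MVJD.martingale_mgProcess_of_mem_Ew hw hB hX hf).1, fun f hf =>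
      Locally.of_prop (MVJD.martingale_mgProcess_of_mem_Ew hw hB hX hf).2.1⟩,
    fun f hf => (MVJD.martingale_mgProcess_of_mem_Ew hw hB hX hf).2⟩⟩
  exact MVJD.integrable_moment_pow_and_le hB hw hX (fun n => hcore n k) (fun n => hbdd n k)
    (fun n => hdrift n k) hinit hone hle t
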